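/- For $\varepsilon\in\mathbb R$ let $\mathcal W(\varepsilon)$ be the complex algebra generated by $a_+,a_-,b_+,b_-$ with relations $[a_-,a_+]=[b_-,b_+]=\varepsilon$ and $[a_\pm,b_\pm]=0$ (all four sign choices). Put $J_-=a_-b_+$, $K_0=\tfrac12(a_+a_-+b_+b_-+\varepsilon)$. Fix $R>0$ and let $\hat R=(R^2+\tfrac14\varepsilon^2)^{1/2}$. Let $\Psi$ be the ($\varepsilon$-independent) vector space of totally symmetric noncommutative polynomials in $a_\pm,b_\pm$ that are formally traceless: writing $\xi=w_1a_+a_-+w_2a_-a_++w_3b_+b_-+w_4b_-b_++\cdots$ according to the last two letters, $w_1+w_2+w_3+w_4=0$. For every $\varepsilon$, $\Psi$ embeds in $\mathcal W(\varepsilon)$ and $\mathcal W(\varepsilon)=\Psi\oplus\{w(K_0-\hat R):w\in\mathcal W(\varepsilon)\}$; let $\rho:\mathcal W(\varepsilon)\to\Psi$ be the projection along the second summand. $\Psi$ carries the product $(\xi,\zeta)\mapsto\rho(\xi\zeta)$ and the form $\langle\xi,\zeta\rangle=\pi_0(\rho(\xi^\dagger\zeta))$, where $\pi_0$ is the degree-$0$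 component and $\dagger$ is the antilinear anti-automorphism with $a_\pm^\dagger=a_\mp$, $b_\pm^\dagger=b_\mp$. For $2n,\,n+r,\,n+m\in\mathbb Z$, $n\ge 0$, $|r|,|m|\le n$ let $P(n,r,m)\in\Psi$ be the element, independent of $\varepsilon$ and $R$, given for $\varepsilon\neq0$ by $$P(n,r,m)=\varepsilon^{m-n}\Big(\tfrac{(n+m)!}{(2n)!\,(n-m)!}\Big)^{1/2}(\mathrm{Ad}\,J_-)^{n-m}\big(a_+^{n+r}b_-^{n-r}\big),$$ where $\mathrm{Ad}\,T(w)=[T,w]$. (1) As $\varepsilon\to0$, the product and the form converge to those at $\varepsilon=0$ (convergence in $\Psi$: bounded degree and convergence of all coefficients). At $\varepsilon=0$, $(\Psi,\rho)$ is isomorphic to the commutative associative algebra $C_0(SU(2))$ of complex polynomial functions on $SU(2)$ with pointwise multiplication. With the Euler angles $g(\alpha,\beta,\gamma)=e^{-i\alpha\sigma_3/2}e^{-i\beta\sigma_2/2}e^{-i\gamma\sigma_3/2}$, which cover $SU(2)$ for $\alpha\in[0,2\pi)$, $\beta\in[0,\pi]$, $\gamma\in[0,4\pi)$, this isomorphism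 is the evaluation $$a_\pm=\sqrt{2R}\,\cos(\beta/2)\,e^{\mp\frac i2(\alpha+\gamma)},\qquad b_\pm=\mp i\sqrt{2R}\,\sin(\beta/2)\,e^{\pm\frac i2(\alpha-\gamma)} .$$ (2) Under this identification $$P(n,r,m)\big|_{\varepsilon=0}=i^{\,m-r}(-1)^{n-r}(2R)^n\binom{2n}{n+r}^{-1/2}D^n_{mr}(\alpha,\beta,\gamma),$$ where $D^n_{mr}(\alpha,\beta,\gamma)=e^{-im\alpha}\,d^n_{mr}(\beta)\,e^{-ir\gamma}$ is Wigner's rotation matrix, with $$d^n_{m'm}(\beta)=\sqrt{(n+m')!(n-m')!(n+m)!(n-m)!}\;\sum_s\frac{(-1)^{m'-m+s}\cos(\beta/2)^{2n+m-m'-2s}\sin(\beta/2)^{m'-m+2s}}{(n+m-s)!\,s!\,(m'-m+s)!\,(n-m'-s)!}.$$ (3) At $\varepsilon=0$ the form is Hermitian and positive definite, and $$\langle\xi,\zeta\rangle=\frac1{16\pi^2}\int_0^{2\pi}d\alpha\int_0^{4\pi}d\gamma\int_0^\pi d\beta\,\sin\beta\;\overline{\xi}\,\zeta .$$ If $\xi$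 and $\zeta$ both have only components of even degree, or both only components of odd degree, then also $\langle\xi,\zeta\rangle=\frac1{8\pi^2}\int_0^{2\pi}d\alpha\int_0^{2\pi}d\gamma\int_0^\pi d\beta\,\sin\beta\,\overline\xi\zeta$. (4) There is a unique linear map $\delta_N:\Psi\to\Psi$ with $\delta_N(P(n,r,m))=n\,P(n,r,m)$. For all $\xi,\zeta\in\Psi\cong C_0(SU(2))$ the limit $\{\xi,\zeta\}=\lim_{\varepsilon\to0}\frac1{i\varepsilon}\rho([\xi,\zeta])$ exists in $\Psi$, and wherever $\sin\beta\ne0$, $$\{\xi,\zeta\}=\frac1{R\sin\beta}\Big(\frac{\partial\xi}{\partial\alpha}\frac{\partial\zeta}{\partial\beta}-\frac{\partial\xi}{\partial\beta}\frac{\partial\zeta}{\partial\alpha}\Big)+\frac1R\Big(\delta_N(\xi)\frac{\partial\zeta}{\partial\gamma}-\frac{\partial\xi}{\partial\gamma}\delta_N(\zeta)\Big)+\frac{\cot\beta}{R}\Big(\frac{\partial\xi}{\partial\beta}\frac{\partial\zeta}{\partial\gamma}-\frac{\partial\xi}{\partial\gamma}\frac{\partial\zeta}{\partial\beta}\Big).$$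 -/

import Mathlib

open scoped Topology

noncomputable section

namespace FuzzySU2

/-- The four generators `a₊, a₋, b₊, b₋`. -/
inductive Gen
  | ap | am | bp | bm
  deriving DecidableEq

/-- The free algebra of (noncommutative) polynomials in `a₊, a₋, b₊, b₋`: finite complex linear
combinations of words. -/
abbrev FreePoly : Type := MonoidAlgebra ℂ (FreeMonoid Gen)

/-- The coefficient of a word. -/
def wordCoeff (ξ : FreePoly) (l : List Gen) : ℂ := ξ.coeff (FreeMonoid.ofList l)

/-- A word as an element of the free algebra. -/
def word (l : List Gen) : FreePoly := MonoidAlgebra.single (FreeMonoid.ofList l) 1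

/-- A generator as an element of the free algebra. -/
def gen (g : Gen) : FreePoly := word [g]

/-! ### The algebra `𝒲(ε)` -/

/-- The relations `[a₋, a₊] ∼ ε`, `[b₋, b₊] ∼ ε`, `[a_±, b_±] ∼ 0` (all four sign choices). -/
inductive WeylRel (ε : ℝ) : FreePoly → FreePoly → Prop
  | a : WeylRel ε (gen .am * gen .ap - gen .ap * gen .am) (algebraMap ℂ FreePoly ε)
  | b : WeylRel ε (gen .bm * gen .bp - gen .bp * gen .bm) (algebraMap ℂ FreePoly ε)
  | ab (x y : Gen) (hx : x = .ap ∨ x = .am) (hy : y = .bp ∨ y = .bm) :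
      WeylRel ε (gen x * gen y - gen y * gen x) 0

/-- The product `𝒲(ε)` of two Heisenberg-Weil algebras. -/
abbrev Weyl (ε : ℝ) : Type := RingQuot (WeylRel ε)

/-- The class in `𝒲(ε)` of a noncommutative polynomial. -/
def toWeyl (ε : ℝ) : FreePoly →ₐ[ℂ] Weyl ε := RingQuot.mkAlgHom ℂ (WeylRel ε)

/-- `J₋ = a₋ b₊`. -/
def Jminus (ε : ℝ) : Weyl ε := toWeyl ε (gen .am * gen .bp)

/-- `K₀ = (a₊ a₋ + b₊ b₋ + ε) / 2`. -/
def K0 (ε : ℝ) : Weyl ε :=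
  (1 / 2 : ℂ) • (toWeyl ε (gen .ap * gen .am + gen .bp * gen .bm) + algebraMap ℂ (Weyl ε) ε)

/-- `R̂ = √(R² + ε²/4)`. -/
def Rhat (ε R : ℝ) : ℝ := Real.sqrt (R ^ 2 + ε ^ 2 / 4)

/-! ### The space `Ψ` -/

/-- The formal trace. Collecting the terms of `ξ` according to their last two letters,
`ξ = w₁ a₊a₋ + w₂ a₋a₊ + w₃ b₊b₋ + w₄ b₋b₊ + ⋯` (the other twelve pairs, and words with fewer than
two letters), the trace is `w₁ + w₂ + w₃ + w₄`; this is the coefficient of the word `l` in it. -/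
def traceCoeff (ξ : FreePoly) (l : List Gen) : ℂ :=
  wordCoeff ξ (l ++ [.ap, .am]) + wordCoeff ξ (l ++ [.am, .ap]) +
    wordCoeff ξ (l ++ [.bp, .bm]) + wordCoeff ξ (l ++ [.bm, .bp])

/-- `Ψ`, the space of totally symmetric, formally traceless polynomials in `a₊, a₋, b₊, b₋`.
Totally symmetric means that coefficients do not change when the letters of a word are permuted.
As a vector space `Ψ` depends neither on `ε` nor on `R`. -/
def Psi : Submodule ℂ FreePoly where
  carrier := {ξ | (∀ u v : List Gen, u.Perm v → wordCoeff ξ u = wordCoeff ξ v) ∧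
    ∀ l : List Gen, traceCoeff ξ l = 0}
  add_mem' := by
    rintro ξ ζ ⟨h1, h2⟩ ⟨h3, h4⟩
    refine ⟨fun u v h => ?_, fun l => ?_⟩
    · have e1 := h1 u v h
      have e2 := h3 u v h
      simp only [wordCoeff, MonoidAlgebra.coeff_add, Finsupp.add_apply] at *
      rw [e1, e2]
    · have e1 := h2 l
      have e2 := h4 l
      simp only [traceCoeff, wordCoeff, MonoidAlgebra.coeff_add, Finsupp.add_apply] at *
      linear_combination e1 + e2
  zero_mem' := by
    refine ⟨fun u v _ => ?_, fun l => ?_⟩ <;> simp [traceCoeff, wordCoeff]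
  smul_mem' := by
    rintro c ξ ⟨h1, h2⟩
    refine ⟨fun u v h => ?_, fun l => ?_⟩
    · have e1 := h1 u v h
      simp only [wordCoeff, MonoidAlgebra.coeff_smul, Finsupp.smul_apply, smul_eq_mul] at *
      rw [e1]
    · have e1 := h2 l
      simp only [traceCoeff, wordCoeff, MonoidAlgebra.coeff_smul, Finsupp.smul_apply,
        smul_eq_mul] at *
      linear_combination c * e1

/-! ### The projection `ρ`, the product and the sesquilinear form -/

/-- Membership in `ker ρ = {w (K₀ - R̂) | w ∈ 𝒲(ε)}`. -/
def InKerRho (ε R : ℝ) (w : Weyl ε) : Prop :=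
  ∃ v : Weyl ε, w = v * (K0 ε - algebraMap ℂ (Weyl ε) (Rhat ε R))

open Classical in
/-- The projection `ρ : 𝒲(ε) → Ψ` with kernel `{w (K₀ - R̂)}`: the element `ξ ∈ Ψ` with
`w - ξ ∈ ker ρ`. -/
def rho (ε R : ℝ) (w : Weyl ε) : Psi :=
  if h : ∃ ξ : Psi, InKerRho ε R (w - toWeyl ε ξ) then h.choose else 0

/-- The product `(ξ, ζ) ↦ ρ(ξ ζ)` on `Ψ`. -/
def prodRho (ε R : ℝ) (ξ ζ : Psi) : Psi := rho ε R (toWeyl ε ξ * toWeyl ε ζ)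

/-- The letter exchange `a_± ↦ a_∓`, `b_± ↦ b_∓`. -/
def Gen.conj : Gen → Gen
  | .ap => .am
  | .am => .ap
  | .bp => .bm
  | .bm => .bp

/-- The conjugation `†`: antilinear, reversing products, with `a_± ↦ a_∓`, `b_± ↦ b_∓`. -/
def dagger (ξ : FreePoly) : FreePoly :=
  ξ.coeff.sum fun w c => (starRingEnd ℂ c) • word ((FreeMonoid.toList w).reverse.map Gen.conj)

/-- The sesquilinear form `⟨ξ, ζ⟩ = π₀(ρ(ξ† ζ))`, `π₀` being the component of degree zero. -/
def form (ε R : ℝ) (ξ ζ : Psi) : ℂ :=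
  wordCoeff (rho ε R (toWeyl ε (dagger ξ) * toWeyl ε ζ)) []

/-- Convergence in `Ψ`: the degrees are eventually bounded and all coefficients converge, that is,
convergence in a finite dimensional subspace. -/
def PsiTendsto (F : ℝ → Psi) (l : Filter ℝ) (η : Psi) : Prop :=
  (∃ d : ℕ, ∀ᶠ ε in l, ∀ u : List Gen, d < u.length → wordCoeff (F ε) u = 0) ∧
    ∀ u : List Gen, Filter.Tendsto (fun ε => wordCoeff (F ε) u) l (𝓝 (wordCoeff η u))

/-! ### The basis elements `P(n,r,m)` -/

/-- The totally symmetric form of `a₊ˣ b₋ʸ`: the mean of all words with `x` letters `a₊` and `y`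
letters `b₋`. -/
def topMonomial (x y : ℕ) : FreePoly :=
  (((x + y).choose x : ℂ)⁻¹) • ∑ s ∈ Finset.powersetCard x (Finset.univ : Finset (Fin (x + y))),
    word (List.ofFn fun k => if k ∈ s then Gen.ap else Gen.bm)

/-- `ε⁻¹ [J₋, ·]` on generators: `a₊ ↦ b₊`, `b₋ ↦ -a₋`, `a₋ ↦ 0`, `b₊ ↦ 0`. -/
def lowerGen : Gen → FreePoly
  | .ap => gen .bp
  | .am => 0
  | .bp => 0
  | .bm => -gen .am

/-- `ε⁻¹ [J₋, ·]` on words, by the Leibniz rule. -/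
def lowerWord : List Gen → FreePoly
  | [] => 0
  | g :: l => lowerGen g * word l + gen g * lowerWord l

/-- The operator `ε⁻¹ Ad J₋` in a form independent of `ε`. At `ε = 0` it is the derivation
`b₊ ∂/∂a₊ - a₋ ∂/∂b₋`. -/
def lower (ξ : FreePoly) : FreePoly := ξ.coeff.sum fun w c => c • lowerWord (FreeMonoid.toList w)

/-- The factor `√((n+m)! / ((2n)! (n-m)!))`, with `N = 2n`, `j = n + m`. -/
def basisNorm (N j : ℕ) : ℝ :=
  Real.sqrt ((j.factorial : ℝ) / ((N.factorial : ℝ) * ((N - j).factorial : ℝ)))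

/-- `basisElt N i j` is `P(n,r,m)` for `N = 2n`, `i = n + r`, `j = n + m`; the admissible
`(n,r,m)` correspond to the natural numbers `i ≤ N`, `j ≤ N`. -/
def basisElt (N i j : ℕ) : FreePoly :=
  (basisNorm N j : ℂ) • lower^[N - j] (topMonomial i (N - i))

/-- `δ` is the number operator: `δ P(n,r,m) = n P(n,r,m)`. -/
def IsNumberOperator (δ : Psi →ₗ[ℂ] Psi) : Prop :=
  ∀ N i j : ℕ, i ≤ N → j ≤ N → ∀ ξ : Psi, (ξ : FreePoly) = basisElt N i j →
    δ ξ = ((N : ℂ) / 2) • ξ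

/-! ### Functions on `SU(2)` -/

/-- The group `SU(2)`. -/
abbrev SU2 : Type := Matrix.specialUnitaryGroup (Fin 2) ℂ

/-- Polynomial functions on `SU(2)`: polynomials in the matrix entries and their conjugates. -/
def polyFun : Subalgebra ℂ (SU2 → ℂ) :=
  Algebra.adjoin ℂ
    ({f | ∃ k l : Fin 2, f = fun g : SU2 => (g : Matrix (Fin 2) (Fin 2) ℂ) k l} ∪
      {f | ∃ k l : Fin 2, f = fun g : SU2 => starRingEnd ℂ ((g : Matrix (Fin 2) (Fin 2) ℂ) k l)})

/-- The generators as functions on `SU(2)`; they satisfy `a₊a₋ + b₊b₋ = 2R`. -/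
def genFun (R : ℝ) : Gen → SU2 → ℂ
  | .ap => fun g => (Real.sqrt (2 * R) : ℂ) * (g : Matrix (Fin 2) (Fin 2) ℂ) 0 0
  | .am => fun g => (Real.sqrt (2 * R) : ℂ) *
      starRingEnd ℂ ((g : Matrix (Fin 2) (Fin 2) ℂ) 0 0)
  | .bp => fun g => -Complex.I * (Real.sqrt (2 * R) : ℂ) *
      (g : Matrix (Fin 2) (Fin 2) ℂ) 1 0
  | .bm => fun g => Complex.I * (Real.sqrt (2 * R) : ℂ) *
      starRingEnd ℂ ((g : Matrix (Fin 2) (Fin 2) ℂ) 1 0)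

/-- Evaluation of polynomials in `a₊, a₋, b₊, b₋` as functions on `SU(2)`. -/
def evalSU2 (R : ℝ) : FreePoly →ₐ[ℂ] (SU2 → ℂ) :=
  MonoidAlgebra.lift ℂ (SU2 → ℂ) (FreeMonoid Gen) (FreeMonoid.lift (genFun R))

/-- The rotation `exp(-iασ₃/2) exp(-iβσ₂/2) exp(-iγσ₃/2)` as a matrix. -/
def eulerMatrix (α β γ : ℝ) : Matrix (Fin 2) (Fin 2) ℂ :=
  !![(Real.cos (β / 2) : ℂ) * Complex.exp (-(Complex.I / 2) * (α + γ)),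
      -(Real.sin (β / 2) : ℂ) * Complex.exp (-(Complex.I / 2) * (α - γ));
    (Real.sin (β / 2) : ℂ) * Complex.exp ((Complex.I / 2) * (α - γ)),
      (Real.cos (β / 2) : ℂ) * Complex.exp ((Complex.I / 2) * (α + γ))]

theorem eulerMatrix_mem (α β γ : ℝ) :
    eulerMatrix α β γ ∈ Matrix.specialUnitaryGroup (Fin 2) ℂ := by
  have e1 : Complex.exp (-(Complex.I / 2) * (α + γ)) *
      Complex.exp ((Complex.I / 2) * (α + γ)) = 1 := by
    rw [← Complex.exp_add, ← Complex.exp_zero]; congr 1; ring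
  have e2 : Complex.exp (-(Complex.I / 2) * (α - γ)) *
      Complex.exp ((Complex.I / 2) * (α - γ)) = 1 := by
    rw [← Complex.exp_add, ← Complex.exp_zero]; congr 1; ring
  have cs : (Real.sin (β / 2) : ℂ) ^ 2 + (Real.cos (β / 2) : ℂ) ^ 2 = 1 := by
    exact_mod_cast Real.sin_sq_add_cos_sq (β / 2)
  have c1 : starRingEnd ℂ (Complex.exp (-(Complex.I / 2) * (α + γ))) =
      Complex.exp ((Complex.I / 2) * (α + γ)) := by
    rw [← Complex.exp_conj]; congr 1; simp [Complex.conj_ofNat]; ring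
  have c2 : starRingEnd ℂ (Complex.exp (-(Complex.I / 2) * (α - γ))) =
      Complex.exp ((Complex.I / 2) * (α - γ)) := by
    rw [← Complex.exp_conj]; congr 1; simp [Complex.conj_ofNat]; ring
  have c3 : starRingEnd ℂ (Complex.exp ((Complex.I / 2) * (α + γ))) =
      Complex.exp (-(Complex.I / 2) * (α + γ)) := by
    rw [← c1, Complex.conj_conj]
  have c4 : starRingEnd ℂ (Complex.exp ((Complex.I / 2) * (α - γ))) =
      Complex.exp (-(Complex.I / 2) * (α - γ)) := by
    rw [← c2, Complex.conj_conj]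
  rw [Matrix.mem_specialUnitaryGroup_iff, Matrix.mem_unitaryGroup_iff]
  unfold eulerMatrix
  generalize Complex.exp (-(Complex.I / 2) * (α + γ)) = x at *
  generalize Complex.exp ((Complex.I / 2) * (α + γ)) = x' at *
  generalize Complex.exp (-(Complex.I / 2) * (α - γ)) = y at *
  generalize Complex.exp ((Complex.I / 2) * (α - γ)) = y' at *
  constructor
  · ext k l
    fin_cases k <;> fin_cases l <;>
      simp [Matrix.mul_apply, Fin.sum_univ_two, Matrix.star_apply, c1, c2, c3, c4,
        -Complex.ofReal_cos, -Complex.ofReal_sin]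
    · linear_combination cs + (Real.cos (β / 2) : ℂ) ^ 2 * e1 + (Real.sin (β / 2) : ℂ) ^ 2 * e2
    · ring
    · ring
    · linear_combination cs + (Real.cos (β / 2) : ℂ) ^ 2 * e1 + (Real.sin (β / 2) : ℂ) ^ 2 * e2
  · rw [Matrix.det_fin_two_of]
    linear_combination cs + (Real.cos (β / 2) : ℂ) ^ 2 * e1 + (Real.sin (β / 2) : ℂ) ^ 2 * e2

/-- The element of `SU(2)` with Euler angles `α, β, γ`. -/
def euler (α β γ : ℝ) : SU2 := ⟨eulerMatrix α β γ, eulerMatrix_mem α β γ⟩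

/-- The function of the Euler angles defined by a polynomial in `a₊, a₋, b₊, b₋`. -/
def eulerFun (R : ℝ) (ξ : FreePoly) (α β γ : ℝ) : ℂ := evalSU2 R ξ (euler α β γ)

/-- Wigner's reduced rotation matrix `dⁿ_{m'm}(β)`, with `N = 2n`, `p = n + m'`, `q = n + m`:
`√((n+m')! (n-m')! (n+m)! (n-m)!)` times the sum of
`(-1)^(m'-m+s) cos(β/2)^(2n+m-m'-2s) sin(β/2)^(m'-m+2s) / ((n+m-s)! s! (m'-m+s)! (n-m'-s)!)`
over the `s` for which no factorial has a negative argument. -/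
def wignerSmallD (N p q : ℕ) (β : ℝ) : ℝ :=
  Real.sqrt ((p.factorial : ℝ) * ((N - p).factorial : ℝ) * (q.factorial : ℝ) *
      ((N - q).factorial : ℝ)) *
    ∑ s ∈ (Finset.range (N + 1)).filter (fun s => s ≤ q ∧ q ≤ p + s ∧ s + p ≤ N),
      (-1 : ℝ) ^ (p + s - q) * Real.cos (β / 2) ^ ((q - s) + (N - p - s)) *
          Real.sin (β / 2) ^ ((p + s - q) + s) /
        (((q - s).factorial : ℝ) * (s.factorial : ℝ) * ((p + s - q).factorial : ℝ) *
          ((N - p - s).factorial : ℝ))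

/-- Wigner's rotation matrix `Dⁿ_{m'm}(α,β,γ) = e^{-im'α} dⁿ_{m'm}(β) e^{-imγ}`, with
`N = 2n`, `p = n + m'`, `q = n + m`. -/
def wignerD (N p q : ℕ) (α β γ : ℝ) : ℂ :=
  Complex.exp (-Complex.I * ((p : ℂ) - (N : ℂ) / 2) * α) * (wignerSmallD N p q β : ℂ) *
    Complex.exp (-Complex.I * ((q : ℂ) - (N : ℂ) / 2) * γ)

/-- All monomials occurring in `ξ` have degree congruent to `k` modulo 2 (so `n ∈ ℤ`, for `k` even,
or `n ∈ ℤ + 1/2`, for `k` odd, in the expansion in the basis). -/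
def HasParity (ξ : FreePoly) (k : ℕ) : Prop :=
  ∀ u : List Gen, wordCoeff ξ u ≠ 0 → u.length ≡ k [MOD 2]

/-- The right-hand side of the bracket formula, with `δ` in the role of the number operator. -/
def bracketRHS (R : ℝ) (δ : Psi →ₗ[ℂ] Psi) (ξ ζ : Psi) (α β γ : ℝ) : ℂ :=
  let F := eulerFun R ξ
  let G := eulerFun R ζ
  let Fα := deriv (fun x => F x β γ) α
  let Fβ := deriv (fun x => F α x γ) β
  let Fγ := deriv (fun x => F α β x) γ
  let Gα := deriv (fun x => G x β γ) α
  let Gβ := deriv (fun x => G α x γ) β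
  let Gγ := deriv (fun x => G α β x) γ
  1 / ((R : ℂ) * (Real.sin β : ℂ)) * (Fα * Gβ - Fβ * Gα) +
    1 / (R : ℂ) * (eulerFun R (δ ξ) α β γ * Gγ - Fγ * eulerFun R (δ ζ) α β γ) +
    (Real.cos β : ℂ) / ((R : ℂ) * (Real.sin β : ℂ)) * (Fβ * Gγ - Fγ * Gβ)

end FuzzySU2

end

open FuzzySU2

noncomputable section

namespace FuzzySU2

open MvPolynomial Filter

/-! A totally symmetric polynomial is determined by its commutative image, and the vanishing of its
formal trace says that this image is killed by the Laplacian Δ = ∂²/∂a₊∂a₋ + ∂²/∂b₊∂b₋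
(`mem_Psi_iff`). So Ψ is the space of harmonic polynomials, for every ε. Normal ordering identifies
𝒲(ε) with the commutative polynomials as well: letters act by multiplication plus ε times a
derivative, and the symbol of w is the result of applying w to 1. For ξ in Ψ the ε-corrections add
up to a trace, so the symbol is just the commutative image (`freeRep_apply_one`).

On symbols, right multiplication by K₀ - R̂ is f ↦ ½qf plus terms of degree at most deg f, where q =
a₊a₋ + b₊b₋ (`rightK`). The classical decomposition of polynomials into harmonic ones and multiples
of q survives this perturbation: existence by induction on the degree, uniqueness by the part of top
degree. The resulting recursion for ρ on qf (`reduce_quad_mul`) has coefficients continuous in ε,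
whence the limits of the product and the form.

At ε = 0 the action is ordinary multiplication and the left ideal is generated by q - 2R, the
equation of SU(2) as a three-sphere. Evaluation there kills the ideal, reaches all polynomial
functions, and is injective on harmonic polynomials (`evalPt_injOn_Harm`). For the form, the
integral over the Euler angles satisfies 2R∫Δf = (d/2)(d/2+1)∫f on polynomials of degree d. Hence
harmonic polynomials without constant term integrate to zero (`haar_of_mem_Harm`), and the mean
value is the component of degree 0.

For the bracket, commutators of noncommutative polynomials are, in every 𝒲(ε), ε times the class of
a fixed polynomial. The right-hand side of the bracket formula is not a biderivation of functions: q
and 2R are the same function but have different degrees. In the free algebra, however, half the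
degree is a derivation, so there both sides are biderivations over evaluation at a point, and it
suffices to compare them on generators (`ptBracket_gen`). The number operator is half the degree,
and is unique because the P(n,r,m) span Ψ.

Finally, ε⁻¹ Ad J₋ is the derivation a₊ ↦ b₊ ↦ 0, b₋ ↦ -a₋ ↦ 0. The Leibniz formula for its powers
on a₊ˣ b₋ʸ yields Wigner's sum term by term. -/

/-- Commutative polynomials in `a₊, a₋, b₊, b₋`. -/
abbrev CPoly : Type := MvPolynomial Gen ℂ

/-- The commutative image of a noncommutative polynomial. -/
def comm : FreePoly →ₐ[ℂ] CPoly :=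
  MonoidAlgebra.lift ℂ CPoly (FreeMonoid Gen) (FreeMonoid.lift fun g => X g)

/-! ### Words, coefficients and linear maps on the free algebra -/

instance : Fintype Gen := ⟨{.ap, .am, .bp, .bm}, by intro x; cases x <;> decide⟩

theorem sum_gen {M : Type*} [AddCommMonoid M] (f : Gen → M) :
    ∑ g, f g = f .ap + f .am + f .bp + f .bm := by
  have h : (Finset.univ : Finset Gen) = {.ap, .am, .bp, .bm} := rfl
  rw [h, Finset.sum_insert (by decide), Finset.sum_insert (by decide),
    Finset.sum_insert (by decide), Finset.sum_singleton, add_assoc, add_assoc]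

theorem word_nil : word [] = 1 := rfl

theorem word_append (u v : List Gen) : word (u ++ v) = word u * word v := by
  simp [word, MonoidAlgebra.single_mul_single]

theorem word_cons (g : Gen) (l : List Gen) : word (g :: l) = gen g * word l :=
  word_append [g] l

theorem comm_gen (g : Gen) : comm (gen g) = X g := by
  simp [comm, gen, word, MonoidAlgebra.lift_single]

theorem freePoly_ext {ξ ζ : FreePoly} (h : ∀ l, wordCoeff ξ l = wordCoeff ζ l) : ξ = ζ := by
  apply MonoidAlgebra.coeff_injective
  ext m
  exact h (FreeMonoid.toList m)

theorem single_eq_smul_word (m : FreeMonoid Gen) (c : ℂ) :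
    MonoidAlgebra.single m c = c • word (FreeMonoid.toList m) := by
  simp [word]

/-- The coefficient of a word, as a linear form. -/
def wordCoeffₗ (l : List Gen) : FreePoly →ₗ[ℂ] ℂ where
  toFun ξ := wordCoeff ξ l
  map_add' _ _ := rfl
  map_smul' _ _ := rfl

@[simp] theorem wordCoeff_add (ξ ζ : FreePoly) (l : List Gen) :
    wordCoeff (ξ + ζ) l = wordCoeff ξ l + wordCoeff ζ l := rfl

@[simp] theorem wordCoeff_neg (ξ : FreePoly) (l : List Gen) :
    wordCoeff (-ξ) l = -wordCoeff ξ l := (wordCoeffₗ l).map_neg ξ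

@[simp] theorem wordCoeff_smul (c : ℂ) (ξ : FreePoly) (l : List Gen) :
    wordCoeff (c • ξ) l = c * wordCoeff ξ l := rfl

@[simp] theorem wordCoeff_zero (l : List Gen) : wordCoeff 0 l = 0 := rfl

@[simp] theorem wordCoeff_sum {ι : Type*} (s : Finset ι) (f : ι → FreePoly) (l : List Gen) :
    wordCoeff (∑ i ∈ s, f i) l = ∑ i ∈ s, wordCoeff (f i) l := map_sum (wordCoeffₗ l) f s

theorem wordCoeff_word (u l : List Gen) : wordCoeff (word u) l = if u = l then 1 else 0 := by
  classical
  rw [wordCoeff, word, MonoidAlgebra.coeff_single, Finsupp.single_apply]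
  simp only [EmbeddingLike.apply_eq_iff_eq]

theorem word_induction {p : FreePoly → Prop} (h : ∀ l, p (word l))
    (hadd : ∀ ξ ζ, p ξ → p ζ → p (ξ + ζ)) (hsmul : ∀ (c : ℂ) ξ, p ξ → p (c • ξ)) (ξ : FreePoly) :
    p ξ := by
  induction ξ using MonoidAlgebra.induction_linear with
  | zero => simpa using hsmul 0 _ (h [])
  | add f g hf hg => exact hadd _ _ hf hg
  | single m c => rw [single_eq_smul_word]; exact hsmul _ _ (h _)

/-- Two linear maps on the free algebra agree if they agree on words. -/
theorem linearMap_ext_word {M : Type*} [AddCommGroup M] [Module ℂ M] {f g : FreePoly →ₗ[ℂ] M}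
    (h : ∀ l, f (word l) = g (word l)) : f = g := by
  refine LinearMap.ext fun ξ => word_induction (p := fun ξ => f ξ = g ξ) h
    (fun a b ha hb => ?_) (fun c a ha => ?_) ξ
  · rw [map_add, map_add, ha, hb]
  · rw [map_smul, map_smul, ha]

theorem gen_induction {p : FreePoly → Prop} (h1 : p 1) (hgen : ∀ g ξ, p ξ → p (gen g * ξ))
    (hadd : ∀ ξ ζ, p ξ → p ζ → p (ξ + ζ)) (hsmul : ∀ (c : ℂ) ξ, p ξ → p (c • ξ)) (ξ : FreePoly) :
    p ξ := by
  refine word_induction (fun l => ?_) hadd hsmul ξ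
  induction l with
  | nil => exact h1
  | cons g l ih => rw [word_cons]; exact hgen g _ ih

theorem wordCoeff_gen_mul_cons (g h : Gen) (ξ : FreePoly) (l : List Gen) :
    wordCoeff (gen g * ξ) (h :: l) = if g = h then wordCoeff ξ l else 0 := by
  induction ξ using word_induction with
  | h u => rw [← word_cons, wordCoeff_word, wordCoeff_word]; split_ifs <;> simp_all
  | hadd a b ha hb => rw [mul_add, wordCoeff_add, ha, hb]; split_ifs <;> simp
  | hsmul c a ha => rw [mul_smul_comm, wordCoeff_smul, ha]; split_ifs <;> simp

theorem wordCoeff_gen_mul_nil (g : Gen) (ξ : FreePoly) : wordCoeff (gen g * ξ) [] = 0 := by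
  induction ξ using word_induction with
  | h u => rw [← word_cons, wordCoeff_word]; simp
  | hadd a b ha hb => rw [mul_add, wordCoeff_add, ha, hb]; simp
  | hsmul c a ha => rw [mul_smul_comm, wordCoeff_smul, ha]; simp

/-- A linear map on the free algebra given by its values on words. -/
def wordLift {M : Type*} [AddCommGroup M] [Module ℂ M] (f : List Gen → M) : FreePoly →ₗ[ℂ] M where
  toFun ξ := ξ.coeff.sum fun w c => c • f (FreeMonoid.toList w)
  map_add' ξ ζ := by
    rw [MonoidAlgebra.coeff_add]
    exact Finsupp.sum_add_index' (by simp) (by intros; rw [add_smul])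
  map_smul' c ξ := by
    rw [MonoidAlgebra.coeff_smul, Finsupp.sum_smul_index (by simp), RingHom.id_apply,
      Finsupp.smul_sum]
    simp only [mul_smul]

@[simp] theorem wordLift_word {M : Type*} [AddCommGroup M] [Module ℂ M] (f : List Gen → M)
    (l : List Gen) : wordLift f (word l) = f l := by
  simp [wordLift, word, Finsupp.sum_single_index]

/-- Removal of the first letter `g`; words not starting with `g` are dropped. -/
def strip (g : Gen) : FreePoly →ₗ[ℂ] FreePoly :=
  wordLift fun l => match l with
    | [] => 0
    | h :: t => if h = g then word t else 0

theorem wordCoeff_strip (g : Gen) (ξ : FreePoly) (l : List Gen) :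
    wordCoeff (strip g ξ) l = wordCoeff ξ (g :: l) := by
  induction ξ using word_induction with
  | h u =>
    rw [strip, wordLift_word]
    cases u with
    | nil => simp [wordCoeff_word]
    | cons h t =>
      by_cases hg : h = g <;> simp [hg, wordCoeff_word]
  | hadd a b ha hb => rw [map_add, wordCoeff_add, ha, hb]; simp
  | hsmul c a ha => rw [map_smul, wordCoeff_smul, ha]; simp

/-- The degree operator: words are multiplied by their length. -/
def degOp : FreePoly →ₗ[ℂ] FreePoly := wordLift fun l => (l.length : ℂ) • word l

theorem degOp_word (l : List Gen) : degOp (word l) = (l.length : ℂ) • word l := by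
  simp [degOp]

theorem wordCoeff_degOp (ξ : FreePoly) (l : List Gen) :
    wordCoeff (degOp ξ) l = l.length * wordCoeff ξ l := by
  induction ξ using word_induction with
  | h u =>
    rw [degOp_word, wordCoeff_smul, wordCoeff_word]
    split_ifs with h <;> simp [h]
  | hadd a b ha hb => rw [map_add, wordCoeff_add, ha, hb, wordCoeff_add]; ring
  | hsmul c a ha => rw [map_smul, wordCoeff_smul, ha, wordCoeff_smul]; ring

/-- Sorting the words by their first letter. Together with `symm_induction` this is the recursion by
which statements on symmetric polynomials are proved. -/
theorem eq_const_add_sum_strip (ξ : FreePoly) :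
    ξ = wordCoeff ξ [] • 1 + ∑ g, gen g * strip g ξ := by
  apply freePoly_ext
  intro l
  rw [wordCoeff_add, wordCoeff_smul, wordCoeff_sum, ← word_nil, wordCoeff_word]
  cases l with
  | nil => simp [wordCoeff_gen_mul_nil]
  | cons h t => simp [wordCoeff_gen_mul_cons, wordCoeff_strip]

/-! ### Symmetric polynomials, Taylor coefficients and symmetrization -/

/-- Totally symmetric polynomials. -/
def IsSymm (ξ : FreePoly) : Prop := ∀ u v : List Gen, u.Perm v → wordCoeff ξ u = wordCoeff ξ v

theorem IsSymm.strip {ξ : FreePoly} (h : IsSymm ξ) (g : Gen) : IsSymm (strip g ξ) := by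
  intro u v huv
  rw [wordCoeff_strip, wordCoeff_strip]
  exact h _ _ (huv.cons g)

theorem IsSymm.degOp {ξ : FreePoly} (h : IsSymm ξ) : IsSymm (degOp ξ) := by
  intro u v huv
  rw [wordCoeff_degOp, wordCoeff_degOp, h u v huv, huv.length_eq]

theorem degBound_exists (ξ : FreePoly) : ∃ d : ℕ, ∀ l : List Gen, d ≤ l.length →
    wordCoeff ξ l = 0 := by
  induction ξ using word_induction with
  | h u =>
    refine ⟨u.length + 1, fun l hl => ?_⟩
    rw [wordCoeff_word, if_neg]
    rintro rfl
    omega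
  | hadd a b ha hb =>
    obtain ⟨d, hd⟩ := ha
    obtain ⟨e, he⟩ := hb
    refine ⟨max d e, fun l hl => ?_⟩
    rw [wordCoeff_add, hd l (le_trans (le_max_left _ _) hl), he l (le_trans (le_max_right _ _) hl),
      add_zero]
  | hsmul c a ha =>
    obtain ⟨d, hd⟩ := ha
    exact ⟨d, fun l hl => by rw [wordCoeff_smul, hd l hl, mul_zero]⟩

theorem eq_zero_of_degBound_zero {ξ : FreePoly}
    (h : ∀ l : List Gen, 0 ≤ l.length → wordCoeff ξ l = 0) : ξ = 0 :=
  freePoly_ext fun l => h l (Nat.zero_le _)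

/-- Induction on the degree for totally symmetric polynomials. -/
theorem symm_induction {p : FreePoly → Prop} {ξ : FreePoly} (hξ : IsSymm ξ) (h0 : p 0)
    (hs : ∀ ξ, IsSymm ξ → (∀ g, p (strip g ξ)) → p ξ) : p ξ := by
  obtain ⟨d, hd⟩ := degBound_exists ξ
  induction d generalizing ξ with
  | zero => rw [eq_zero_of_degBound_zero hd]; exact h0
  | succ d ih =>
    refine hs ξ hξ fun g => ih (hξ.strip g) fun l hl => ?_
    rw [wordCoeff_strip]
    exact hd _ (by simpa using hl)

theorem comm_eq_sum_strip (ξ : FreePoly) :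
    comm ξ = C (wordCoeff ξ []) + ∑ g, X g * comm (strip g ξ) := by
  conv_lhs => rw [eq_const_add_sum_strip ξ]
  rw [map_add, map_smul, map_one, map_sum, smul_eq_C_mul, mul_one]
  simp only [map_mul, comm_gen]

/-- By symmetry all positions of the letter `g` in words of length d contribute alike, so
differentiating amounts to removing a leading `g` and multiplying by d. The factor is supplied by
`degOp`, applied before the letter is removed. -/
theorem pderiv_comm (ξ : FreePoly) (hξ : IsSymm ξ) (g : Gen) :
    pderiv g (comm ξ) = comm (strip g (degOp ξ)) := by
  refine symm_induction (p := fun ξ => pderiv g (comm ξ) = comm (strip g (degOp ξ))) hξ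
    (by simp) fun ξ hξ ih => ?_
  · have key : strip g (degOp ξ) = strip g ξ + degOp (strip g ξ) := by
      apply freePoly_ext
      intro l
      simp only [wordCoeff_strip, wordCoeff_degOp, wordCoeff_add, List.length_cons]
      push_cast
      ring
    -- This is where total symmetry enters: the two removed letters may be exchanged.
    have hη : ∀ h, strip h (degOp (strip g ξ)) = strip g (degOp (strip h ξ)) := by
      intro h
      apply freePoly_ext
      intro l
      simp only [wordCoeff_strip, wordCoeff_degOp, List.length_cons]
      rw [hξ _ _ (List.Perm.swap h g l)]
    rw [key, map_add, comm_eq_sum_strip (degOp _), comm_eq_sum_strip ξ, map_add, map_sum]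
    simp only [pderiv_C, hη, pderiv_mul, ih, pderiv_X, zero_add, wordCoeff_degOp]
    simp [Finset.sum_add_distrib, Pi.single_apply]

/-- The value at the origin of the partial derivative of a polynomial along the letters of a
word. -/
def taylor (f : CPoly) : List Gen → ℂ
  | [] => constantCoeff f
  | g :: l => taylor (pderiv g f) l

/-- Recovers a symmetric polynomial from its commutative image; this gives the injectivity of `comm`
on symmetric polynomials and dictates the coefficients of `symmetrize`. -/
theorem taylor_comm {ξ : FreePoly} (hξ : IsSymm ξ) (l : List Gen) :
    taylor (comm ξ) l = (l.length.factorial : ℂ) * wordCoeff ξ l := by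
  induction l generalizing ξ with
  | nil =>
    rw [taylor, comm_eq_sum_strip, map_add, map_sum]
    simp
  | cons g l ih =>
    rw [taylor, pderiv_comm ξ hξ, ih (hξ.degOp.strip g), wordCoeff_strip, wordCoeff_degOp,
      List.length_cons, Nat.factorial_succ]
    push_cast
    ring

theorem taylor_add (f g : CPoly) (l : List Gen) : taylor (f + g) l = taylor f l + taylor g l := by
  induction l generalizing f g with
  | nil => simp [taylor]
  | cons x l ih => simp [taylor, ih]

theorem taylor_smul (c : ℂ) (f : CPoly) (l : List Gen) : taylor (c • f) l = c * taylor f l := by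
  induction l generalizing f with
  | nil => simp [taylor]
  | cons x l ih => simp [taylor, ih]

theorem taylor_sub (f g : CPoly) (l : List Gen) : taylor (f - g) l = taylor f l - taylor g l := by
  induction l generalizing f g with
  | nil => simp [taylor]
  | cons x l ih => simp [taylor, ih]

theorem pderiv_pderiv_comm (g h : Gen) (f : CPoly) :
    pderiv g (pderiv h f) = pderiv h (pderiv g f) := by
  ext m
  rw [coeff_pderiv, coeff_pderiv, coeff_pderiv, coeff_pderiv, add_right_comm]
  by_cases hgh : g = h
  · subst hgh; rfl
  · simp [hgh, Ne.symm hgh]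
    ring

theorem taylor_perm (f : CPoly) {u v : List Gen} (h : u.Perm v) : taylor f u = taylor f v := by
  induction h generalizing f with
  | nil => rfl
  | cons x _ ih => exact ih _
  | swap x y l => rw [taylor, taylor, taylor, taylor, pderiv_pderiv_comm]
  | trans _ _ ih1 ih2 => rw [ih1, ih2]

theorem exists_pderiv_coeff (m : Gen →₀ ℕ) (g : Gen) (hg : m g ≠ 0) (f : CPoly) :
    coeff (m - Finsupp.single g 1) (pderiv g f) = m g * coeff m f := by
  have hle : Finsupp.single g 1 ≤ m := by
    rw [Finsupp.single_le_iff]; omega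
  rw [coeff_pderiv, tsub_add_cancel_of_le hle, Finsupp.tsub_apply, Finsupp.single_eq_same,
    ← Nat.cast_add_one, Nat.sub_add_cancel (by omega), mul_comm]

/-- Differentiating along a letter that occurs in a monomial lowers its degree and multiplies its
coefficient by a nonzero exponent, so every coefficient is reached by induction. -/
theorem eq_zero_of_taylor {f : CPoly} (h : ∀ l, taylor f l = 0) : f = 0 := by
  ext m
  rw [coeff_zero]
  induction hn : m.degree generalizing f m with
  | zero =>
    rw [Finsupp.degree_eq_zero_iff] at hn
    subst hn
    exact h []
  | succ n ih =>
    obtain ⟨g, hg⟩ : ∃ g, m g ≠ 0 := by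
      by_contra! hm
      rw [show m = 0 from Finsupp.ext hm] at hn
      simp at hn
    have h1 := ih (f := pderiv g f) (fun l => h (g :: l)) (m - Finsupp.single g 1) (by
      have hle : Finsupp.single g 1 ≤ m := by
        rw [Finsupp.single_le_iff]; omega
      have := congrArg Finsupp.degree (tsub_add_cancel_of_le hle)
      rw [map_add, Finsupp.degree_single] at this
      omega)
    rw [exists_pderiv_coeff m g hg] at h1
    exact (mul_eq_zero.1 h1).resolve_left (by exact_mod_cast hg)

theorem taylor_eq_zero_of_length (f : CPoly) (l : List Gen) (h : f.totalDegree < l.length) :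
    taylor f l = 0 := by
  induction l generalizing f with
  | nil => simp at h
  | cons g l ih =>
    rw [taylor]
    by_cases h0 : pderiv g f = 0
    · rw [h0]
      have := taylor_smul 0 0 l
      simpa using this
    · refine ih _ (lt_of_lt_of_le ?_ (Nat.le_of_lt_succ h))
      rw [totalDegree, Finset.sup_lt_iff]
      · intro m hm
        have : coeff (m + Finsupp.single g 1) f ≠ 0 := by
          intro h1
          rw [mem_support_iff, coeff_pderiv, h1, zero_mul] at hm
          exact hm rfl
        have := le_totalDegree (mem_support_iff.2 this)
        rw [Finsupp.sum_add_index' (by simp) (by simp)] at this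
        simp at this
        exact this
      · by_contra! hf
        obtain hf := Nat.le_zero.1 hf
        rw [totalDegree_eq_zero_iff_eq_C] at hf
        rw [hf, pderiv_C] at h0
        exact h0 rfl

/-- The totally symmetric polynomial with a given commutative image. -/
def symmetrize (f : CPoly) : FreePoly :=
  ∑ n ∈ Finset.range (f.totalDegree + 1), ∑ u : Fin n → Gen,
    (taylor f (List.ofFn u) / (n.factorial : ℂ)) • word (List.ofFn u)

theorem wordCoeff_symmetrize (f : CPoly) (l : List Gen) :
    wordCoeff (symmetrize f) l = taylor f l / (l.length.factorial : ℂ) := by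
  have h1 : ∀ n, wordCoeff (∑ u : Fin n → Gen,
      (taylor f (List.ofFn u) / (n.factorial : ℂ)) • word (List.ofFn u)) l =
      if n = l.length then taylor f l / (l.length.factorial : ℂ) else 0 := by
    intro n
    rw [wordCoeff_sum]
    simp only [wordCoeff_smul, wordCoeff_word]
    split_ifs with hn
    · subst hn
      rw [Finset.sum_eq_single l.get]
      · simp
      · intro b _ hb
        rw [if_neg, mul_zero]
        rintro h
        apply hb
        apply List.ofFn_injective
        rw [h, List.ofFn_get]
      · simp
    · refine Finset.sum_eq_zero fun u _ => ?_
      rw [if_neg, mul_zero]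
      rintro rfl
      simp at hn
  rw [symmetrize, wordCoeff_sum]
  simp only [h1]
  rw [Finset.sum_ite_eq']
  split_ifs with h
  · rfl
  · rw [taylor_eq_zero_of_length f l (by simpa using h), zero_div]

theorem isSymm_symmetrize (f : CPoly) : IsSymm (symmetrize f) := by
  intro u v h
  rw [wordCoeff_symmetrize, wordCoeff_symmetrize, taylor_perm f h, h.length_eq]

theorem comm_symmetrize (f : CPoly) : comm (symmetrize f) = f := by
  rw [← sub_eq_zero]
  apply eq_zero_of_taylor
  intro l
  rw [taylor_sub, taylor_comm (isSymm_symmetrize f), wordCoeff_symmetrize]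
  have : (l.length.factorial : ℂ) ≠ 0 := by exact_mod_cast Nat.factorial_ne_zero _
  field_simp
  ring

theorem comm_injOn_symm {ξ ζ : FreePoly} (hξ : IsSymm ξ) (hζ : IsSymm ζ)
    (h : comm ξ = comm ζ) : ξ = ζ := by
  apply freePoly_ext
  intro l
  have h1 := taylor_comm hξ l
  rw [h, taylor_comm hζ] at h1
  exact (mul_left_cancel₀ (by exact_mod_cast Nat.factorial_ne_zero _) h1).symm

/-! ### Ψ as the space of harmonic polynomials -/

/-- The Laplacian `∂²/∂a₊∂a₋ + ∂²/∂b₊∂b₋`. -/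
def lap : CPoly →ₗ[ℂ] CPoly :=
  (pderiv .ap).toLinearMap ∘ₗ (pderiv .am).toLinearMap +
    (pderiv .bp).toLinearMap ∘ₗ (pderiv .bm).toLinearMap

theorem lap_apply (f : CPoly) :
    lap f = pderiv .ap (pderiv .am f) + pderiv .bp (pderiv .bm f) := rfl

theorem traceCoeff_eq_of_symm {ξ : FreePoly} (h : IsSymm ξ) (l : List Gen) :
    traceCoeff ξ l = 2 * (wordCoeff ξ (.am :: .ap :: l) + wordCoeff ξ (.bm :: .bp :: l)) := by
  have e1 : ∀ x y : Gen, wordCoeff ξ (l ++ [x, y]) = wordCoeff ξ (x :: y :: l) := fun x y =>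
    h _ _ List.perm_append_comm
  rw [traceCoeff, e1, e1, e1, e1, h _ _ (List.Perm.swap .am .ap l),
    h _ _ (List.Perm.swap .bm .bp l)]
  ring

/-- The factorial comes from `taylor_comm` on words with two more letters; the formal trace counts
each of the pairs a₊a₋, b₊b₋ in both orders, hence the division by 2. -/
theorem taylor_lap {ξ : FreePoly} (h : IsSymm ξ) (l : List Gen) :
    taylor (lap (comm ξ)) l = ((l.length + 2).factorial : ℂ) / 2 * traceCoeff ξ l := by
  rw [lap_apply, taylor_add]
  have e1 := taylor_comm h (.am :: .ap :: l)
  have e2 := taylor_comm h (.bm :: .bp :: l)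
  simp only [taylor, List.length_cons] at e1 e2
  rw [e1, e2, traceCoeff_eq_of_symm h]
  ring

theorem mem_Psi_iff {ξ : FreePoly} : ξ ∈ Psi ↔ IsSymm ξ ∧ lap (comm ξ) = 0 := by
  refine and_congr_right fun h => ⟨fun h2 => eq_zero_of_taylor fun l => ?_, fun h2 l => ?_⟩
  · rw [taylor_lap h, h2, mul_zero]
  · have := taylor_lap h l
    rw [h2] at this
    have h0 : taylor 0 l = 0 := by simpa using taylor_smul 0 0 l
    rw [h0] at this
    have hf : ((l.length + 2).factorial : ℂ) / 2 ≠ 0 :=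
      div_ne_zero (by exact_mod_cast Nat.factorial_ne_zero _) two_ne_zero
    exact (mul_eq_zero.1 this.symm).resolve_left hf

/-- Harmonic polynomials. -/
def Harm : Submodule ℂ CPoly := LinearMap.ker lap

theorem mem_Harm {f : CPoly} : f ∈ Harm ↔ lap f = 0 := LinearMap.mem_ker

/-- `Ψ` is the space of harmonic polynomials. -/
def psiEquiv : Psi ≃ₗ[ℂ] Harm :=
  LinearEquiv.ofBijective
    ((comm.toLinearMap.comp Psi.subtype).codRestrict Harm fun ξ =>
      mem_Harm.2 (mem_Psi_iff.1 ξ.2).2)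
    ⟨fun ξ ζ h => Subtype.ext (comm_injOn_symm ξ.2.1 ζ.2.1 (congrArg Subtype.val h)),
      fun f => ⟨⟨symmetrize f, mem_Psi_iff.2 ⟨isSymm_symmetrize _, by
        rw [comm_symmetrize]; exact mem_Harm.1 f.2⟩⟩, Subtype.ext (comm_symmetrize _)⟩⟩

theorem psiEquiv_coe (ξ : Psi) : (psiEquiv ξ : CPoly) = comm ξ := rfl

theorem comm_psiEquiv_symm (f : Harm) : comm (psiEquiv.symm f) = f := by
  rw [← psiEquiv_coe, LinearEquiv.apply_symm_apply]

/-! ### Decomposition into harmonic polynomials and multiples of the quadratic form -/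

/-- The quadratic form `a₊a₋ + b₊b₋`. -/
def quad : CPoly := X .ap * X .am + X .bp * X .bm

theorem isHomogeneous_quad : quad.IsHomogeneous 2 :=
  ((isHomogeneous_X ℂ Gen.ap).mul (isHomogeneous_X ℂ Gen.am)).add
    ((isHomogeneous_X ℂ Gen.bp).mul (isHomogeneous_X ℂ Gen.bm))

theorem quad_ne_zero : quad ≠ 0 := by
  intro h
  have := congrArg (eval (fun _ => (1 : ℂ))) h
  simp [quad] at this

theorem pderiv_X_gen (g h : Gen) : pderiv g (X h : CPoly) = if h = g then 1 else 0 := by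
  rw [pderiv_X, Pi.single_apply]

/-- The mixed terms of the product rule form the Euler operator, which contributes d; the 2 is the
Laplacian of `quad`. -/
theorem lap_quad_mul {f : CPoly} {d : ℕ} (hf : f.IsHomogeneous d) :
    lap (quad * f) = (d + 2 : ℂ) • f + quad * lap f := by
  have he := hf.sum_X_mul_pderiv
  rw [sum_gen, nsmul_eq_mul] at he
  simp only [lap_apply, quad, pderiv_mul, map_add, pderiv_X_gen, reduceCtorEq, if_true, if_false,
    smul_eq_C_mul, map_zero, pderiv_one]
  rw [map_natCast, show C (2 : ℂ) = (2 : CPoly) from map_ofNat C 2]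
  linear_combination he

theorem IsHomogeneous.lap {f : CPoly} {d : ℕ} (hf : f.IsHomogeneous (d + 2)) :
    (lap f).IsHomogeneous d :=
  (hf.pderiv.pderiv).add (hf.pderiv.pderiv)

theorem lap_eq_zero_of_degree {f : CPoly} {d : ℕ} (hf : f.IsHomogeneous d) (hd : d < 2) :
    lap f = 0 := by
  have h0 : ∀ g h, pderiv g (pderiv h f) = 0 := by
    intro g h
    ext m
    rw [coeff_pderiv, coeff_pderiv, hf.coeff_eq_zero, zero_mul, zero_mul, coeff_zero]
    simp only [map_add, Finsupp.degree_single]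
    omega
  rw [lap_apply, h0, h0, add_zero]

/-- Iterating `lap_quad_mul` adds up d + 2 + 2l for l = 0, …, k, which is (k + 1)(k + 2 + d). This
is never zero, which is all that the decomposition requires. -/
theorem lap_quad_pow_mul {f : CPoly} {d : ℕ} (hf : f.IsHomogeneous d) (k : ℕ) :
    lap (quad ^ (k + 1) * f) =
      ((k + 1) * (k + 2 + d) : ℂ) • (quad ^ k * f) + quad ^ (k + 1) * lap f := by
  induction k with
  | zero =>
    rw [zero_add, pow_one, lap_quad_mul hf]
    simp [add_comm]
  | succ k ih =>
    have h1 : (quad ^ (k + 1) * f).IsHomogeneous (2 * (k + 1) + d) :=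
      (isHomogeneous_quad.pow _).mul hf
    rw [pow_succ' quad (k + 1), mul_assoc, lap_quad_mul h1, ih]
    push_cast
    simp only [smul_eq_C_mul, map_add, map_mul, map_natCast, map_one, map_ofNat]
    ring

/-- Injectivity of f ↦ Δ(qᵏ⁺¹f). The equation forces f to be a multiple of qΔf; then Δf satisfies
the same hypothesis with k + 1 and smaller degree, which is why k has to vary. -/
theorem eq_zero_of_lap_quad_pow {f : CPoly} {d : ℕ} (hf : f.IsHomogeneous d) (k : ℕ)
    (h : lap (quad ^ (k + 1) * f) = 0) : f = 0 := by
  induction d using Nat.strong_induction_on generalizing f k with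
  | _ d ih =>
    rw [lap_quad_pow_mul hf] at h
    have hc : ((k + 1) * (k + 2 + d) : ℂ) ≠ 0 := by
      exact_mod_cast Nat.mul_ne_zero (by omega) (by omega)
    set c : ℂ := (k + 1) * (k + 2 + d)
    have hfe : f = -c⁻¹ • (quad * lap f) := by
      have hq : quad ^ k ≠ 0 := pow_ne_zero _ quad_ne_zero
      apply mul_left_cancel₀ hq
      have h2 : quad ^ k * f = c⁻¹ • (c • (quad ^ k * f)) := by
        rw [smul_smul, inv_mul_cancel₀ hc, one_smul]
      rw [h2, eq_neg_of_add_eq_zero_left h]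
      simp only [smul_eq_C_mul, map_neg]
      ring
    by_cases hd : d < 2
    · rw [hfe, lap_eq_zero_of_degree hf hd, mul_zero, smul_zero]
    · obtain ⟨e, rfl⟩ := Nat.exists_eq_add_of_le' (not_lt.1 hd)
      have h3 : lap f = 0 := by
        refine ih e (by omega) (IsHomogeneous.lap hf) (k + 1) ?_
        have h4 : quad ^ (k + 1) * f = -c⁻¹ • (quad ^ (k + 1 + 1) * lap f) := by
          conv_lhs => rw [hfe]
          simp only [smul_eq_C_mul]
          ring
        have h5 : quad ^ (k + 1 + 1) * lap f = -c • (quad ^ (k + 1) * f) := by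
          rw [h4, smul_smul]
          simp [hc]
        rw [h5, map_smul, lap_quad_pow_mul hf, h, smul_zero]
      rw [hfe, h3, mul_zero, smul_zero]

/-- Surjectivity of g ↦ Δ(qg). The first guess, a multiple of qᵏf, leaves an error proportional to
qᵏ⁺¹Δf, which is removed by induction on the degree of f. Only k = 0 is used in the end. -/
theorem exists_lap_quad_mul {f : CPoly} {d : ℕ} (hf : f.IsHomogeneous d) (k : ℕ) :
    ∃ g : CPoly, g.IsHomogeneous (2 * k + d) ∧ lap (quad * g) = quad ^ k * f := by
  induction d using Nat.strong_induction_on generalizing f k with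
  | _ d ih =>
    have hc : ((k + 1) * (k + 2 + d) : ℂ) ≠ 0 := by
      exact_mod_cast Nat.mul_ne_zero (by omega) (by omega)
    obtain ⟨g, hg, hg2⟩ : ∃ g : CPoly, g.IsHomogeneous (2 * k + d) ∧
        lap (quad * g) = quad ^ (k + 1) * lap f := by
      by_cases hd : d < 2
      · exact ⟨0, isHomogeneous_zero _ _ _, by rw [lap_eq_zero_of_degree hf hd]; simp⟩
      · obtain ⟨e, rfl⟩ := Nat.exists_eq_add_of_le' (not_lt.1 hd)
        obtain ⟨g, hg, hg2⟩ := ih e (by omega) (IsHomogeneous.lap hf) (k + 1)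
        refine ⟨g, ?_, hg2⟩
        rwa [show 2 * k + (e + 2) = 2 * (k + 1) + e by ring]
    refine ⟨((k + 1) * (k + 2 + d) : ℂ)⁻¹ • (quad ^ k * f - g),
      (homogeneousSubmodule _ _ _).smul_mem _ (((isHomogeneous_quad.pow k).mul hf).sub hg), ?_⟩
    rw [mul_smul_comm, map_smul, mul_sub, map_sub, hg2, ← mul_assoc, ← pow_succ',
      lap_quad_pow_mul hf, add_sub_cancel_right, smul_smul, inv_mul_cancel₀ hc, one_smul]

theorem exists_harmonic_add_quad_mul {f : CPoly} {d : ℕ} (hf : f.IsHomogeneous d) :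
    f ∈ Harm ∨ ∃ e, d = e + 2 ∧ ∃ h ∈ Harm, ∃ g : CPoly, g.IsHomogeneous e ∧ f = h + quad * g := by
  by_cases hd : d < 2
  · exact Or.inl (mem_Harm.2 (lap_eq_zero_of_degree hf hd))
  · obtain ⟨e, rfl⟩ := Nat.exists_eq_add_of_le' (not_lt.1 hd)
    -- Solve Δ(qg) = Δf, so that f - qg is harmonic.
    obtain ⟨g, hg, hg2⟩ := exists_lap_quad_mul (IsHomogeneous.lap hf) 0
    refine Or.inr ⟨e, rfl, f - quad * g, mem_Harm.2 ?_, g, by simpa using hg, by ring⟩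
    rw [map_sub, hg2, pow_zero, one_mul, sub_self]

/-- Induction by means of the decomposition into a harmonic polynomial and a multiple of the
quadratic form. -/
theorem harmonic_induction {p : CPoly → Prop} (hadd : ∀ f g, p f → p g → p (f + g))
    (hharm : ∀ h ∈ Harm, p h)
    (hquad : ∀ g d, g.IsHomogeneous d → (∀ g' : CPoly, g'.IsHomogeneous d → p g') → p (quad * g))
    (f : CPoly) : p f := by
  have hhom : ∀ d, ∀ f : CPoly, f.IsHomogeneous d → p f := by
    intro d
    induction d using Nat.strong_induction_on with
    | _ d ih =>
      intro f hf
      rcases exists_harmonic_add_quad_mul hf with h | ⟨e, rfl, h, hh, g, hg, rfl⟩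
      · exact hharm f h
      · exact hadd _ _ (hharm h hh) (hquad g e hg (ih e (by omega)))
  rw [← sum_homogeneousComponent f]
  refine Finset.sum_induction _ p hadd (hharm 0 (Submodule.zero_mem _)) fun d _ => ?_
  exact hhom d _ (homogeneousComponent_isHomogeneous d f)

/-- Shows that Δ respects the grading, and is used again to eliminate products b₊b₋ from harmonic
polynomials. -/
theorem coeff_lap (f : CPoly) (m : Gen →₀ ℕ) :
    coeff m (lap f) =
      (m .ap + 1) * (m .am + 1) * coeff (m + Finsupp.single .ap 1 + Finsupp.single .am 1) f +
      (m .bp + 1) * (m .bm + 1) * coeff (m + Finsupp.single .bp 1 + Finsupp.single .bm 1) f := by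
  rw [lap_apply, coeff_add, coeff_pderiv, coeff_pderiv, coeff_pderiv, coeff_pderiv]
  simp
  ring

theorem homogeneousComponent_mem_Harm {f : CPoly} (hf : f ∈ Harm) (n : ℕ) :
    homogeneousComponent n f ∈ Harm := by
  rw [mem_Harm] at hf ⊢
  ext m
  have h := congrArg (coeff m) hf
  rw [coeff_lap] at h ⊢
  rw [coeff_homogeneousComponent, coeff_homogeneousComponent]
  simp only [map_add, Finsupp.degree_single]
  split_ifs with hn
  · exact h
  · simp

theorem homogeneousComponent_quad_mul (f : CPoly) (n : ℕ) :
    homogeneousComponent (n + 2) (quad * f) = quad * homogeneousComponent n f := by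
  conv_lhs => rw [← sum_homogeneousComponent f, Finset.mul_sum, map_sum]
  have h1 : ∀ i, homogeneousComponent (n + 2) (quad * homogeneousComponent i f) =
      if i = n then quad * homogeneousComponent n f else 0 := by
    intro i
    have h2 : (quad * homogeneousComponent i f).IsHomogeneous (2 + i) :=
      isHomogeneous_quad.mul (homogeneousComponent_isHomogeneous i f)
    rw [homogeneousComponent_of_mem h2]
    split_ifs with h3 h4 h4
    · rw [h4]
    · omega
    · omega
    · rfl
  simp only [h1]
  rw [Finset.sum_ite_eq']
  split_ifs with h
  · rfl
  · rw [homogeneousComponent_eq_zero n f (by simpa using h), mul_zero]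

theorem homogeneousComponent_totalDegree_ne_zero {f : CPoly} (hf : f ≠ 0) :
    homogeneousComponent f.totalDegree f ≠ 0 := by
  obtain ⟨m, hm, hm2⟩ := f.support.exists_mem_eq_sup (support_nonempty.2 hf)
    (fun s => s.sum fun _ e => e)
  intro h
  have h1 := congrArg (coeff m) h
  rw [coeff_homogeneousComponent, if_pos, coeff_zero] at h1
  · exact (mem_support_iff.1 hm) h1
  · rw [totalDegree, hm2]; rfl

/-- A harmonic polynomial is not the sum of a nonzero multiple `z f` of the quadratic form and a
polynomial of degree at most `deg f`. -/
theorem eq_zero_of_quad_mul_add_mem_Harm {f g : CPoly} (h : quad * f + g ∈ Harm)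
    (hg : g.totalDegree ≤ f.totalDegree) : f = 0 := by
  by_contra hf
  have h1 := homogeneousComponent_mem_Harm h (f.totalDegree + 2)
  rw [map_add, homogeneousComponent_quad_mul, homogeneousComponent_eq_zero _ g (by omega),
    add_zero, mem_Harm] at h1
  refine homogeneousComponent_totalDegree_ne_zero hf (eq_zero_of_lap_quad_pow
    (homogeneousComponent_isHomogeneous _ f) 0 ?_)
  simpa using h1

/-! ### Normal ordering and symbols in 𝒲(ε) -/

/-- The derivation by which a letter, acting from the left on normally ordered polynomials, differs
from multiplication (divided by `ε`). -/
def contraction : Gen → CPoly →ₗ[ℂ] CPoly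
  | .ap => 0
  | .am => (pderiv .ap).toLinearMap
  | .bp => 0
  | .bm => (pderiv .bp).toLinearMap

/-- The action of a letter on normally ordered polynomials. -/
def letterOp (ε : ℝ) (g : Gen) : Module.End ℂ CPoly :=
  LinearMap.mulLeft ℂ (X g) + (ε : ℂ) • contraction g

theorem letterOp_apply (ε : ℝ) (g : Gen) (f : CPoly) :
    letterOp ε g f = X g * f + (ε : ℂ) • contraction g f := rfl

/-- The action of the free algebra on normally ordered polynomials. -/
def freeRep (ε : ℝ) : FreePoly →ₐ[ℂ] Module.End ℂ CPoly :=
  MonoidAlgebra.lift ℂ _ (FreeMonoid Gen) (FreeMonoid.lift (letterOp ε))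

theorem freeRep_gen (ε : ℝ) (g : Gen) : freeRep ε (gen g) = letterOp ε g := by
  simp [freeRep, gen, word, MonoidAlgebra.lift_single]

theorem freeRep_rel (ε : ℝ) ⦃x y : FreePoly⦄ (h : WeylRel ε x y) : freeRep ε x = freeRep ε y := by
  cases h with
  | a =>
    refine LinearMap.ext fun f => ?_
    simp only [map_sub, map_mul, freeRep_gen, AlgHom.commutes, LinearMap.sub_apply,
      Module.End.mul_apply, letterOp_apply, contraction, Module.algebraMap_end_apply,
      LinearMap.zero_apply, smul_zero, add_zero, Derivation.coeFn_coe, pderiv_mul, pderiv_X_gen,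
      if_true, smul_eq_C_mul]
    ring
  | b =>
    refine LinearMap.ext fun f => ?_
    simp only [map_sub, map_mul, freeRep_gen, AlgHom.commutes, LinearMap.sub_apply,
      Module.End.mul_apply, letterOp_apply, contraction, Module.algebraMap_end_apply,
      LinearMap.zero_apply, smul_zero, add_zero, Derivation.coeFn_coe, pderiv_mul, pderiv_X_gen,
      if_true, smul_eq_C_mul]
    ring
  | ab x y hx hy =>
    refine LinearMap.ext fun f => ?_
    rcases hx with rfl | rfl <;> rcases hy with rfl | rfl <;>
    · simp only [map_sub, map_mul, freeRep_gen, LinearMap.sub_apply, map_zero,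
        Module.End.mul_apply, letterOp_apply, contraction, map_add, pderiv_C,
        LinearMap.zero_apply, smul_zero, add_zero, Derivation.coeFn_coe, pderiv_mul, pderiv_X_gen,
        reduceCtorEq, if_false, smul_eq_C_mul, pderiv_pderiv_comm Gen.ap Gen.bp]
      ring

/-- The action of `𝒲(ε)` on normally ordered polynomials. -/
def weylRep (ε : ℝ) : Weyl ε →ₐ[ℂ] Module.End ℂ CPoly :=
  RingQuot.liftAlgHom ℂ ⟨freeRep ε, freeRep_rel ε⟩

theorem weylRep_toWeyl (ε : ℝ) (ξ : FreePoly) : weylRep ε (toWeyl ε ξ) = freeRep ε ξ :=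
  RingQuot.liftAlgHom_mkAlgHom_apply ℂ _ _ ξ

theorem toWeyl_surjective (ε : ℝ) : Function.Surjective (toWeyl ε) :=
  RingQuot.mkAlgHom_surjective ℂ _

theorem toWeyl_rel {ε : ℝ} {x y : FreePoly} (h : WeylRel ε x y) : toWeyl ε x = toWeyl ε y :=
  RingQuot.mkAlgHom_rel ℂ h

/-- A generator in `𝒲(ε)`. -/
def wgen (ε : ℝ) (g : Gen) : Weyl ε := toWeyl ε (gen g)

theorem wgen_comm_ab (ε : ℝ) (x y : Gen) (hx : x = .ap ∨ x = .am) (hy : y = .bp ∨ y = .bm) :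
    Commute (wgen ε x) (wgen ε y) := by
  have := toWeyl_rel (WeylRel.ab (ε := ε) x y hx hy)
  rwa [map_sub, map_mul, map_mul, map_zero, sub_eq_zero] at this

theorem wgen_am_mul_ap (ε : ℝ) :
    wgen ε .am * wgen ε .ap = wgen ε .ap * wgen ε .am + (ε : ℂ) • 1 := by
  have := toWeyl_rel (WeylRel.a (ε := ε))
  rw [map_sub, map_mul, map_mul, AlgHom.commutes, sub_eq_iff_eq_add, Algebra.algebraMap_eq_smul_one,
    add_comm] at this
  exact this

theorem wgen_bm_mul_bp (ε : ℝ) :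
    wgen ε .bm * wgen ε .bp = wgen ε .bp * wgen ε .bm + (ε : ℂ) • 1 := by
  have := toWeyl_rel (WeylRel.b (ε := ε))
  rw [map_sub, map_mul, map_mul, AlgHom.commutes, sub_eq_iff_eq_add, Algebra.algebraMap_eq_smul_one,
    add_comm] at this
  exact this

/-- For n = 0 the truncated exponent n - 1 is harmless because its coefficient vanishes. -/
theorem mul_pow_of_heisenberg {A : Type*} [Ring A] [Algebra ℂ A] {x y : A} {c : ℂ}
    (h : x * y = y * x + c • 1) (n : ℕ) : x * y ^ n = y ^ n * x + (c * n) • y ^ (n - 1) := by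
  induction n with
  | zero => simp
  | succ n ih =>
    rw [pow_succ, ← mul_assoc, ih, add_mul, mul_assoc, h, mul_add, ← mul_assoc, add_assoc]
    congr 1
    cases n with
    | zero => simp
    | succ n =>
      rw [smul_mul_assoc, Nat.add_sub_cancel, Nat.add_sub_cancel, ← pow_succ, mul_smul_comm,
        mul_one, ← add_smul]
      congr 1
      push_cast
      ring

/-- The normally ordered monomial in `𝒲(ε)`. -/
def normalMonomial (ε : ℝ) (m : Gen →₀ ℕ) : Weyl ε :=
  wgen ε .ap ^ m .ap * wgen ε .bp ^ m .bp * wgen ε .am ^ m .am * wgen ε .bm ^ m .bm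

/-- Normal ordering. -/
def normalOrder (ε : ℝ) : CPoly →ₗ[ℂ] Weyl ε :=
  (basisMonomials Gen ℂ).constr ℂ (normalMonomial ε)

theorem normalOrder_monomial (ε : ℝ) (m : Gen →₀ ℕ) (c : ℂ) :
    normalOrder ε (monomial m c) = c • normalMonomial ε m := by
  have h : monomial m c = c • basisMonomials Gen ℂ m := by simp [smul_monomial]
  rw [h, map_smul, normalOrder, Module.Basis.constr_basis]

theorem X_mul_monomial (g : Gen) (m : Gen →₀ ℕ) (c : ℂ) :
    X g * monomial m c = monomial (m + Finsupp.single g 1) c := by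
  rw [X, monomial_mul, one_mul, add_comm]

/-- A letter multiplied from the left moves to its place in a normally ordered monomial; only a₋
passing a₊ and b₋ passing b₊ leave a term, the one recorded by `contraction`. -/
theorem normalOrder_letterOp (ε : ℝ) (g : Gen) (f : CPoly) :
    normalOrder ε (letterOp ε g f) = wgen ε g * normalOrder ε f := by
  induction f using MvPolynomial.induction_on' with
  | add p q hp hq => rw [map_add, map_add, hp, hq, map_add, mul_add]
  | monomial m c =>
    rw [letterOp_apply, map_add, map_smul, X_mul_monomial, normalOrder_monomial,
      normalOrder_monomial, mul_smul_comm]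
    cases g with
    | ap =>
      simp [contraction, normalMonomial, pow_succ', mul_assoc]
    | bp =>
      have h := (wgen_comm_ab ε .ap .bp (Or.inl rfl) (Or.inl rfl)).pow_left (m .ap)
      simp only [contraction, normalMonomial, pow_succ', mul_assoc, LinearMap.zero_apply,
        map_zero, smul_zero, add_zero, Finsupp.add_apply, Finsupp.single_apply, if_true,
        reduceCtorEq, if_false]
      rw [h.left_comm]
    | am =>
      have h1 := (wgen_comm_ab ε .am .bp (Or.inr rfl) (Or.inl rfl)).pow_right (m .bp)
      have h2 := mul_pow_of_heisenberg (wgen_am_mul_ap ε) (m .ap)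
      simp only [contraction, Derivation.coeFn_coe, pderiv_monomial, normalOrder_monomial,
        normalMonomial, Finsupp.add_apply, Finsupp.single_apply, Finsupp.tsub_apply, if_true,
        reduceCtorEq, if_false, add_zero, tsub_zero]
      simp only [← mul_assoc, h2]
      rw [pow_succ']
      simp only [add_mul, mul_assoc, smul_mul_assoc, smul_add, smul_smul, h1.left_comm]
      congr 2
      ring
    | bm =>
      have h1 := (wgen_comm_ab ε .ap .bm (Or.inl rfl) (Or.inr rfl)).symm.pow_right (m .ap)
      have h2 := mul_pow_of_heisenberg (wgen_bm_mul_bp ε) (m .bp)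
      have h3 := (wgen_comm_ab ε .am .bm (Or.inr rfl) (Or.inr rfl)).symm.pow_right (m .am)
      simp only [contraction, Derivation.coeFn_coe, pderiv_monomial, normalOrder_monomial,
        normalMonomial, Finsupp.add_apply, Finsupp.single_apply, Finsupp.tsub_apply, if_true,
        reduceCtorEq, if_false, add_zero, tsub_zero]
      rw [mul_assoc, mul_assoc, mul_assoc, mul_assoc, mul_assoc, mul_assoc, h1.left_comm,
        ← mul_assoc (wgen ε .bm), h2, pow_succ']
      simp only [add_mul, mul_add, mul_assoc, smul_mul_assoc, mul_smul_comm, smul_add, smul_smul,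
        h3.left_comm]
      congr 2
      ring

theorem normalOrder_weylRep (ε : ℝ) (w : Weyl ε) (f : CPoly) :
    normalOrder ε (weylRep ε w f) = w * normalOrder ε f := by
  obtain ⟨ξ, rfl⟩ := toWeyl_surjective ε w
  rw [weylRep_toWeyl]
  induction ξ using gen_induction generalizing f with
  | h1 => simp
  | hgen g ξ ih =>
    rw [map_mul, Module.End.mul_apply, freeRep_gen, normalOrder_letterOp, ih, map_mul, mul_assoc]
    rfl
  | hadd ξ ζ h1 h2 => rw [map_add, LinearMap.add_apply, map_add, h1, h2, map_add, add_mul]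
  | hsmul c ξ h => rw [map_smul, LinearMap.smul_apply, map_smul, h, map_smul, smul_mul_assoc]

/-- The normally ordered symbol. -/
def symbol (ε : ℝ) : Weyl ε →ₗ[ℂ] CPoly where
  toFun w := weylRep ε w 1
  map_add' v w := by rw [map_add, LinearMap.add_apply]
  map_smul' c w := by rw [map_smul, LinearMap.smul_apply, RingHom.id_apply]

theorem symbol_apply (ε : ℝ) (w : Weyl ε) : symbol ε w = weylRep ε w 1 := rfl

theorem symbol_mul (ε : ℝ) (v w : Weyl ε) : symbol ε (v * w) = weylRep ε v (symbol ε w) := by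
  rw [symbol_apply, map_mul, Module.End.mul_apply, symbol_apply]

/-- With `symbol_normalOrder` this is the Poincaré–Birkhoff–Witt statement: normally ordered
monomials form a basis of 𝒲(ε). -/
theorem normalOrder_symbol (ε : ℝ) (w : Weyl ε) : normalOrder ε (symbol ε w) = w := by
  rw [symbol_apply, normalOrder_weylRep, ← C_1, ← monomial_zero', normalOrder_monomial]
  simp [normalMonomial]

theorem symbol_injective (ε : ℝ) : Function.Injective (symbol ε) :=
  Function.LeftInverse.injective (normalOrder_symbol ε)

theorem weylRep_wgen (ε : ℝ) (g : Gen) : weylRep ε (wgen ε g) = letterOp ε g := by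
  rw [wgen, weylRep_toWeyl, freeRep_gen]

theorem letterOp_pow_apply (ε : ℝ) (g : Gen) (n : ℕ) (f : CPoly) (h : contraction g f = 0)
    (hX : contraction g (X g) = 0) : (letterOp ε g ^ n) f = X g ^ n * f := by
  have key : ∀ n, contraction g (X g ^ n * f) = 0 := by
    intro n
    cases g <;> simp_all [contraction]
  induction n with
  | zero => simp
  | succ n ih =>
    rw [pow_succ', Module.End.mul_apply, ih, letterOp_apply, key, smul_zero, add_zero, pow_succ',
      mul_assoc]

theorem symbol_normalOrder (ε : ℝ) (f : CPoly) : symbol ε (normalOrder ε f) = f := by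
  induction f using MvPolynomial.induction_on' with
  | add p q hp hq => rw [map_add, map_add, hp, hq]
  | monomial m c =>
    have hX : ∀ g, contraction g (X g) = 0 := by
      intro g
      cases g <;> simp [contraction]
    rw [normalOrder_monomial, map_smul, normalMonomial, symbol_apply]
    simp only [map_mul, map_pow, weylRep_wgen, Module.End.mul_apply]
    -- The letters a₋ and b₋ act before any a₊ or b₊ is present, so all contractions vanish.
    rw [letterOp_pow_apply ε .bm _ _ (by simp [contraction]) (hX _),
      letterOp_pow_apply ε .am _ _ (by simp [contraction]) (hX _),
      letterOp_pow_apply ε .bp _ _ (by simp [contraction]) (hX _),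
      letterOp_pow_apply ε .ap _ _ (by simp [contraction]) (hX _), monomial_eq,
      Finsupp.prod_fintype _ _ (by simp), smul_eq_C_mul]
    have h : (Finset.univ : Finset Gen) = {.ap, .am, .bp, .bm} := rfl
    rw [h, Finset.prod_insert (by decide), Finset.prod_insert (by decide),
      Finset.prod_insert (by decide), Finset.prod_singleton]
    ring

theorem strip_mem_Psi {ξ : FreePoly} (h : ξ ∈ Psi) (g : Gen) : strip g ξ ∈ Psi := by
  refine ⟨IsSymm.strip h.1 g, fun l => ?_⟩
  have := h.2 (g :: l)
  rw [traceCoeff] at this ⊢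
  simpa only [wordCoeff_strip, List.cons_append] using this

/-- On `Ψ` the normally ordered symbol is the commutative image. -/
theorem freeRep_apply_one {ξ : FreePoly} (h : ξ ∈ Psi) (ε : ℝ) : freeRep ε ξ 1 = comm ξ := by
  refine symm_induction (ξ := ξ) (p := fun ξ => ξ ∈ Psi → freeRep ε ξ 1 = comm ξ) h.1 (by simp)
    (fun ξ hξ ih h => ?_) h
  -- The total contraction produced when the first letters of ξ act on the symbols of the remaining
  -- words. It is the trace of ξ, up to a factor depending on the degree, and is therefore zero.
  have h0 : comm (strip .ap (degOp (strip .am ξ)) + strip .bp (degOp (strip .bm ξ))) = 0 := by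
    have : strip .ap (degOp (strip .am ξ)) + strip .bp (degOp (strip .bm ξ)) = 0 := by
      apply freePoly_ext
      intro l
      have h2 := h.2 l
      rw [traceCoeff_eq_of_symm hξ] at h2
      simp only [wordCoeff_add, wordCoeff_strip, wordCoeff_degOp, wordCoeff_zero, List.length_cons]
      linear_combination ((l.length + 1 : ℕ) : ℂ) / 2 * h2
    rw [this, map_zero]
  rw [map_add, ← pderiv_comm _ (hξ.strip _), ← pderiv_comm _ (hξ.strip _)] at h0
  have ih' : ∀ g, freeRep ε (strip g ξ) 1 = comm (strip g ξ) := fun g => ih g (strip_mem_Psi h g)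
  rw [comm_eq_sum_strip]
  conv_lhs => rw [eq_const_add_sum_strip ξ]
  simp only [map_add, map_smul, map_one, map_sum, map_mul, LinearMap.add_apply,
    LinearMap.smul_apply, Module.End.one_apply, LinearMap.sum_apply, Module.End.mul_apply,
    freeRep_gen, ih', letterOp_apply, Finset.sum_add_distrib, smul_eq_C_mul, mul_one]
  congr 1
  simp only [sum_gen, contraction, LinearMap.zero_apply, mul_zero, zero_add, add_zero,
    Derivation.coeFn_coe, ← mul_add, h0]

theorem symbol_toWeyl_Psi (ε : ℝ) (ξ : Psi) : symbol ε (toWeyl ε ξ) = comm ξ := by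
  rw [symbol_apply, weylRep_toWeyl, freeRep_apply_one ξ.2]

theorem freeRep_zero (ξ : FreePoly) (f : CPoly) : freeRep 0 ξ f = comm ξ * f := by
  induction ξ using gen_induction generalizing f with
  | h1 => simp
  | hgen g ξ ih =>
    rw [map_mul, Module.End.mul_apply, freeRep_gen, letterOp_apply, ih, map_mul comm, comm_gen]
    simp [mul_assoc]
  | hadd ξ ζ h1 h2 => rw [map_add, LinearMap.add_apply, h1, h2, map_add, add_mul]
  | hsmul c ξ h => rw [map_smul, LinearMap.smul_apply, h, map_smul, smul_mul_assoc]

/-! ### The left ideal of K₀ - R̂ and the projection ρ -/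

/-- The number of letters `a₋`, `b₋`. -/
def minusDeg : CPoly →ₗ[ℂ] CPoly :=
  LinearMap.mulLeft ℂ (X .am) ∘ₗ (pderiv .am).toLinearMap +
    LinearMap.mulLeft ℂ (X .bm) ∘ₗ (pderiv .bm).toLinearMap

theorem minusDeg_apply (f : CPoly) :
    minusDeg f = X .am * pderiv .am f + X .bm * pderiv .bm f := rfl

/-- Right multiplication by `K₀ - R̂` on normally ordered polynomials. -/
def rightK (ε R : ℝ) : CPoly →ₗ[ℂ] CPoly :=
  (1 / 2 : ℂ) • (LinearMap.mulLeft ℂ quad + (ε : ℂ) • (minusDeg + 1)) - (Rhat ε R : ℂ) • 1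

theorem rightK_apply (ε R : ℝ) (f : CPoly) : rightK ε R f =
    (1 / 2 : ℂ) • (quad * f + (ε : ℂ) • (minusDeg f + f)) - (Rhat ε R : ℂ) • f := rfl

/-- Right multiplications commute with left ones. Once this is known for `rightK`, it is identified
as right multiplication by K₀ - R̂ by its value at 1 alone. -/
theorem rightK_letterOp (ε R : ℝ) (g : Gen) (f : CPoly) :
    rightK ε R (letterOp ε g f) = letterOp ε g (rightK ε R f) := by
  simp only [rightK_apply, letterOp_apply, minusDeg_apply, quad]
  cases g <;>
  · simp only [contraction, LinearMap.zero_apply, smul_zero, add_zero, map_add, map_sub,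
      Derivation.coeFn_coe, pderiv_mul, pderiv_X_gen, reduceCtorEq, if_true, if_false,
      smul_eq_C_mul, pderiv_C, pderiv_pderiv_comm .ap .am, pderiv_pderiv_comm .ap .bm,
      pderiv_pderiv_comm .bp .am, pderiv_pderiv_comm .bp .bm]
    have h2 : C (1 / 2 : ℂ) * 2 = (1 : CPoly) := by
      rw [← map_ofNat C 2, ← C_mul]
      norm_num
    ring

theorem rightK_weylRep (ε R : ℝ) (w : Weyl ε) (f : CPoly) :
    rightK ε R (weylRep ε w f) = weylRep ε w (rightK ε R f) := by
  obtain ⟨ξ, rfl⟩ := toWeyl_surjective ε w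
  rw [weylRep_toWeyl]
  induction ξ using gen_induction generalizing f with
  | h1 => simp
  | hgen g ξ ih =>
    simp only [map_mul, Module.End.mul_apply, freeRep_gen, rightK_letterOp, ih]
  | hadd ξ ζ h1 h2 => simp only [map_add, LinearMap.add_apply, h1, h2]
  | hsmul c ξ h => simp only [map_smul, LinearMap.smul_apply, h]

theorem symbol_mul_K0_sub (ε R : ℝ) (v : Weyl ε) :
    symbol ε (v * (K0 ε - algebraMap ℂ (Weyl ε) (Rhat ε R))) = rightK ε R (symbol ε v) := by
  -- Both sides are now v acting on a polynomial: the symbol of K₀ - R̂ on the left, `rightK ε R 1`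
  -- on the right.
  rw [symbol_mul, symbol_apply ε v, rightK_weylRep]
  congr 1
  rw [K0, map_sub, map_smul, map_add, rightK_apply]
  simp only [symbol_apply, AlgHom.commutes, weylRep_toWeyl, map_add, map_mul, freeRep_gen,
    Module.End.mul_apply, letterOp_apply, Module.algebraMap_end_apply,
    contraction, minusDeg_apply, quad, Derivation.coeFn_coe, LinearMap.zero_apply]
  simp

theorem inKerRho_iff (ε R : ℝ) (w : Weyl ε) :
    InKerRho ε R w ↔ ∃ f, symbol ε w = rightK ε R f := by
  constructor
  · rintro ⟨v, rfl⟩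
    exact ⟨symbol ε v, symbol_mul_K0_sub ε R v⟩
  · rintro ⟨f, hf⟩
    refine ⟨normalOrder ε f, symbol_injective ε ?_⟩
    rw [symbol_mul_K0_sub, symbol_normalOrder, hf]

theorem IsHomogeneous.minusDeg {f : CPoly} {d : ℕ} (hf : f.IsHomogeneous d) :
    (minusDeg f).IsHomogeneous d := by
  cases d with
  | zero =>
    rw [minusDeg_apply]
    have h0 : ∀ g, X g * pderiv g f = 0 := by
      intro g
      rw [← totalDegree_zero_iff_isHomogeneous, totalDegree_eq_zero_iff_eq_C] at hf
      rw [hf, pderiv_C, mul_zero]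
    rw [h0, h0, add_zero]
    exact isHomogeneous_zero _ _ _
  | succ d =>
    have h0 : ∀ g, (X g * pderiv g f).IsHomogeneous (d + 1) := by
      intro g
      rw [add_comm]
      exact (isHomogeneous_X ℂ g).mul hf.pderiv
    exact (h0 _).add (h0 _)

theorem totalDegree_minusDeg_le (f : CPoly) : (minusDeg f).totalDegree ≤ f.totalDegree := by
  conv_lhs => rw [← sum_homogeneousComponent f, map_sum]
  refine totalDegree_finsetSum_le fun d hd => ?_
  exact (IsHomogeneous.totalDegree_le (IsHomogeneous.minusDeg
    (homogeneousComponent_isHomogeneous d f))).trans (by simpa [Nat.lt_succ_iff] using hd)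

/-- Twice `rightK ε R f` is qf plus a polynomial of degree at most deg f, so harmonicity would make
the top component of qf harmonic. -/
theorem eq_zero_of_rightK_mem_Harm {ε R : ℝ} {f : CPoly} (h : rightK ε R f ∈ Harm) : f = 0 := by
  have h1 : (2 : ℂ) • rightK ε R f =
      quad * f + ((ε : ℂ) • (minusDeg f + f) - (2 * Rhat ε R : ℂ) • f) := by
    rw [rightK_apply, smul_sub, smul_smul, smul_smul]
    norm_num
    abel
  have h2 := Submodule.smul_mem Harm (2 : ℂ) h
  rw [h1] at h2
  refine eq_zero_of_quad_mul_add_mem_Harm h2 ?_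
  refine (totalDegree_sub _ _).trans (max_le ?_ (totalDegree_smul_le _ _))
  exact (totalDegree_smul_le _ _).trans ((totalDegree_add _ _).trans
    (max_le (totalDegree_minusDeg_le f) le_rfl))

theorem quad_mul_eq (ε R : ℝ) (f : CPoly) : quad * f =
    rightK ε R ((2 : ℂ) • f) + ((2 * Rhat ε R : ℂ) • f - (ε : ℂ) • (minusDeg f + f)) := by
  rw [rightK_apply, map_smul]
  simp only [smul_eq_C_mul, C_mul, mul_add]
  have h2 : C (1 / 2 : ℂ) * C 2 = (1 : CPoly) := by
    rw [← C_mul]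
    norm_num
  linear_combination (-(quad * f) - C (ε : ℂ) * (minusDeg f + f)) * h2

/-- Modulo the image of `rightK`, a product qg equals a combination of g and `minusDeg g`. These
have the degree of g, two less, so the induction closes. -/
theorem exists_harmonic_representative (ε R : ℝ) (f : CPoly) :
    ∃ h ∈ Harm, ∃ g, f - h = rightK ε R g := by
  induction f using harmonic_induction with
  | hadd f g hf hg =>
    obtain ⟨h, hh, v, hv⟩ := hf
    obtain ⟨h', hh', v', hv'⟩ := hg
    exact ⟨h + h', Harm.add_mem hh hh', v + v', by rw [map_add, ← hv, ← hv']; ring⟩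
  | hharm h hh => exact ⟨h, hh, 0, by simp⟩
  | hquad g d hg ih =>
    obtain ⟨h, hh, v, hv⟩ := ih ((2 * Rhat ε R : ℂ) • g - (ε : ℂ) • (minusDeg g + g))
      (((homogeneousSubmodule _ _ _).smul_mem _ hg).sub ((homogeneousSubmodule _ _ _).smul_mem _
        ((IsHomogeneous.minusDeg hg).add hg)))
    refine ⟨h, hh, (2 : ℂ) • g + v, ?_⟩
    rw [map_add, ← hv, quad_mul_eq ε R g]
    ring

theorem exists_unique_rho (ε R : ℝ) (w : Weyl ε) :
    ∃! ξ : Psi, InKerRho ε R (w - toWeyl ε ξ) := by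
  simp only [inKerRho_iff, map_sub, symbol_toWeyl_Psi]
  obtain ⟨h, hh, g, hg⟩ := exists_harmonic_representative ε R (symbol ε w)
  refine ⟨psiEquiv.symm ⟨h, hh⟩, ⟨g, by rw [comm_psiEquiv_symm, hg]⟩, fun ξ hξ => ?_⟩
  obtain ⟨g', hg'⟩ := hξ
  rw [LinearEquiv.eq_symm_apply]
  apply Subtype.ext
  rw [psiEquiv_coe]
  have h1 : rightK ε R (g - g') = comm ξ - h := by
    rw [map_sub, ← hg, ← hg']
    abel
  have h2 := eq_zero_of_rightK_mem_Harm (h1 ▸ Harm.sub_mem (psiEquiv ξ).2 hh)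
  rw [h2, map_zero] at h1
  exact (sub_eq_zero.1 h1.symm)

theorem rho_spec (ε R : ℝ) (w : Weyl ε) : InKerRho ε R (w - toWeyl ε (rho ε R w)) := by
  have h := (exists_unique_rho ε R w).exists
  rw [rho, dif_pos h]
  exact h.choose_spec

theorem rho_eq {ε R : ℝ} {w : Weyl ε} {ξ : Psi} (h : InKerRho ε R (w - toWeyl ε ξ)) :
    rho ε R w = ξ :=
  (exists_unique_rho ε R w).unique (rho_spec ε R w) h

/-- The harmonic representative of a normally ordered polynomial modulo the left ideal, as an
element of `Ψ`. -/
def reduce (ε R : ℝ) : CPoly →ₗ[ℂ] Psi where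
  toFun f := rho ε R (normalOrder ε f)
  map_add' f g := by
    apply rho_eq
    obtain ⟨v, hv⟩ := rho_spec ε R (normalOrder ε f)
    obtain ⟨w, hw⟩ := rho_spec ε R (normalOrder ε g)
    refine ⟨v + w, ?_⟩
    rw [add_mul, ← hv, ← hw, Submodule.coe_add, map_add, map_add]
    abel
  map_smul' c f := by
    apply rho_eq
    obtain ⟨v, hv⟩ := rho_spec ε R (normalOrder ε f)
    refine ⟨c • v, ?_⟩
    rw [smul_mul_assoc, ← hv, Submodule.coe_smul, map_smul, map_smul, smul_sub, RingHom.id_apply]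

theorem rho_eq_reduce (ε R : ℝ) (w : Weyl ε) : rho ε R w = reduce ε R (symbol ε w) := by
  change _ = rho ε R (normalOrder ε (symbol ε w))
  rw [normalOrder_symbol]

theorem reduce_spec (ε R : ℝ) (f : CPoly) : ∃ g, f - comm (reduce ε R f) = rightK ε R g := by
  obtain ⟨g, hg⟩ := (inKerRho_iff ε R _).1 (rho_spec ε R (normalOrder ε f))
  rw [map_sub, symbol_toWeyl_Psi, symbol_normalOrder] at hg
  exact ⟨g, hg⟩

theorem reduce_eq {ε R : ℝ} {f g : CPoly} {ξ : Psi} (h : f - comm ξ = rightK ε R g) :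
    reduce ε R f = ξ := by
  refine rho_eq ((inKerRho_iff ε R _).2 ⟨g, ?_⟩)
  rw [map_sub, symbol_toWeyl_Psi, symbol_normalOrder, h]

theorem reduce_comm (ε R : ℝ) (ξ : Psi) : reduce ε R (comm ξ) = ξ :=
  reduce_eq (g := 0) (by simp)

theorem reduce_rightK (ε R : ℝ) (f : CPoly) : reduce ε R (rightK ε R f) = 0 :=
  reduce_eq (g := f) (by simp)

/-- With `reduce_comm` this determines `reduce` recursively and exhibits its dependence on ε. -/
theorem reduce_quad_mul (ε R : ℝ) (f : CPoly) : reduce ε R (quad * f) =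
    (2 * Rhat ε R : ℂ) • reduce ε R f - (ε : ℂ) • reduce ε R (minusDeg f + f) := by
  rw [quad_mul_eq ε R f, map_add, reduce_rightK, zero_add, map_sub, map_smul, map_smul]

theorem prodRho_eq (ε R : ℝ) (ξ ζ : Psi) :
    prodRho ε R ξ ζ = reduce ε R (freeRep ε ξ (comm ζ)) := by
  rw [prodRho, rho_eq_reduce, symbol_mul, symbol_toWeyl_Psi, weylRep_toWeyl]

/-! ### Continuity in ε of the product and the form -/

/-- Families in a vector space which are combinations of finitely many fixed vectors with
coefficients that are continuous at `0`. -/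
def contFamily (V : Type*) [AddCommGroup V] [Module ℂ V] : Submodule ℂ (ℝ → V) :=
  Submodule.span ℂ {F | ∃ (c : ℝ → ℂ) (v : V), ContinuousAt c 0 ∧ F = fun ε => c ε • v}

section

variable {V W : Type*} [AddCommGroup V] [Module ℂ V] [AddCommGroup W] [Module ℂ W]

theorem smul_const_mem_contFamily {c : ℝ → ℂ} (hc : ContinuousAt c 0) (v : V) :
    (fun ε => c ε • v) ∈ contFamily V :=
  Submodule.subset_span ⟨c, v, hc, rfl⟩

theorem const_mem_contFamily (v : V) : (fun _ => v) ∈ contFamily V := by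
  simpa using smul_const_mem_contFamily (c := fun _ => 1) continuousAt_const v

theorem smul_mem_contFamily {c : ℝ → ℂ} (hc : ContinuousAt c 0) {F : ℝ → V}
    (hF : F ∈ contFamily V) : (fun ε => c ε • F ε) ∈ contFamily V := by
  induction hF using Submodule.span_induction with
  | mem F h =>
    obtain ⟨d, v, hd, rfl⟩ := h
    simp only [smul_smul]
    exact smul_const_mem_contFamily (hc.mul hd) v
  | zero =>
    simp only [Pi.zero_apply, smul_zero]
    exact (contFamily V).zero_mem
  | add F G _ _ h1 h2 =>
    simp only [Pi.add_apply, smul_add]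
    exact (contFamily V).add_mem h1 h2
  | smul a F _ h =>
    simp only [Pi.smul_apply, smul_comm _ a]
    exact (contFamily V).smul_mem a h

/-- A family of linear maps which is pointwise in `contFamily` preserves `contFamily`. -/
theorem map_mem_contFamily {L : ℝ → V →ₗ[ℂ] W} (hL : ∀ v, (fun ε => L ε v) ∈ contFamily W)
    {F : ℝ → V} (hF : F ∈ contFamily V) : (fun ε => L ε (F ε)) ∈ contFamily W := by
  induction hF using Submodule.span_induction with
  | mem F h =>
    obtain ⟨c, v, hc, rfl⟩ := h
    simp only [map_smul]
    exact smul_mem_contFamily hc (hL v)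
  | zero =>
    simp only [Pi.zero_apply, map_zero]
    exact (contFamily W).zero_mem
  | add F G _ _ h1 h2 =>
    simp only [Pi.add_apply, map_add]
    exact (contFamily W).add_mem h1 h2
  | smul a F _ h =>
    simp only [Pi.smul_apply, map_smul]
    exact (contFamily W).smul_mem a h

end

theorem continuousAt_ofReal : ContinuousAt (fun ε : ℝ => (ε : ℂ)) 0 :=
  Complex.continuous_ofReal.continuousAt

theorem freeRep_mem_contFamily (ξ : FreePoly) (f : CPoly) :
    (fun ε => freeRep ε ξ f) ∈ contFamily CPoly := by
  induction ξ using gen_induction generalizing f with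
  | h1 => simpa using const_mem_contFamily f
  | hgen g ξ ih =>
    have h : ∀ v, (fun ε => letterOp ε g v) ∈ contFamily CPoly := fun v =>
      (contFamily CPoly).add_mem (const_mem_contFamily (X g * v))
        (smul_const_mem_contFamily continuousAt_ofReal (contraction g v))
    simpa only [map_mul, Module.End.mul_apply, freeRep_gen] using map_mem_contFamily h (ih f)
  | hadd ξ ζ h1 h2 =>
    simp only [map_add, LinearMap.add_apply]
    exact (contFamily CPoly).add_mem (h1 f) (h2 f)
  | hsmul c ξ h =>
    simp only [map_smul, LinearMap.smul_apply]
    exact (contFamily CPoly).smul_mem c (h f)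

theorem continuousAt_Rhat (R : ℝ) : ContinuousAt (fun ε : ℝ => (2 * Rhat ε R : ℂ)) 0 := by
  unfold Rhat
  fun_prop

/-- Harmonic polynomials are fixed for all ε, and on multiples of q the recursion multiplies known
families by the continuous functions 2R̂ and ε. -/
theorem reduce_mem_contFamily (R : ℝ) (f : CPoly) :
    (fun ε => reduce ε R f) ∈ contFamily Psi := by
  induction f using harmonic_induction with
  | hadd f g hf hg =>
    simp only [map_add]
    exact (contFamily Psi).add_mem hf hg
  | hharm h hh =>
    have h1 : ∀ ε, reduce ε R h = psiEquiv.symm ⟨h, hh⟩ := fun ε => by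
      rw [← reduce_comm ε R (psiEquiv.symm ⟨h, hh⟩), comm_psiEquiv_symm]
    simp only [h1]
    exact const_mem_contFamily _
  | hquad g d hg ih =>
    -- The recursion involves both g and `minusDeg g + g`, so the inductive hypothesis is needed for
    -- all polynomials of the degree of g.
    simp only [reduce_quad_mul]
    exact (contFamily Psi).sub_mem (smul_mem_contFamily (continuousAt_Rhat R) (ih g hg))
      (smul_mem_contFamily continuousAt_ofReal
        (ih _ ((IsHomogeneous.minusDeg hg).add hg)))

theorem reduce_family_mem (R : ℝ) {F : ℝ → CPoly} (hF : F ∈ contFamily CPoly) :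
    (fun ε => reduce ε R (F ε)) ∈ contFamily Psi :=
  map_mem_contFamily (reduce_mem_contFamily R) hF

/-- Membership in `contFamily` confines the family to a finite-dimensional subspace, which supplies
the bound on the degree. -/
theorem psiTendsto_of_mem_contFamily {F : ℝ → Psi} (hF : F ∈ contFamily Psi) :
    PsiTendsto F (𝓝 0) (F 0) := by
  induction hF using Submodule.span_induction with
  | mem F h =>
    obtain ⟨c, v, hc, rfl⟩ := h
    refine ⟨?_, fun u => ?_⟩
    · obtain ⟨d, hd⟩ := degBound_exists v
      refine ⟨d, Eventually.of_forall fun ε u hu => ?_⟩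
      rw [Submodule.coe_smul, wordCoeff_smul, hd u hu.le, mul_zero]
    · exact hc.tendsto.mul tendsto_const_nhds
  | zero => exact ⟨⟨0, Eventually.of_forall fun _ _ _ => rfl⟩, fun u => tendsto_const_nhds⟩
  | add F G _ _ h1 h2 =>
    obtain ⟨⟨d, hd⟩, h1⟩ := h1
    obtain ⟨⟨e, he⟩, h2⟩ := h2
    refine ⟨⟨max d e, ?_⟩, fun u => (h1 u).add (h2 u)⟩
    filter_upwards [hd, he] with ε h3 h4 u hu
    rw [Pi.add_apply, Submodule.coe_add, wordCoeff_add, h3 u (lt_of_le_of_lt (le_max_left _ _) hu),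
      h4 u (lt_of_le_of_lt (le_max_right _ _) hu), add_zero]
  | smul a F _ h =>
    obtain ⟨⟨d, hd⟩, h⟩ := h
    refine ⟨⟨d, ?_⟩, fun u => (h u).const_mul a⟩
    filter_upwards [hd] with ε h3 u hu
    rw [Pi.smul_apply, Submodule.coe_smul, wordCoeff_smul, h3 u hu, mul_zero]

theorem prodRho_tendsto (R : ℝ) (ξ ζ : Psi) :
    PsiTendsto (fun ε => prodRho ε R ξ ζ) (𝓝 0) (prodRho 0 R ξ ζ) := by
  simp only [prodRho_eq]
  exact psiTendsto_of_mem_contFamily (reduce_family_mem R (freeRep_mem_contFamily ξ (comm ζ)))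

theorem form_eq (ε R : ℝ) (ξ ζ : Psi) : form ε R ξ ζ =
    wordCoeff (reduce ε R (freeRep ε (dagger ξ) (comm ζ)) : Psi) [] := by
  rw [form, rho_eq_reduce, symbol_mul, symbol_toWeyl_Psi, weylRep_toWeyl]

theorem form_tendsto (R : ℝ) (ξ ζ : Psi) :
    Tendsto (fun ε => form ε R ξ ζ) (𝓝 0) (𝓝 (form 0 R ξ ζ)) := by
  simp only [form_eq]
  exact (psiTendsto_of_mem_contFamily
    (reduce_family_mem R (freeRep_mem_contFamily (dagger ξ) (comm ζ)))).2 []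

/-! ### Evaluation on SU(2) and the isomorphism at ε = 0 -/

/-- Evaluation of commutative polynomials at an element of `SU(2)`. -/
def evalPt (R : ℝ) (g : SU2) : CPoly →ₐ[ℂ] ℂ := aeval fun x => genFun R x g

theorem evalPt_eq_eval (R : ℝ) (g : SU2) (f : CPoly) :
    evalPt R g f = eval (fun x => genFun R x g) f := by
  rw [evalPt, aeval_eq_eval]

theorem evalSU2_gen (R : ℝ) (x : Gen) : evalSU2 R (gen x) = genFun R x := by
  simp [evalSU2, gen, word, MonoidAlgebra.lift_single]

theorem evalSU2_apply (R : ℝ) (ξ : FreePoly) (g : SU2) :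
    evalSU2 R ξ g = evalPt R g (comm ξ) := by
  induction ξ using gen_induction with
  | h1 => simp
  | hgen x ξ ih =>
    rw [map_mul, Pi.mul_apply, ih, evalSU2_gen, map_mul, map_mul, comm_gen, evalPt, aeval_X]
  | hadd ξ ζ h1 h2 => rw [map_add, Pi.add_apply, h1, h2, map_add, map_add]
  | hsmul c ξ h => rw [map_smul, Pi.smul_apply, h, map_smul, map_smul]

theorem SU2_star_eq_adjugate (g : SU2) :
    star (g : Matrix (Fin 2) (Fin 2) ℂ) = Matrix.adjugate (g : Matrix (Fin 2) (Fin 2) ℂ) := by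
  obtain ⟨h1, h2⟩ := Matrix.mem_specialUnitaryGroup_iff.1 g.2
  have h3 := Matrix.mem_unitaryGroup_iff'.1 h1
  have h4 := Matrix.mul_adjugate (g : Matrix (Fin 2) (Fin 2) ℂ)
  rw [h2, one_smul] at h4
  exact left_inv_eq_right_inv h3 h4

theorem SU2_conj_00 (g : SU2) : starRingEnd ℂ ((g : Matrix (Fin 2) (Fin 2) ℂ) 0 0) =
    (g : Matrix (Fin 2) (Fin 2) ℂ) 1 1 := by
  have h := congrFun (congrFun (SU2_star_eq_adjugate g) 0) 0
  rw [Matrix.adjugate_fin_two] at h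
  simpa using h

theorem SU2_conj_10 (g : SU2) : starRingEnd ℂ ((g : Matrix (Fin 2) (Fin 2) ℂ) 1 0) =
    -(g : Matrix (Fin 2) (Fin 2) ℂ) 0 1 := by
  have h := congrFun (congrFun (SU2_star_eq_adjugate g) 0) 1
  rw [Matrix.adjugate_fin_two] at h
  simpa using h

theorem SU2_norm (g : SU2) :
    (g : Matrix (Fin 2) (Fin 2) ℂ) 0 0 * starRingEnd ℂ ((g : Matrix (Fin 2) (Fin 2) ℂ) 0 0) +
    (g : Matrix (Fin 2) (Fin 2) ℂ) 1 0 * starRingEnd ℂ ((g : Matrix (Fin 2) (Fin 2) ℂ) 1 0) =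
      1 := by
  obtain ⟨_, h2⟩ := Matrix.mem_specialUnitaryGroup_iff.1 g.2
  rw [Matrix.det_fin_two] at h2
  rw [SU2_conj_00, SU2_conj_10]
  linear_combination h2

theorem ofReal_sqrt_two_mul_sq {R : ℝ} (hR : 0 < R) :
    (Real.sqrt (2 * R) : ℂ) ^ 2 = 2 * R := by
  rw [← Complex.ofReal_pow, Real.sq_sqrt (by positivity)]
  push_cast
  rfl

theorem evalPt_quad {R : ℝ} (hR : 0 < R) (g : SU2) : evalPt R g quad = 2 * R := by
  simp only [evalPt, quad, map_add, map_mul, aeval_X, genFun]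
  linear_combination (Real.sqrt (2 * R) : ℂ) ^ 2 * SU2_norm g + ofReal_sqrt_two_mul_sq hR -
    (Real.sqrt (2 * R) : ℂ) ^ 2 * ((g : Matrix (Fin 2) (Fin 2) ℂ) 1 0 *
    starRingEnd ℂ ((g : Matrix (Fin 2) (Fin 2) ℂ) 1 0)) * Complex.I_sq

theorem Rhat_zero {R : ℝ} (hR : 0 < R) : Rhat 0 R = R := by
  rw [Rhat]
  norm_num
  exact Real.sqrt_sq hR.le

/-- At ε = 0 one has R̂ = R, and `rightK` is multiplication by q/2 - R, which vanishes on SU(2). -/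
theorem evalPt_comm_reduce {R : ℝ} (hR : 0 < R) (g : SU2) (f : CPoly) :
    evalPt R g (comm (reduce 0 R f)) = evalPt R g f := by
  obtain ⟨v, hv⟩ := reduce_spec 0 R f
  have h := congrArg (evalPt R g) hv
  rw [rightK_apply, map_sub, map_sub, map_smul, map_add, map_mul, evalPt_quad hR, Rhat_zero hR,
    map_smul, map_smul, Complex.ofReal_zero, zero_smul, smul_eq_mul, smul_eq_mul] at h
  linear_combination -h

/-- The coordinates on `SU(2)`, without normalization, at `(u, v)`. -/
def sphereCoord (u v : ℂ) : Gen → ℂ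
  | .ap => u
  | .am => starRingEnd ℂ u
  | .bp => -Complex.I * v
  | .bm => Complex.I * starRingEnd ℂ v

theorem genFun_eq (R : ℝ) (x : Gen) (g : SU2) : genFun R x g = (Real.sqrt (2 * R) : ℂ) *
    sphereCoord ((g : Matrix (Fin 2) (Fin 2) ℂ) 0 0) ((g : Matrix (Fin 2) (Fin 2) ℂ) 1 0) x := by
  cases x <;> simp only [genFun, sphereCoord] <;> ring

theorem exists_SU2 (u v : ℂ) (h : u * starRingEnd ℂ u + v * starRingEnd ℂ v = 1) :
    ∃ g : SU2, (g : Matrix (Fin 2) (Fin 2) ℂ) = !![u, -starRingEnd ℂ v; v, starRingEnd ℂ u] := by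
  refine ⟨⟨!![u, -starRingEnd ℂ v; v, starRingEnd ℂ u], ?_⟩, rfl⟩
  rw [Matrix.mem_specialUnitaryGroup_iff, Matrix.mem_unitaryGroup_iff]
  constructor
  · ext k l
    fin_cases k <;> fin_cases l <;>
      simp [Matrix.mul_apply, Fin.sum_univ_two, Matrix.star_apply] <;>
      first | ring1 | linear_combination h
  · rw [Matrix.det_fin_two_of]
    linear_combination h

theorem eval_smul_of_isHomogeneous {f : CPoly} {d : ℕ} (hf : f.IsHomogeneous d) (c : ℂ)
    (x : Gen → ℂ) : eval (fun i => c * x i) f = c ^ d * eval x f := by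
  rw [eval_eq, eval_eq, Finset.mul_sum]
  refine Finset.sum_congr rfl fun m hm => ?_
  have hd : ∑ i ∈ m.support, m i = d := by
    rw [← hf.degree_eq_sum_deg_support hm]
  simp only [mul_pow, Finset.prod_mul_distrib, Finset.prod_pow_eq_pow_sum, hd]
  ring

/-- A polynomial vanishing at all real points, other than the coordinate hyperplanes, of the real
form `a₋ = conj a₊`, `b₋ = conj b₊` is zero. -/
theorem eq_zero_of_eval_sphereCoord {f : CPoly}
    (h : ∀ u v : ℂ, u ≠ 0 → eval (sphereCoord u v) f = 0) : f = 0 := by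
  -- The linear substitution by real and imaginary parts of u and v, and its inverse `ψ`. On real
  -- arguments `φ f` takes the values of f at points `sphereCoord u v`.
  let φ : CPoly →ₐ[ℂ] CPoly := aeval fun
    | .ap => X .ap + C Complex.I * X .am
    | .am => X .ap - C Complex.I * X .am
    | .bp => -C Complex.I * (X .bp + C Complex.I * X .bm)
    | .bm => C Complex.I * (X .bp - C Complex.I * X .bm)
  let ψ : CPoly →ₐ[ℂ] CPoly := aeval fun
    | .ap => C (1 / 2) * (X .ap + X .am)
    | .am => C (-Complex.I / 2) * (X .ap - X .am)
    | .bp => C (Complex.I / 2) * (X .bp - X .bm)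
    | .bm => C (1 / 2) * (X .bp + X .bm)
  have hCI : (C Complex.I : CPoly) * C Complex.I = -1 := by
    rw [← C_mul, Complex.I_mul_I]; simp
  have hC2 : (C (1 / 2) : CPoly) + C (1 / 2) = 1 := by
    rw [← C_add]; norm_num
  have hCI2 : (C (Complex.I / 2) : CPoly) = C Complex.I * C (1 / 2) := by
    rw [← C_mul]; congr 1; ring
  have hCI3 : (C (-Complex.I / 2) : CPoly) = -(C Complex.I * C (1 / 2)) := by
    rw [← C_mul, ← C_neg]; congr 1; ring
  have hinv : ψ.comp φ = AlgHom.id ℂ CPoly := by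
    apply MvPolynomial.algHom_ext
    intro x
    cases x <;>
      simp only [φ, ψ, AlgHom.comp_apply, aeval_X, map_add, map_sub, map_mul, map_neg,
        AlgHom.id_apply, algHom_C, algebraMap_eq, hCI2, hCI3]
    · linear_combination X .ap * hC2 + (C (1 / 2) * X .am - C (1 / 2) * X .ap) * hCI
    · linear_combination X .am * hC2 + (C (1 / 2) * X .ap - C (1 / 2) * X .am) * hCI
    · linear_combination X .bp * hC2 - 2 * C (1 / 2) * X .bp * hCI
    · linear_combination X .bm * hC2 - 2 * C (1 / 2) * X .bm * hCI
  have hφ : φ f = 0 := by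
    -- Only nonzero real arguments are used: then u has nonzero real part, as required by `h`, and
    -- infinitely many values remain for each variable.
    refine funext_set (fun _ => {z : ℂ | ∃ t : ℝ, t ≠ 0 ∧ (t : ℂ) = z}) (fun _ => ?_)
      fun x hx => ?_
    · refine Set.infinite_of_injective_forall_mem (f := fun n : ℕ => ((n + 1 : ℝ) : ℂ))
        (fun a b hab => by simpa using hab) fun n => ⟨n + 1, by positivity, rfl⟩
    · choose t ht ht2 using fun i => hx i (Set.mem_univ i)
      obtain rfl : x = fun i => (t i : ℂ) := funext fun i => (ht2 i).symm
      rw [map_zero, ← h (t .ap + Complex.I * t .am) (t .bp + Complex.I * t .bm) (fun h0 => ht .ap (by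
        simpa using congrArg Complex.re h0))]
      change eval _ (aeval _ f) = _
      rw [← coe_aeval_eq_eval, ← coe_aeval_eq_eval]
      change ((aeval fun i => (t i : ℂ)).comp φ) f = aeval _ f
      congr 1
      apply MvPolynomial.algHom_ext
      intro x
      cases x <;> simp [φ, sphereCoord, sub_eq_add_neg]
  have := congrArg ψ hφ
  rw [map_zero] at this
  rwa [show ψ (φ f) = f from DFunLike.congr_fun hinv f] at this

theorem sphereCoord_mul (r : ℝ) (u v : ℂ) :
    sphereCoord (r * u) (r * v) = fun i => (r : ℂ) * sphereCoord u v i := by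
  funext x
  cases x <;> simp only [sphereCoord, map_mul, Complex.conj_ofReal] <;> ring

/-- By homogeneity, vanishing on the sphere spreads to all its real multiples, hence to every point
(u, v) with u ≠ 0. -/
theorem eq_zero_of_isHomogeneous_of_evalPt {R : ℝ} (hR : 0 < R) {f : CPoly} {d : ℕ}
    (hf : f.IsHomogeneous d) (h : ∀ g, evalPt R g f = 0) : f = 0 := by
  refine eq_zero_of_eval_sphereCoord fun u v hu => ?_
  set r : ℝ := Real.sqrt (Complex.normSq u + Complex.normSq v) with hr
  have hpos : 0 < Complex.normSq u + Complex.normSq v :=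
    add_pos_of_pos_of_nonneg (Complex.normSq_pos.2 hu) (Complex.normSq_nonneg v)
  have hr0 : (r : ℂ) ≠ 0 := by exact_mod_cast (Real.sqrt_pos.2 hpos).ne'
  have hr2 : (r : ℂ) ^ 2 = u * starRingEnd ℂ u + v * starRingEnd ℂ v := by
    rw [← Complex.ofReal_pow, Real.sq_sqrt hpos.le, Complex.mul_conj, Complex.mul_conj]
    push_cast
    rfl
  obtain ⟨g, hg⟩ := exists_SU2 (u / r) (v / r) (by
    rw [map_div₀, map_div₀, Complex.conj_ofReal]
    field_simp
    rw [hr2])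
  have hu' : sphereCoord u v = fun x => (r / Real.sqrt (2 * R) : ℂ) * genFun R x g := by
    have hs : (Real.sqrt (2 * R) : ℂ) ≠ 0 := by
      exact_mod_cast (Real.sqrt_pos.2 (mul_pos two_pos hR)).ne'
    have h1 := sphereCoord_mul r (u / r) (v / r)
    rw [mul_div_cancel₀ _ hr0, mul_div_cancel₀ _ hr0] at h1
    rw [h1]
    funext x
    rw [genFun_eq, hg, ← mul_assoc, div_mul_cancel₀ _ hs]
    rfl
  rw [hu', eval_smul_of_isHomogeneous hf, ← evalPt_eq_eval, h g, mul_zero]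

/-- Since -g lies in SU(2) with g, the components of even and of odd degree vanish on SU(2)
separately. Those with the parity of the top degree D are brought to degree D by powers of q/(2R),
which equals 1 on SU(2). Their sum is homogeneous and vanishes on SU(2), so it is zero. The
component of degree D is then divisible by q, and being harmonic it vanishes. -/
theorem evalPt_injOn_Harm {R : ℝ} (hR : 0 < R) {f : CPoly} (hf : f ∈ Harm)
    (h : ∀ g, evalPt R g f = 0) : f = 0 := by
  by_contra hf0
  set D := f.totalDegree with hD
  have hneg : ∀ g : SU2, ∃ g' : SU2, ∀ x, genFun R x g' = (-1) * genFun R x g := by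
    intro g
    obtain ⟨g', hg'⟩ := exists_SU2 (-(g : Matrix (Fin 2) (Fin 2) ℂ) 0 0)
      (-(g : Matrix (Fin 2) (Fin 2) ℂ) 1 0) (by simpa using SU2_norm g)
    refine ⟨g', fun x => ?_⟩
    cases x <;> simp [genFun, hg']
  have hsum : ∀ g, ∑ d ∈ Finset.range (D + 1), evalPt R g (homogeneousComponent d f) = 0 := by
    intro g
    rw [← map_sum, sum_homogeneousComponent, h g]
  have hsum' : ∀ g, ∑ d ∈ Finset.range (D + 1),
      (-1 : ℂ) ^ d * evalPt R g (homogeneousComponent d f) = 0 := by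
    intro g
    obtain ⟨g', hg'⟩ := hneg g
    rw [← hsum g']
    refine Finset.sum_congr rfl fun d _ => ?_
    simp only [evalPt_eq_eval, hg']
    exact (eval_smul_of_isHomogeneous (homogeneousComponent_isHomogeneous d f) _ _).symm
  -- The first factor is 0 for degrees of the wrong parity and 2 for the others; this 2 is divided
  -- out when `G` is extracted below.
  set c : ℕ → ℂ := fun d => (1 + (-1) ^ (D + d)) * (2 * R : ℂ)⁻¹ ^ ((D - d) / 2) with hc
  set F : CPoly := ∑ d ∈ Finset.range (D + 1),
    c d • (quad ^ ((D - d) / 2) * homogeneousComponent d f) with hF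
  have hR0 : (2 * R : ℂ) ≠ 0 := by exact_mod_cast (mul_pos two_pos hR).ne'
  have hcodd : ∀ d, Odd (D + d) → c d = 0 := by
    intro d hd
    simp [hc, hd.neg_one_pow]
  have hFhom : F.IsHomogeneous D := by
    refine IsHomogeneous.sum _ _ _ fun d hd => ?_
    have hd' : d ≤ D := Nat.lt_succ_iff.1 (Finset.mem_range.1 hd)
    rcases Nat.even_or_odd (D + d) with he | ho
    · have h1 := (isHomogeneous_quad.pow ((D - d) / 2)).mul
        (homogeneousComponent_isHomogeneous d f)
      have h2 : 2 * ((D - d) / 2) + d = D := by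
        obtain ⟨k, hk⟩ := he
        omega
      rw [h2] at h1
      exact (homogeneousSubmodule _ _ _).smul_mem _ h1
    · rw [hcodd d ho, zero_smul]
      exact isHomogeneous_zero _ _ _
  have hF0 : F = 0 := by
    refine eq_zero_of_isHomogeneous_of_evalPt hR hFhom fun g => ?_
    have h1 : evalPt R g F = ∑ d ∈ Finset.range (D + 1), (evalPt R g (homogeneousComponent d f) +
        (-1) ^ D * ((-1 : ℂ) ^ d * evalPt R g (homogeneousComponent d f))) := by
      rw [hF, map_sum]
      refine Finset.sum_congr rfl fun d _ => ?_
      rw [map_smul, map_mul, map_pow, evalPt_quad hR, smul_eq_mul]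
      simp only [hc]
      have : (2 * R : ℂ)⁻¹ ^ ((D - d) / 2) * (2 * R : ℂ) ^ ((D - d) / 2) = 1 := by
        rw [← mul_pow, inv_mul_cancel₀ hR0, one_pow]
      rw [pow_add]
      linear_combination (1 + (-1) ^ D * (-1) ^ d) * evalPt R g (homogeneousComponent d f) * this
    rw [h1, Finset.sum_add_distrib, ← Finset.mul_sum, hsum, hsum', mul_zero, add_zero]
  obtain ⟨G, hG⟩ : ∃ G, homogeneousComponent D f = quad * G := by
    rw [hF, Finset.sum_range_succ] at hF0
    have hcD : c D = 2 := by
      have : Even (D + D) := ⟨D, rfl⟩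
      simp [hc, this.neg_one_pow]
      norm_num
    have hdvd : quad ∣ ∑ d ∈ Finset.range D,
        c d • (quad ^ ((D - d) / 2) * homogeneousComponent d f) := by
      refine Finset.dvd_sum fun d hd => ?_
      rcases Nat.even_or_odd (D + d) with he | ho
      · have h2 : (D - d) / 2 ≠ 0 := by
          obtain ⟨k, hk⟩ := he
          have := Finset.mem_range.1 hd
          omega
        rw [smul_eq_C_mul]
        exact ((dvd_pow_self _ h2).mul_right _).mul_left _
      · rw [hcodd d ho, zero_smul]
        exact dvd_zero _
    obtain ⟨G, hG⟩ := hdvd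
    refine ⟨(-(1 / 2) : ℂ) • G, ?_⟩
    rw [hG, hcD, Nat.sub_self, Nat.zero_div, pow_zero, one_mul] at hF0
    rw [mul_smul_comm, eq_neg_of_add_eq_zero_left hF0, smul_neg, smul_smul]
    norm_num
  have hG0 : G = 0 := by
    refine eq_zero_of_quad_mul_add_mem_Harm (f := G) (g := 0) ?_ (by simp)
    rw [add_zero, ← hG]
    exact homogeneousComponent_mem_Harm hf D
  rw [hG0, mul_zero] at hG
  exact homogeneousComponent_totalDegree_ne_zero hf0 hG

theorem evalSU2_mem_polyFun (R : ℝ) (ξ : FreePoly) : evalSU2 R ξ ∈ polyFun := by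
  have hsub : ∀ k l, (fun g : SU2 => (g : Matrix (Fin 2) (Fin 2) ℂ) k l) ∈ polyFun := fun k l =>
    Algebra.subset_adjoin (Or.inl ⟨k, l, rfl⟩)
  have hsub' : ∀ k l, (fun g : SU2 => starRingEnd ℂ ((g : Matrix (Fin 2) (Fin 2) ℂ) k l)) ∈
    polyFun := fun k l => Algebra.subset_adjoin (Or.inr ⟨k, l, rfl⟩)
  induction ξ using gen_induction with
  | h1 => rw [map_one]; exact polyFun.one_mem
  | hgen x ξ ih =>
    rw [map_mul]
    refine polyFun.mul_mem ?_ ih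
    rw [evalSU2_gen]
    cases x
    · exact polyFun.smul_mem (hsub 0 0) (Real.sqrt (2 * R) : ℂ)
    · exact polyFun.smul_mem (hsub' 0 0) (Real.sqrt (2 * R) : ℂ)
    · exact polyFun.smul_mem (hsub 1 0) (-Complex.I * (Real.sqrt (2 * R) : ℂ))
    · exact polyFun.smul_mem (hsub' 1 0) (Complex.I * (Real.sqrt (2 * R) : ℂ))
  | hadd ξ ζ h1 h2 => rw [map_add]; exact polyFun.add_mem h1 h2
  | hsmul c ξ h => rw [map_smul]; exact polyFun.smul_mem h c

/-- The second column of a matrix in SU(2) consists, up to sign, of conjugates of entries of the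
first, so the four generators suffice. -/
theorem exists_evalSU2_eq {R : ℝ} (hR : 0 < R) {f : SU2 → ℂ} (hf : f ∈ polyFun) :
    ∃ ξ, evalSU2 R ξ = f := by
  have hs : (Real.sqrt (2 * R) : ℂ) ≠ 0 := by
    exact_mod_cast (Real.sqrt_pos.2 (mul_pos two_pos hR)).ne'
  have hle : polyFun ≤ (evalSU2 R).range := by
    have h00 : (fun g : SU2 => (g : Matrix (Fin 2) (Fin 2) ℂ) 0 0) ∈ (evalSU2 R).range :=
      ⟨(Real.sqrt (2 * R) : ℂ)⁻¹ • gen .ap, by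
        simp only [AlgHom.toRingHom_eq_coe, RingHom.coe_coe, map_smul, evalSU2_gen]
        funext g
        simp only [Pi.smul_apply, genFun, smul_eq_mul]
        field_simp⟩
    have h10 : (fun g : SU2 => (g : Matrix (Fin 2) (Fin 2) ℂ) 1 0) ∈ (evalSU2 R).range :=
      ⟨(Complex.I * (Real.sqrt (2 * R) : ℂ)⁻¹) • gen .bp, by
        simp only [AlgHom.toRingHom_eq_coe, RingHom.coe_coe, map_smul, evalSU2_gen]
        funext g
        simp only [Pi.smul_apply, genFun, smul_eq_mul]
        field_simp
        linear_combination -(g : Matrix (Fin 2) (Fin 2) ℂ) 1 0 * Complex.I_sq⟩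
    have h00' : (fun g : SU2 => starRingEnd ℂ ((g : Matrix (Fin 2) (Fin 2) ℂ) 0 0)) ∈
        (evalSU2 R).range :=
      ⟨(Real.sqrt (2 * R) : ℂ)⁻¹ • gen .am, by
        simp only [AlgHom.toRingHom_eq_coe, RingHom.coe_coe, map_smul, evalSU2_gen]
        funext g
        simp only [Pi.smul_apply, genFun, smul_eq_mul]
        field_simp⟩
    have h10' : (fun g : SU2 => starRingEnd ℂ ((g : Matrix (Fin 2) (Fin 2) ℂ) 1 0)) ∈
        (evalSU2 R).range :=
      ⟨(-Complex.I * (Real.sqrt (2 * R) : ℂ)⁻¹) • gen .bm, by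
        simp only [AlgHom.toRingHom_eq_coe, RingHom.coe_coe, map_smul, evalSU2_gen]
        funext g
        simp only [Pi.smul_apply, genFun, smul_eq_mul]
        field_simp
        linear_combination -starRingEnd ℂ ((g : Matrix (Fin 2) (Fin 2) ℂ) 1 0) * Complex.I_sq⟩
    refine Algebra.adjoin_le ?_
    rintro _ (⟨k, l, rfl⟩ | ⟨k, l, rfl⟩)
    · have h01 : (fun g : SU2 => (g : Matrix (Fin 2) (Fin 2) ℂ) 0 1) =
          -fun g : SU2 => starRingEnd ℂ ((g : Matrix (Fin 2) (Fin 2) ℂ) 1 0) :=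
        funext fun g => by rw [Pi.neg_apply, SU2_conj_10, neg_neg]
      have h11 : (fun g : SU2 => (g : Matrix (Fin 2) (Fin 2) ℂ) 1 1) =
          fun g : SU2 => starRingEnd ℂ ((g : Matrix (Fin 2) (Fin 2) ℂ) 0 0) :=
        funext fun g => (SU2_conj_00 g).symm
      fin_cases k <;> fin_cases l
      exacts [h00, h01 ▸ (evalSU2 R).range.neg_mem h10', h10, h11 ▸ h00']
    · have h01 : (fun g : SU2 => starRingEnd ℂ ((g : Matrix (Fin 2) (Fin 2) ℂ) 0 1)) =
          -fun g : SU2 => (g : Matrix (Fin 2) (Fin 2) ℂ) 1 0 :=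
        funext fun g => by
          rw [Pi.neg_apply, ← neg_neg ((g : Matrix (Fin 2) (Fin 2) ℂ) 0 1), ← SU2_conj_10,
            map_neg, Complex.conj_conj]
      have h11 : (fun g : SU2 => starRingEnd ℂ ((g : Matrix (Fin 2) (Fin 2) ℂ) 1 1)) =
          fun g : SU2 => (g : Matrix (Fin 2) (Fin 2) ℂ) 0 0 :=
        funext fun g => by rw [← SU2_conj_00, Complex.conj_conj]
      fin_cases k <;> fin_cases l
      exacts [h00', h01 ▸ (evalSU2 R).range.neg_mem h10, h10', h11 ▸ h00]
  exact hle hf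

/-- `Ψ` is isomorphic to the space of polynomial functions on `SU(2)`. -/
theorem exists_polyFun_equiv {R : ℝ} (hR : 0 < R) :
    ∃ e : Psi ≃ₗ[ℂ] polyFun, (∀ ξ : Psi, (e ξ : SU2 → ℂ) = evalSU2 R ξ) ∧
      ∀ ξ ζ : Psi, e (prodRho 0 R ξ ζ) = e ξ * e ζ := by
  let L : Psi →ₗ[ℂ] polyFun :=
    (((evalSU2 R).toLinearMap).comp Psi.subtype).codRestrict polyFun.toSubmodule fun ξ =>
      evalSU2_mem_polyFun R ξ
  have hL : ∀ ξ, (L ξ : SU2 → ℂ) = evalSU2 R ξ := fun _ => rfl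
  have hred : ∀ f : CPoly, ∀ g, evalSU2 R (reduce 0 R f) g = evalPt R g f := fun f g => by
    rw [evalSU2_apply, evalPt_comm_reduce hR]
  have hbij : Function.Bijective L := by
    constructor
    · rw [← LinearMap.ker_eq_bot, LinearMap.ker_eq_bot']
      intro ξ hξ
      have h0 : evalSU2 R ξ = 0 := by rw [← hL, hξ]; rfl
      have h1 : comm ξ = 0 := evalPt_injOn_Harm hR (psiEquiv ξ).2 fun g => by
        rw [← evalSU2_apply, h0, Pi.zero_apply]
      exact (LinearEquiv.map_eq_zero_iff psiEquiv).1 (Subtype.ext h1)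
    · rintro ⟨f, hf⟩
      obtain ⟨ξ, rfl⟩ := exists_evalSU2_eq hR hf
      refine ⟨reduce 0 R (comm ξ), Subtype.ext (funext fun g => ?_)⟩
      change evalSU2 R (reduce 0 R (comm ξ) : Psi) g = evalSU2 R ξ g
      rw [hred, evalSU2_apply]
  refine ⟨LinearEquiv.ofBijective L hbij, hL, fun ξ ζ => Subtype.ext (funext fun g => ?_)⟩
  change evalSU2 R (prodRho 0 R ξ ζ : Psi) g = evalSU2 R ξ g * evalSU2 R ζ g
  rw [prodRho_eq, hred, freeRep_zero, map_mul, evalSU2_apply, evalSU2_apply]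

/-! ### Euler angles -/

theorem eulerFun_gen_ap (R α β γ : ℝ) : eulerFun R (gen .ap) α β γ =
    (Real.sqrt (2 * R) : ℂ) * (Real.cos (β / 2) : ℂ) *
      Complex.exp (-(Complex.I / 2) * (α + γ)) := by
  rw [eulerFun, evalSU2_gen, mul_assoc]
  rfl

theorem conj_exp_half (z : ℝ) : starRingEnd ℂ (Complex.exp (Complex.I / 2 * z)) =
    Complex.exp (-(Complex.I / 2) * z) := by
  rw [← Complex.exp_conj]
  congr 1
  simp [Complex.conj_ofNat]
  ring

theorem conj_exp_neg_half (z : ℝ) : starRingEnd ℂ (Complex.exp (-(Complex.I / 2) * z)) =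
    Complex.exp (Complex.I / 2 * z) := by
  rw [← conj_exp_half, Complex.conj_conj]

theorem eulerFun_gen_am (R α β γ : ℝ) : eulerFun R (gen .am) α β γ =
    (Real.sqrt (2 * R) : ℂ) * (Real.cos (β / 2) : ℂ) *
      Complex.exp ((Complex.I / 2) * (α + γ)) := by
  rw [eulerFun, evalSU2_gen, mul_assoc]
  change _ * starRingEnd ℂ ((Real.cos (β / 2) : ℂ) *
    Complex.exp (-(Complex.I / 2) * (α + γ))) = _
  rw [map_mul, Complex.conj_ofReal, ← Complex.ofReal_add, conj_exp_neg_half]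

theorem eulerFun_gen_bp (R α β γ : ℝ) : eulerFun R (gen .bp) α β γ =
    -Complex.I * (Real.sqrt (2 * R) : ℂ) * (Real.sin (β / 2) : ℂ) *
      Complex.exp ((Complex.I / 2) * (α - γ)) := by
  rw [eulerFun, evalSU2_gen, mul_assoc]
  rfl

theorem eulerFun_gen_bm (R α β γ : ℝ) : eulerFun R (gen .bm) α β γ =
    Complex.I * (Real.sqrt (2 * R) : ℂ) * (Real.sin (β / 2) : ℂ) *
      Complex.exp (-(Complex.I / 2) * (α - γ)) := by
  rw [eulerFun, evalSU2_gen, mul_assoc]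
  change _ * starRingEnd ℂ ((Real.sin (β / 2) : ℂ) *
    Complex.exp ((Complex.I / 2) * (α - γ))) = _
  rw [map_mul, Complex.conj_ofReal, ← Complex.ofReal_sub, conj_exp_half]

theorem SU2_ext {g h : SU2}
    (h0 : (g : Matrix (Fin 2) (Fin 2) ℂ) 0 0 = (h : Matrix (Fin 2) (Fin 2) ℂ) 0 0)
    (h1 : (g : Matrix (Fin 2) (Fin 2) ℂ) 1 0 = (h : Matrix (Fin 2) (Fin 2) ℂ) 1 0) : g = h := by
  apply Subtype.ext
  ext k l
  fin_cases k <;> fin_cases l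
  · exact h0
  · have := SU2_conj_10 g
    rw [h1, SU2_conj_10 h] at this
    exact (neg_injective this).symm
  · exact h1
  · have := SU2_conj_00 g
    rw [h0, SU2_conj_00 h] at this
    exact this.symm

theorem exists_euler (g : SU2) : ∃ α ∈ Set.Ico 0 (2 * Real.pi), ∃ β ∈ Set.Icc 0 Real.pi,
    ∃ γ ∈ Set.Ico 0 (4 * Real.pi), euler α β γ = g := by
  set u := (g : Matrix (Fin 2) (Fin 2) ℂ) 0 0 with hu
  set v := (g : Matrix (Fin 2) (Fin 2) ℂ) 1 0 with hv
  have hn : ‖u‖ ^ 2 + ‖v‖ ^ 2 = 1 := by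
    have := SU2_norm g
    rw [Complex.mul_conj', Complex.mul_conj'] at this
    exact_mod_cast this
  have hu1 : ‖u‖ ≤ 1 := by nlinarith [norm_nonneg u, norm_nonneg v]
  have h2 : 0 < 2 * Real.pi := Real.two_pi_pos
  have h4 : 0 < 4 * Real.pi := by positivity
  -- The phases require -(α + γ)/2 = arg u and (α - γ)/2 = arg v modulo 2π; β = 2 arccos ‖u‖ takes
  -- care of the absolute values.
  set α0 : ℝ := -u.arg + v.arg with hα0
  set k := toIcoDiv h2 0 α0 with hk
  -- Reducing α by 2πk changes (α ± γ)/2 by πk. Shifting γ by the same amount restores α - γ and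
  -- turns the change of (α + γ)/2 into 2πk.
  set γ0 : ℝ := -u.arg - v.arg - k * (2 * Real.pi) with hγ0
  set l := toIcoDiv h4 0 γ0 with hl
  have hα : toIcoMod h2 0 α0 = α0 - k * (2 * Real.pi) := by
    rw [toIcoMod, zsmul_eq_mul]
  have hγ : toIcoMod h4 0 γ0 = γ0 - l * (4 * Real.pi) := by
    rw [toIcoMod, zsmul_eq_mul]
  have hcos : Real.cos (2 * Real.arccos ‖u‖ / 2) = ‖u‖ := by
    rw [mul_div_cancel_left₀ _ two_ne_zero, Real.cos_arccos (by linarith [norm_nonneg u]) hu1]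
  have hsin : Real.sin (2 * Real.arccos ‖u‖ / 2) = ‖v‖ := by
    rw [mul_div_cancel_left₀ _ two_ne_zero, Real.sin_arccos,
      show 1 - ‖u‖ ^ 2 = ‖v‖ ^ 2 by linarith, Real.sqrt_sq (norm_nonneg v)]
  refine ⟨toIcoMod h2 0 α0, by simpa using toIcoMod_mem_Ico h2 0 α0, 2 * Real.arccos ‖u‖,
    ⟨by linarith [Real.arccos_nonneg ‖u‖], ?_⟩, toIcoMod h4 0 γ0,
    by simpa using toIcoMod_mem_Ico h4 0 γ0, ?_⟩
  · have := Real.arccos_le_pi_div_two.2 (norm_nonneg u)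
    linarith
  · apply SU2_ext
    · change (Real.cos (2 * Real.arccos ‖u‖ / 2) : ℂ) * Complex.exp (-(Complex.I / 2) *
        ((toIcoMod h2 0 α0 : ℝ) + (toIcoMod h4 0 γ0 : ℝ))) = u
      rw [hcos, hα, hγ]
      have he : -(Complex.I / 2) * (((α0 - k * (2 * Real.pi) : ℝ) : ℂ) +
          ((γ0 - l * (4 * Real.pi) : ℝ) : ℂ)) =
          u.arg * Complex.I + ((k + l : ℤ) : ℂ) * (2 * Real.pi * Complex.I) := by
        rw [hα0, hγ0]
        push_cast
        ring
      rw [he, Complex.exp_add, Complex.exp_int_mul_two_pi_mul_I, mul_one,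
        Complex.norm_mul_exp_arg_mul_I]
    · change (Real.sin (2 * Real.arccos ‖u‖ / 2) : ℂ) * Complex.exp ((Complex.I / 2) *
        ((toIcoMod h2 0 α0 : ℝ) - (toIcoMod h4 0 γ0 : ℝ))) = v
      rw [hsin, hα, hγ]
      have he : (Complex.I / 2) * (((α0 - k * (2 * Real.pi) : ℝ) : ℂ) -
          ((γ0 - l * (4 * Real.pi) : ℝ) : ℂ)) =
          v.arg * Complex.I + (l : ℂ) * (2 * Real.pi * Complex.I) := by
        rw [hα0, hγ0]
        push_cast
        ring
      rw [he, Complex.exp_add, Complex.exp_int_mul_two_pi_mul_I, mul_one,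
        Complex.norm_mul_exp_arg_mul_I]

theorem eulerFun_mul (R : ℝ) (ξ ζ : FreePoly) (α β γ : ℝ) :
    eulerFun R (ξ * ζ) α β γ = eulerFun R ξ α β γ * eulerFun R ζ α β γ := by
  simp [eulerFun]

theorem eulerFun_add (R : ℝ) (ξ ζ : FreePoly) (α β γ : ℝ) :
    eulerFun R (ξ + ζ) α β γ = eulerFun R ξ α β γ + eulerFun R ζ α β γ := by
  simp [eulerFun]

theorem eulerFun_smul (R : ℝ) (c : ℂ) (ξ : FreePoly) (α β γ : ℝ) :
    eulerFun R (c • ξ) α β γ = c * eulerFun R ξ α β γ := by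
  simp [eulerFun]

theorem eulerFun_one (R α β γ : ℝ) : eulerFun R 1 α β γ = 1 := by
  simp [eulerFun]

theorem eulerFun_eq_evalPt (R : ℝ) (ξ : FreePoly) (α β γ : ℝ) :
    eulerFun R ξ α β γ = evalPt R (euler α β γ) (comm ξ) := evalSU2_apply R ξ _

/-! ### The adjoint -/

theorem dagger_add (ξ ζ : FreePoly) : dagger (ξ + ζ) = dagger ξ + dagger ζ := by
  rw [dagger, MonoidAlgebra.coeff_add]
  exact Finsupp.sum_add_index' (by simp) (by intros; rw [map_add, add_smul])

theorem dagger_smul (c : ℂ) (ξ : FreePoly) : dagger (c • ξ) = starRingEnd ℂ c • dagger ξ := by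
  rw [dagger, MonoidAlgebra.coeff_smul, Finsupp.sum_smul_index (by simp), dagger,
    Finsupp.smul_sum]
  simp only [map_mul, mul_smul]

theorem dagger_word (l : List Gen) : dagger (word l) = word (l.reverse.map Gen.conj) := by
  rw [dagger, word, MonoidAlgebra.coeff_single, Finsupp.sum_single_index (by simp)]
  simp

theorem genFun_conj (R : ℝ) (x : Gen) (g : SU2) :
    genFun R x.conj g = starRingEnd ℂ (genFun R x g) := by
  cases x <;> simp [Gen.conj, genFun, Complex.conj_ofReal]

theorem evalSU2_dagger (R : ℝ) (ξ : FreePoly) (g : SU2) :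
    evalSU2 R (dagger ξ) g = starRingEnd ℂ (evalSU2 R ξ g) := by
  induction ξ using word_induction with
  | h l =>
    rw [dagger_word]
    induction l with
    | nil => simp [word_nil]
    | cons x l ih =>
      rw [List.reverse_cons, List.map_append, word_append, map_mul, Pi.mul_apply, ih, word_cons,
        map_mul, Pi.mul_apply, map_mul, evalSU2_gen, ← genFun_conj, ← evalSU2_gen, mul_comm]
      rfl
  | hadd ξ ζ h1 h2 => rw [dagger_add, map_add, Pi.add_apply, h1, h2, map_add, Pi.add_apply, map_add]
  | hsmul c ξ h =>
    rw [dagger_smul, map_smul, Pi.smul_apply, h, map_smul, Pi.smul_apply, smul_eq_mul, smul_eq_mul,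
      map_mul]

/-! ### Parity -/

/-- The automorphism changing the sign of all letters. -/
def signFlip : FreePoly →ₗ[ℂ] FreePoly := wordLift fun l => (-1 : ℂ) ^ l.length • word l

theorem wordCoeff_signFlip (ξ : FreePoly) (l : List Gen) :
    wordCoeff (signFlip ξ) l = (-1) ^ l.length * wordCoeff ξ l := by
  induction ξ using word_induction with
  | h u =>
    rw [signFlip, wordLift_word, wordCoeff_smul, wordCoeff_word]
    split_ifs with h <;> simp [h]
  | hadd a b ha hb => rw [map_add, wordCoeff_add, ha, hb, wordCoeff_add]; ring
  | hsmul c a ha => rw [map_smul, wordCoeff_smul, ha, wordCoeff_smul]; ring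

theorem signFlip_of_hasParity {ξ : FreePoly} {k : ℕ} (h : HasParity ξ k) :
    signFlip ξ = (-1 : ℂ) ^ k • ξ := by
  apply freePoly_ext
  intro l
  rw [wordCoeff_signFlip, wordCoeff_smul]
  by_cases h0 : wordCoeff ξ l = 0
  · rw [h0, mul_zero, mul_zero]
  · have := h l h0
    rw [neg_one_pow_eq_pow_mod_two, this, ← neg_one_pow_eq_pow_mod_two]

/-- The shift γ ↦ γ + 2π replaces the group element by its negative. -/
theorem eulerFun_gen_add_two_pi (R : ℝ) (x : Gen) (α β γ : ℝ) :
    eulerFun R (gen x) α β (γ + 2 * Real.pi) = -eulerFun R (gen x) α β γ := by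
  have e1 : ∀ z : ℂ, Complex.exp (z + Real.pi * Complex.I) = -Complex.exp z := fun z => by
    rw [Complex.exp_add, Complex.exp_pi_mul_I]; ring
  have e2 : ∀ z : ℂ, Complex.exp (z - Real.pi * Complex.I) = -Complex.exp z := fun z => by
    rw [Complex.exp_sub, Complex.exp_pi_mul_I]; ring
  have h1 : -(Complex.I / 2) * ((α : ℂ) + ((γ + 2 * Real.pi : ℝ) : ℂ)) =
      -(Complex.I / 2) * (α + γ) - Real.pi * Complex.I := by push_cast; ring
  have h2 : (Complex.I / 2) * ((α : ℂ) + ((γ + 2 * Real.pi : ℝ) : ℂ)) =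
      (Complex.I / 2) * (α + γ) + Real.pi * Complex.I := by push_cast; ring
  have h3 : -(Complex.I / 2) * ((α : ℂ) - ((γ + 2 * Real.pi : ℝ) : ℂ)) =
      -(Complex.I / 2) * (α - γ) + Real.pi * Complex.I := by push_cast; ring
  have h4 : (Complex.I / 2) * ((α : ℂ) - ((γ + 2 * Real.pi : ℝ) : ℂ)) =
      (Complex.I / 2) * (α - γ) - Real.pi * Complex.I := by push_cast; ring
  cases x
  · rw [eulerFun_gen_ap, eulerFun_gen_ap, h1, e2]; ring
  · rw [eulerFun_gen_am, eulerFun_gen_am, h2, e1]; ring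
  · rw [eulerFun_gen_bp, eulerFun_gen_bp, h4, e2]; ring
  · rw [eulerFun_gen_bm, eulerFun_gen_bm, h3, e1]; ring

theorem eulerFun_add_two_pi (R : ℝ) (ξ : FreePoly) (α β γ : ℝ) :
    eulerFun R ξ α β (γ + 2 * Real.pi) = eulerFun R (signFlip ξ) α β γ := by
  induction ξ using word_induction with
  | h l =>
    rw [signFlip, wordLift_word, eulerFun_smul]
    induction l with
    | nil => simp [word_nil, eulerFun_one]
    | cons x l ih =>
      rw [word_cons, eulerFun_mul, eulerFun_gen_add_two_pi, ih, eulerFun_mul, List.length_cons,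
        pow_succ]
      ring
  | hadd ξ ζ h1 h2 => rw [eulerFun_add, h1, h2, map_add, eulerFun_add]
  | hsmul c ξ h => rw [eulerFun_smul, h, map_smul, eulerFun_smul]

/-! ### Integration -/

theorem continuous_eulerFun (R : ℝ) (ξ : FreePoly) :
    Continuous fun p : ℝ × ℝ × ℝ => eulerFun R ξ p.1 p.2.1 p.2.2 := by
  induction ξ using gen_induction with
  | h1 => simp only [eulerFun_one]; exact continuous_const
  | hgen x ξ ih =>
    simp only [eulerFun_mul]
    refine Continuous.mul ?_ ih
    cases x
    · simp only [eulerFun_gen_ap]; fun_prop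
    · simp only [eulerFun_gen_am]; fun_prop
    · simp only [eulerFun_gen_bp]; fun_prop
    · simp only [eulerFun_gen_bm]; fun_prop
  | hadd ξ ζ h1 h2 => simp only [eulerFun_add]; exact h1.add h2
  | hsmul c ξ h => simp only [eulerFun_smul]; exact h.const_mul c

/-- `∫₀^π sin β cos(β/2)^{2a} sin(β/2)^{2b} dβ`. -/
def betaInt (a b : ℕ) : ℝ :=
  ∫ β in (0 : ℝ)..Real.pi, Real.sin β * Real.cos (β / 2) ^ (2 * a) * Real.sin (β / 2) ^ (2 * b)

theorem intervalIntegrable_betaInt (a b : ℕ) : IntervalIntegrable (fun β : ℝ =>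
    Real.sin β * Real.cos (β / 2) ^ (2 * a) * Real.sin (β / 2) ^ (2 * b)) MeasureTheory.volume
    0 Real.pi :=
  Continuous.intervalIntegrable (by fun_prop) _ _

theorem betaInt_split (a b : ℕ) : betaInt (a + 1) b + betaInt a (b + 1) = betaInt a b := by
  rw [betaInt, betaInt, betaInt, ← intervalIntegral.integral_add (intervalIntegrable_betaInt _ _)
    (intervalIntegrable_betaInt _ _)]
  congr 1
  funext β
  linear_combination Real.sin β * Real.cos (β / 2) ^ (2 * a) * Real.sin (β / 2) ^ (2 * b) *
    Real.sin_sq_add_cos_sq (β / 2)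

/-- Integration of the derivative of cos(β/2)²ᵃ⁺² sin(β/2)²ᵇ⁺², which vanishes at 0 and at π. With
`betaInt_split`, which is cos² + sin² = 1, it gives the two recursions below. -/
theorem betaInt_parts (a b : ℕ) :
    (b + 1 : ℝ) * betaInt (a + 1) b = (a + 1) * betaInt a (b + 1) := by
  have hd : ∀ β : ℝ, HasDerivAt
      (fun β : ℝ => Real.cos (β / 2) ^ (2 * a + 2) * Real.sin (β / 2) ^ (2 * b + 2))
      ((1 / 2 : ℝ) * ((b + 1) * (Real.sin β * Real.cos (β / 2) ^ (2 * (a + 1)) *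
          Real.sin (β / 2) ^ (2 * b)) -
        (a + 1) * (Real.sin β * Real.cos (β / 2) ^ (2 * a) *
          Real.sin (β / 2) ^ (2 * (b + 1))))) β := by
    intro β
    have h0 : HasDerivAt (fun β : ℝ => β / 2) (1 / 2) β := (hasDerivAt_id β).div_const 2
    have h1 := (h0.cos.pow (2 * a + 2)).mul (h0.sin.pow (2 * b + 2))
    refine h1.congr_deriv ?_
    have hs : Real.sin β = 2 * Real.sin (β / 2) * Real.cos (β / 2) := by
      rw [← Real.sin_two_mul]; congr 1; ring
    rw [hs]
    simp only [show 2 * a + 2 - 1 = 2 * a + 1 by omega,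
      show 2 * b + 2 - 1 = 2 * b + 1 by omega, Pi.pow_apply]
    push_cast
    ring
  have h := intervalIntegral.integral_eq_sub_of_hasDerivAt (a := 0) (b := Real.pi)
    (fun β _ => hd β) (Continuous.intervalIntegrable (by fun_prop) _ _)
  rw [intervalIntegral.integral_const_mul, intervalIntegral.integral_sub
    ((intervalIntegrable_betaInt _ _).const_mul _) ((intervalIntegrable_betaInt _ _).const_mul _),
    intervalIntegral.integral_const_mul, intervalIntegral.integral_const_mul] at h
  simp only [Real.cos_pi_div_two, Real.sin_pi_div_two, zero_div, Real.cos_zero, Real.sin_zero] at h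
  simp only [betaInt]
  rw [zero_pow (by omega), zero_pow (by omega)] at h
  linarith

theorem betaInt_succ_left (a b : ℕ) :
    (a + b + 2 : ℝ) * betaInt (a + 1) b = (a + 1) * betaInt a b := by
  rw [← betaInt_split a b]
  linarith [betaInt_parts a b]

theorem betaInt_succ_right (a b : ℕ) :
    (a + b + 2 : ℝ) * betaInt a (b + 1) = (b + 1) * betaInt a b := by
  rw [← betaInt_split a b]
  linarith [betaInt_parts a b]

theorem betaInt_zero : betaInt 0 0 = 2 := by
  simp [betaInt]
  norm_num

/-- The iterated integral over the Euler angles. -/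
def eulerInt (F : ℝ → ℝ → ℝ → ℂ) : ℂ :=
  ∫ α in (0 : ℝ)..(2 * Real.pi), ∫ γ in (0 : ℝ)..(4 * Real.pi), ∫ β in (0 : ℝ)..Real.pi, F α γ β

theorem continuous_inner {F : ℝ → ℝ → ℝ → ℂ}
    (hF : Continuous fun p : ℝ × ℝ × ℝ => F p.1 p.2.1 p.2.2) (b : ℝ) :
    Continuous fun p : ℝ × ℝ => ∫ β in (0 : ℝ)..b, F p.1 p.2 β :=
  intervalIntegral.continuous_parametric_intervalIntegral_of_continuous'
    (f := fun (p : ℝ × ℝ) β => F p.1 p.2 β)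
    (hF.comp (g := fun p : ℝ × ℝ × ℝ => F p.1 p.2.1 p.2.2)
      (f := fun q : (ℝ × ℝ) × ℝ => (q.1.1, q.1.2, q.2)) (by fun_prop)) 0 b

theorem continuous_innermost {F : ℝ → ℝ → ℝ → ℂ}
    (hF : Continuous fun p : ℝ × ℝ × ℝ => F p.1 p.2.1 p.2.2) (α b : ℝ) :
    Continuous fun γ : ℝ => ∫ β in (0 : ℝ)..b, F α γ β :=
  (continuous_inner hF b).comp (Continuous.prodMk_right α)

theorem continuous_middle {F : ℝ → ℝ → ℝ → ℂ}
    (hF : Continuous fun p : ℝ × ℝ × ℝ => F p.1 p.2.1 p.2.2) (b c : ℝ) :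
    Continuous fun α : ℝ => ∫ γ in (0 : ℝ)..c, ∫ β in (0 : ℝ)..b, F α γ β :=
  intervalIntegral.continuous_parametric_intervalIntegral_of_continuous'
    (f := fun α γ => ∫ β in (0 : ℝ)..b, F α γ β) (continuous_inner hF b) 0 c

theorem eulerInt_add {F G : ℝ → ℝ → ℝ → ℂ}
    (hF : Continuous fun p : ℝ × ℝ × ℝ => F p.1 p.2.1 p.2.2)
    (hG : Continuous fun p : ℝ × ℝ × ℝ => G p.1 p.2.1 p.2.2) :
    eulerInt (fun α γ β => F α γ β + G α γ β) = eulerInt F + eulerInt G := by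
  have h1 : ∀ α γ, ∫ β in (0 : ℝ)..Real.pi, (F α γ β + G α γ β) =
      (∫ β in (0 : ℝ)..Real.pi, F α γ β) + ∫ β in (0 : ℝ)..Real.pi, G α γ β := fun α γ =>
    intervalIntegral.integral_add
      (Continuous.intervalIntegrable (hF.comp (Continuous.prodMk_right α |>.comp
        (Continuous.prodMk_right γ))) _ _)
      (Continuous.intervalIntegrable (hG.comp (Continuous.prodMk_right α |>.comp
        (Continuous.prodMk_right γ))) _ _)
  simp only [eulerInt, h1]
  rw [← intervalIntegral.integral_add ((continuous_middle hF _ _).intervalIntegrable _ _)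
    ((continuous_middle hG _ _).intervalIntegrable _ _)]
  congr 1
  funext α
  exact intervalIntegral.integral_add
    ((continuous_innermost hF α _).intervalIntegrable _ _)
    ((continuous_innermost hG α _).intervalIntegrable _ _)

theorem eulerInt_prod (A B C : ℝ → ℂ) (c : ℂ) :
    eulerInt (fun α γ β => c * (A α * B γ * C β)) =
      c * ((∫ α in (0 : ℝ)..(2 * Real.pi), A α) * (∫ γ in (0 : ℝ)..(4 * Real.pi), B γ) *
        ∫ β in (0 : ℝ)..Real.pi, C β) := by
  simp only [eulerInt, intervalIntegral.integral_const_mul, intervalIntegral.integral_mul_const]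

theorem integral_exp_int_two_pi {n : ℤ} (hn : n ≠ 0) :
    ∫ x in (0 : ℝ)..(2 * Real.pi), Complex.exp (n * Complex.I * x) = 0 := by
  rw [integral_exp_mul_complex (mul_ne_zero (by exact_mod_cast hn) Complex.I_ne_zero)]
  have : (n : ℂ) * Complex.I * ((2 * Real.pi : ℝ) : ℂ) = n * (2 * Real.pi * Complex.I) := by
    push_cast; ring
  rw [this, Complex.exp_int_mul_two_pi_mul_I]
  simp

theorem integral_exp_int_four_pi {n : ℤ} (hn : n ≠ 0) :
    ∫ x in (0 : ℝ)..(4 * Real.pi), Complex.exp (n / 2 * Complex.I * x) = 0 := by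
  have hn' : (n / 2 : ℂ) ≠ 0 := div_ne_zero (by exact_mod_cast hn) two_ne_zero
  rw [integral_exp_mul_complex (mul_ne_zero hn' Complex.I_ne_zero)]
  have : (n / 2 : ℂ) * Complex.I * ((4 * Real.pi : ℝ) : ℂ) = n * (2 * Real.pi * Complex.I) := by
    push_cast; ring
  rw [this, Complex.exp_int_mul_two_pi_mul_I]
  simp

/-- The integral of a monomial over the Euler angles. -/
def haarMonomial (R : ℝ) (m : Gen →₀ ℕ) : ℂ :=
  if m .ap = m .am ∧ m .bp = m .bm then
    -- 8π² = 2π · 4π is the measure of the range of α and γ.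
    8 * (Real.pi : ℂ) ^ 2 * (2 * R : ℂ) ^ (m .ap + m .bp) * (betaInt (m .ap) (m .bp) : ℂ)
  else 0

theorem evalPt_euler_monomial (R : ℝ) (m : Gen →₀ ℕ) (c : ℂ) (α β γ : ℝ) :
    evalPt R (euler α β γ) (monomial m c) =
      (c * ((Real.sqrt (2 * R) : ℂ) ^ (m .ap + m .am + m .bp + m .bm) * (-Complex.I) ^ m .bp *
        Complex.I ^ m .bm)) *
      (Complex.exp (((m .am - m .ap + m .bp - m .bm : ℤ) : ℂ) / 2 * Complex.I * α) *
        Complex.exp (((m .am - m .ap + m .bm - m .bp : ℤ) : ℂ) / 2 * Complex.I * γ) *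
        ((Real.cos (β / 2) : ℂ) ^ (m .ap + m .am) *
          (Real.sin (β / 2) : ℂ) ^ (m .bp + m .bm))) := by
  have hg : ∀ x, genFun R x (euler α β γ) = eulerFun R (gen x) α β γ := fun x => by
    rw [eulerFun, evalSU2_gen]
  have hu : (Finset.univ : Finset Gen) = {.ap, .am, .bp, .bm} := rfl
  rw [evalPt, aeval_monomial, Finsupp.prod_fintype _ _ (by simp), hu,
    Finset.prod_insert (by decide), Finset.prod_insert (by decide),
    Finset.prod_insert (by decide), Finset.prod_singleton]
  simp only [hg, eulerFun_gen_ap, eulerFun_gen_am, eulerFun_gen_bp, eulerFun_gen_bm, mul_pow,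
    ← Complex.exp_nat_mul, Algebra.algebraMap_self, RingHom.id_apply]
  have he : Complex.exp (((m .am - m .ap + m .bp - m .bm : ℤ) : ℂ) / 2 * Complex.I * α) *
        Complex.exp (((m .am - m .ap + m .bm - m .bp : ℤ) : ℂ) / 2 * Complex.I * γ) =
      Complex.exp (m .ap * (-(Complex.I / 2) * (α + γ))) *
      Complex.exp (m .am * ((Complex.I / 2) * (α + γ))) *
      Complex.exp (m .bp * ((Complex.I / 2) * (α - γ))) *
      Complex.exp (m .bm * (-(Complex.I / 2) * (α - γ))) := by
    rw [← Complex.exp_add, ← Complex.exp_add, ← Complex.exp_add, ← Complex.exp_add]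
    congr 1
    push_cast
    ring
  rw [he]
  ring

theorem eulerInt_monomial {R : ℝ} (hR : 0 < R) (m : Gen →₀ ℕ) (c : ℂ) :
    eulerInt (fun α γ β => (Real.sin β : ℂ) * evalPt R (euler α β γ) (monomial m c)) =
      c * haarMonomial R m := by
  have h1 : (fun α γ β : ℝ => (Real.sin β : ℂ) * evalPt R (euler α β γ) (monomial m c)) =
      fun α γ β : ℝ => (c * ((Real.sqrt (2 * R) : ℂ) ^ (m .ap + m .am + m .bp + m .bm) *
        (-Complex.I) ^ m .bp * Complex.I ^ m .bm)) *
      (Complex.exp (((m .am - m .ap + m .bp - m .bm : ℤ) : ℂ) / 2 * Complex.I * α) *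
        Complex.exp (((m .am - m .ap + m .bm - m .bp : ℤ) : ℂ) / 2 * Complex.I * γ) *
        ((Real.sin β : ℂ) * ((Real.cos (β / 2) : ℂ) ^ (m .ap + m .am) *
          (Real.sin (β / 2) : ℂ) ^ (m .bp + m .bm)))) := by
    funext α γ β
    rw [evalPt_euler_monomial]
    ring
  rw [h1, eulerInt_prod]
  -- The order of the cases matters: the frequency in α may be a half-integer, which does not
  -- integrate to zero over [0, 2π]. When the frequency in γ vanishes, that in α is the integer `m
  -- .am - m .ap`.
  by_cases hγ : (m .am - m .ap + m .bm - m .bp : ℤ) = 0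
  · by_cases hα : (m .am - m .ap : ℤ) = 0
    · have e1 : m .am = m .ap := by omega
      have e2 : m .bm = m .bp := by omega
      have hI : (-Complex.I) ^ m .bp * Complex.I ^ m .bp = 1 := by
        rw [← mul_pow]
        simp
      have hb : (∫ β in (0 : ℝ)..Real.pi, (Real.sin β : ℂ) *
          ((Real.cos (β / 2) : ℂ) ^ (m .ap + m .ap) * (Real.sin (β / 2) : ℂ) ^ (m .bp + m .bp))) =
          (betaInt (m .ap) (m .bp) : ℂ) := by
        rw [betaInt, ← intervalIntegral.integral_ofReal]
        congr 1
        funext β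
        push_cast
        rw [two_mul, two_mul]
        ring
      have hs : (Real.sqrt (2 * R) : ℂ) ^ (m .ap + m .ap + m .bp + m .bp) =
          (2 * R) ^ (m .ap + m .bp) := by
        rw [← ofReal_sqrt_two_mul_sq hR, ← pow_mul]
        congr 1
        ring
      rw [haarMonomial, if_pos ⟨e1.symm, e2.symm⟩, e1, e2, hb, hs]
      simp
      linear_combination c * (2 * R) ^ (m .ap + m .bp) * (2 * Real.pi * (4 * Real.pi)) *
        betaInt (m .ap) (m .bp) * hI
    · have e : (((m .am - m .ap + m .bp - m .bm : ℤ) : ℂ) / 2) = ((m .am - m .ap : ℤ) : ℂ) := by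
        rw [show (m .am - m .ap + m .bp - m .bm : ℤ) = 2 * (m .am - m .ap) by omega]
        push_cast
        ring
      rw [e, integral_exp_int_two_pi hα, haarMonomial, if_neg (by omega)]
      ring
  · rw [integral_exp_int_four_pi hγ, haarMonomial, if_neg (by omega)]
    ring

/-- The integral over the Euler angles, as a linear functional. -/
def haar (R : ℝ) : CPoly →ₗ[ℂ] ℂ := (basisMonomials Gen ℂ).constr ℂ (haarMonomial R)

theorem haar_monomial (R : ℝ) (m : Gen →₀ ℕ) (c : ℂ) :
    haar R (monomial m c) = c * haarMonomial R m := by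
  have h : monomial m c = c • basisMonomials Gen ℂ m := by simp [smul_monomial]
  rw [h, map_smul, haar, Module.Basis.constr_basis, smul_eq_mul]

theorem continuous_evalPt_euler (R : ℝ) (f : CPoly) : Continuous fun p : ℝ × ℝ × ℝ =>
    (Real.sin p.2.2 : ℂ) * evalPt R (euler p.1 p.2.2 p.2.1) f := by
  have h := continuous_eulerFun R (symmetrize f)
  simp only [eulerFun_eq_evalPt, comm_symmetrize] at h
  exact Continuous.mul (by fun_prop) (h.comp (g := fun p : ℝ × ℝ × ℝ =>
    evalPt R (euler p.1 p.2.1 p.2.2) f)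
    (f := fun p : ℝ × ℝ × ℝ => (p.1, p.2.2, p.2.1)) (by fun_prop))

theorem eulerInt_evalPt {R : ℝ} (hR : 0 < R) (f : CPoly) :
    eulerInt (fun α γ β => (Real.sin β : ℂ) * evalPt R (euler α β γ) f) = haar R f := by
  induction f using MvPolynomial.induction_on' with
  | monomial m c => rw [eulerInt_monomial hR, haar_monomial]
  | add p q hp hq =>
    simp only [map_add, mul_add]
    rw [eulerInt_add (continuous_evalPt_euler R p) (continuous_evalPt_euler R q), hp, hq]

/-- For the exponents a, a, b, b the two terms of the Laplacian contribute a(a + b + 1) and b(a + b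
+ 1) times the integral, by the recursions for `betaInt`. Their sum is (d/2)(d/2 + 1) with d = 2(a +
b). -/
theorem haarMonomial_lap (R : ℝ) (m : Gen →₀ ℕ) (c : ℂ) :
    2 * R * haar R (lap (monomial m c)) =
      ((m.degree : ℂ) / 2 * (m.degree / 2 + 1)) * haar R (monomial m c) := by
  have hdeg : (m.degree : ℂ) = m .ap + m .am + m .bp + m .bm := by
    rw [Finsupp.degree_eq_sum, sum_gen]
    push_cast
    ring
  rw [lap_apply, pderiv_monomial, pderiv_monomial, pderiv_monomial, pderiv_monomial, map_add,
    haar_monomial, haar_monomial, haar_monomial, hdeg]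
  simp only [haarMonomial, Finsupp.tsub_apply, Finsupp.single_apply, reduceCtorEq, if_true,
    if_false, tsub_zero]
  generalize m .ap = a
  generalize m .am = a'
  generalize m .bp = b
  generalize m .bm = b'
  by_cases h : a = a' ∧ b = b'
  · obtain ⟨rfl, rfl⟩ := h
    simp only [and_self, if_true]
    have h1 : (a : ℂ) * a * (2 * R * ((2 * R) ^ (a - 1 + b) * (betaInt (a - 1) b : ℂ))) =
        a * (a + b + 1) * ((2 * R) ^ (a + b) * betaInt a b) := by
      cases a with
      | zero => simp
      | succ a =>
        have := betaInt_succ_left a b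
        apply_fun ((↑) : ℝ → ℂ) at this
        push_cast at this ⊢
        rw [add_right_comm a 1 b, pow_succ]
        linear_combination -(a + 1 : ℂ) * (2 * R) ^ (a + b) * (2 * R) * this
    have h2 : (b : ℂ) * b * (2 * R * ((2 * R) ^ (a + (b - 1)) * (betaInt a (b - 1) : ℂ))) =
        b * (a + b + 1) * ((2 * R) ^ (a + b) * betaInt a b) := by
      cases b with
      | zero => simp
      | succ b =>
        have := betaInt_succ_right a b
        apply_fun ((↑) : ℝ → ℂ) at this
        push_cast at this ⊢
        rw [← add_assoc a b 1, pow_succ]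
        linear_combination -(b + 1 : ℂ) * (2 * R) ^ (a + b) * (2 * R) * this
    linear_combination 8 * (Real.pi : ℂ) ^ 2 * c * (h1 + h2)
  · rw [if_neg h, mul_zero, mul_zero]
    -- Truncated subtraction can make a - 1 and a' - 1 agree for a ≠ a', but only if one of the
    -- exponents is 0, and then the coefficient vanishes.
    have h1 : (c * a' * a : ℂ) * (if a - 1 = a' - 1 ∧ b = b' then
        8 * (Real.pi : ℂ) ^ 2 * (2 * R : ℂ) ^ (a - 1 + b) * (betaInt (a - 1) b : ℂ) else 0) = 0 := by
      rcases Nat.eq_zero_or_pos a with rfl | ha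
      · simp
      rcases Nat.eq_zero_or_pos a' with rfl | ha'
      · simp
      rw [if_neg (by omega), mul_zero]
    have h2 : (c * b' * b : ℂ) * (if a = a' ∧ b - 1 = b' - 1 then
        8 * (Real.pi : ℂ) ^ 2 * (2 * R : ℂ) ^ (a + (b - 1)) * (betaInt a (b - 1) : ℂ) else 0) =
        0 := by
      rcases Nat.eq_zero_or_pos b with rfl | hb
      · simp
      rcases Nat.eq_zero_or_pos b' with rfl | hb'
      · simp
      rw [if_neg (by omega), mul_zero]
    rw [h1, h2]
    ring

theorem haar_lap (R : ℝ) {f : CPoly} {d : ℕ} (hf : f.IsHomogeneous d) :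
    2 * R * haar R (lap f) = ((d : ℂ) / 2 * (d / 2 + 1)) * haar R f := by
  rw [f.as_sum, map_sum, map_sum, map_sum, Finset.mul_sum, Finset.mul_sum]
  refine Finset.sum_congr rfl fun m hm => ?_
  rw [haarMonomial_lap, hf.degree_eq_sum_deg_support hm]
  rfl

/-- By `haar_lap` every harmonic component of positive degree integrates to zero. The constant 16π²
is 8π² times `betaInt 0 0 = 2`. -/
theorem haar_of_mem_Harm {R : ℝ} {f : CPoly} (hf : f ∈ Harm) :
    haar R f = 16 * (Real.pi : ℂ) ^ 2 * constantCoeff f := by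
  have h1 : ∀ d, d ≠ 0 → haar R (homogeneousComponent d f) = 0 := by
    intro d hd
    have h := haar_lap R (homogeneousComponent_isHomogeneous d f)
    rw [mem_Harm.1 (homogeneousComponent_mem_Harm hf d), map_zero, mul_zero] at h
    refine (mul_eq_zero.1 h.symm).resolve_left ?_
    have hd' : (d : ℂ) ≠ 0 := by exact_mod_cast hd
    refine mul_ne_zero (div_ne_zero hd' two_ne_zero) ?_
    have : (d + 2 : ℂ) ≠ 0 := by exact_mod_cast (by omega : d + 2 ≠ 0)
    intro h0
    apply this
    linear_combination 2 * h0
  conv_lhs => rw [← sum_homogeneousComponent f]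
  rw [map_sum, Finset.sum_eq_single_of_mem 0 (by simp) (fun d _ hd => h1 d hd),
    homogeneousComponent_zero, ← monomial_zero', haar_monomial, haarMonomial]
  simp [betaInt_zero, constantCoeff_eq]
  ring

/-- The integrand of the sesquilinear form. -/
def formIntegrand (R : ℝ) (ξ ζ : FreePoly) (α γ β : ℝ) : ℂ :=
  (Real.sin β : ℂ) * starRingEnd ℂ (eulerFun R ξ α β γ) * eulerFun R ζ α β γ

theorem continuous_formIntegrand (R : ℝ) (ξ ζ : FreePoly) :
    Continuous fun p : ℝ × ℝ × ℝ => formIntegrand R ξ ζ p.1 p.2.1 p.2.2 := by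
  have h1 := (continuous_eulerFun R ξ).comp
    (f := fun p : ℝ × ℝ × ℝ => (p.1, p.2.2, p.2.1)) (by fun_prop)
  have h2 := (continuous_eulerFun R ζ).comp
    (f := fun p : ℝ × ℝ × ℝ => (p.1, p.2.2, p.2.1)) (by fun_prop)
  exact (Continuous.mul (by fun_prop) (Complex.continuous_conj.comp h1)).mul h2

theorem integral_four_pi_of_periodic {G : ℝ → ℂ} (hG : Continuous G)
    (hper : Function.Periodic G (2 * Real.pi)) :
    ∫ γ in (0 : ℝ)..(4 * Real.pi), G γ = 2 * ∫ γ in (0 : ℝ)..(2 * Real.pi), G γ := by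
  rw [← intervalIntegral.integral_add_adjacent_intervals (b := 2 * Real.pi)
    (hG.intervalIntegrable _ _) (hG.intervalIntegrable _ _)]
  have h3 := hper.intervalIntegral_add_eq (2 * Real.pi) 0
  rw [zero_add, show 2 * Real.pi + 2 * Real.pi = 4 * Real.pi by ring] at h3
  rw [h3]
  ring

theorem formIntegrand_periodic (R : ℝ) {k : ℕ} {ξ ζ : FreePoly} (hξ : HasParity ξ k)
    (hζ : HasParity ζ k) (α γ β : ℝ) :
    formIntegrand R ξ ζ α (γ + 2 * Real.pi) β = formIntegrand R ξ ζ α γ β := by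
  have hk : (-1 : ℂ) ^ k * (-1) ^ k = 1 := by
    rw [← mul_pow]
    simp
  rw [formIntegrand, eulerFun_add_two_pi, eulerFun_add_two_pi, signFlip_of_hasParity hξ,
    signFlip_of_hasParity hζ, eulerFun_smul, eulerFun_smul, map_mul, map_pow, map_neg, map_one,
    formIntegrand]
  linear_combination (Real.sin β : ℂ) * starRingEnd ℂ (eulerFun R ξ α β γ) *
    eulerFun R ζ α β γ * hk

/-- On SU(2) the dagger is complex conjugation and reduction does not change values, so the
integrand is a harmonic polynomial; its mean is its constant term. -/
theorem form_eq_integral {R : ℝ} (hR : 0 < R) (ξ ζ : Psi) :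
    form 0 R ξ ζ = (1 / (16 * (Real.pi : ℂ) ^ 2)) *
      ∫ α in (0 : ℝ)..(2 * Real.pi), ∫ γ in (0 : ℝ)..(4 * Real.pi), ∫ β in (0 : ℝ)..Real.pi,
        formIntegrand R ξ ζ α γ β := by
  set η := reduce 0 R (freeRep 0 (dagger ξ) (comm ζ)) with hη
  have h1 : ∀ α β γ, formIntegrand R ξ ζ α γ β =
      (Real.sin β : ℂ) * evalPt R (euler α β γ) (comm η) := by
    intro α β γ
    rw [formIntegrand, hη, evalPt_comm_reduce hR, freeRep_zero, map_mul, ← evalSU2_apply, ← evalSU2_apply,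
      evalSU2_dagger, mul_assoc]
    rfl
  simp only [h1]
  have h2 := eulerInt_evalPt hR (comm η)
  rw [haar_of_mem_Harm (mem_Harm.2 (mem_Psi_iff.1 η.2).2)] at h2
  have h3 := taylor_comm η.2.1 []
  simp only [taylor, List.length_nil, Nat.factorial_zero, Nat.cast_one, one_mul] at h3
  rw [form_eq, ← hη, ← h3]
  rw [eulerInt] at h2
  rw [h2]
  have : (Real.pi : ℂ) ≠ 0 := by exact_mod_cast Real.pi_ne_zero
  field_simp

theorem form_conj {R : ℝ} (hR : 0 < R) (ξ ζ : Psi) :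
    form 0 R ξ ζ = starRingEnd ℂ (form 0 R ζ ξ) := by
  rw [form_eq_integral hR, form_eq_integral hR, map_mul]
  simp only [formIntegrand, ← intervalIntegral.intervalIntegral_conj]
  congr 1
  · simp [Complex.conj_ofReal, Complex.conj_ofNat]
  · simp only [map_mul, Complex.conj_conj, Complex.conj_ofReal]
    congr 1; funext α; congr 1; funext γ; congr 1; funext β
    ring

theorem form_eq_integral_of_parity {R : ℝ} (hR : 0 < R) (k : ℕ) (ξ ζ : Psi) (hξ : HasParity ξ k)
    (hζ : HasParity ζ k) : form 0 R ξ ζ = (1 / (8 * (Real.pi : ℂ) ^ 2)) *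
      ∫ α in (0 : ℝ)..(2 * Real.pi), ∫ γ in (0 : ℝ)..(2 * Real.pi), ∫ β in (0 : ℝ)..Real.pi,
        formIntegrand R ξ ζ α γ β := by
  have h2 : ∀ α, ∫ γ in (0 : ℝ)..(4 * Real.pi), ∫ β in (0 : ℝ)..Real.pi,
        formIntegrand R ξ ζ α γ β =
      2 * ∫ γ in (0 : ℝ)..(2 * Real.pi), ∫ β in (0 : ℝ)..Real.pi,
        formIntegrand R ξ ζ α γ β := fun α =>
    integral_four_pi_of_periodic
      (G := fun γ => ∫ β in (0 : ℝ)..Real.pi, formIntegrand R ξ ζ α γ β)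
      (continuous_innermost (continuous_formIntegrand R ξ ζ) α _)
      (fun γ => intervalIntegral.integral_congr fun β _ =>
        formIntegrand_periodic R hξ hζ α γ β)
  rw [form_eq_integral hR]
  simp only [h2, intervalIntegral.integral_const_mul]
  have : (Real.pi : ℂ) ≠ 0 := by exact_mod_cast Real.pi_ne_zero
  field_simp
  ring

theorem formIntegrand_self (R : ℝ) (ξ : FreePoly) (α γ β : ℝ) :
    formIntegrand R ξ ξ α γ β = ((Real.sin β * ‖eulerFun R ξ α β γ‖ ^ 2 : ℝ) : ℂ) := by
  rw [formIntegrand, mul_assoc, Complex.conj_mul']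
  push_cast
  rfl

theorem form_self_pos {R : ℝ} (hR : 0 < R) (ξ : Psi) (hξ : ξ ≠ 0) :
    0 < (form 0 R ξ ξ).re ∧ (form 0 R ξ ξ).im = 0 := by
  set F : ℝ → ℝ → ℝ → ℝ := fun α γ β => Real.sin β * ‖eulerFun R ξ α β γ‖ ^ 2 with hF
  have hcont : Continuous fun p : ℝ × ℝ × ℝ => F p.1 p.2.1 p.2.2 := by
    have h1 := (continuous_eulerFun R ξ).comp
      (f := fun p : ℝ × ℝ × ℝ => (p.1, p.2.2, p.2.1)) (by fun_prop)
    exact Continuous.mul (by fun_prop) (h1.norm.pow 2)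
  have hcont1 : Continuous fun p : ℝ × ℝ => ∫ β in (0 : ℝ)..Real.pi, F p.1 p.2 β :=
    intervalIntegral.continuous_parametric_intervalIntegral_of_continuous'
      (f := fun (p : ℝ × ℝ) β => F p.1 p.2 β)
      (hcont.comp (g := fun p : ℝ × ℝ × ℝ => F p.1 p.2.1 p.2.2)
        (f := fun q : (ℝ × ℝ) × ℝ => (q.1.1, q.1.2, q.2)) (by fun_prop)) 0 _
  have hcont2 : Continuous fun α : ℝ => ∫ γ in (0 : ℝ)..(4 * Real.pi),
      ∫ β in (0 : ℝ)..Real.pi, F α γ β :=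
    intervalIntegral.continuous_parametric_intervalIntegral_of_continuous'
      (f := fun α γ => ∫ β in (0 : ℝ)..Real.pi, F α γ β) hcont1 0 _
  have hform : form 0 R ξ ξ = ((1 / (16 * Real.pi ^ 2) * ∫ α in (0 : ℝ)..(2 * Real.pi),
      ∫ γ in (0 : ℝ)..(4 * Real.pi), ∫ β in (0 : ℝ)..Real.pi, F α γ β : ℝ) : ℂ) := by
    rw [form_eq_integral hR]
    simp only [formIntegrand_self, intervalIntegral.integral_ofReal]
    push_cast
    rfl
  rw [hform]
  refine ⟨?_, Complex.ofReal_im _⟩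
  rw [Complex.ofReal_re]
  have hpi := Real.pi_pos
  have hpos : ∀ α γ β, β ∈ Set.Icc 0 Real.pi → 0 ≤ F α γ β := fun α γ β hβ =>
    mul_nonneg (Real.sin_nonneg_of_mem_Icc hβ) (by positivity)
  have hpos1 : ∀ α γ, 0 ≤ ∫ β in (0 : ℝ)..Real.pi, F α γ β := fun α γ =>
    intervalIntegral.integral_nonneg hpi.le (hpos α γ)
  -- A point where ξ does not vanish must be found with 0 < β < π, since the weight sin β vanishes
  -- at the ends. If there were none, ξ would vanish at the ends too, by continuity in β.
  obtain ⟨α, hα, γ, hγ, β, hβ, hne⟩ : ∃ α ∈ Set.Icc 0 (2 * Real.pi), ∃ γ ∈ Set.Icc 0 (4 * Real.pi),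
      ∃ β ∈ Set.Ioo 0 Real.pi, eulerFun R ξ α β γ ≠ 0 := by
    by_contra! h
    apply hξ
    have h1 : comm ξ = 0 := by
      refine evalPt_injOn_Harm hR (mem_Harm.2 (mem_Psi_iff.1 ξ.2).2) fun g => ?_
      obtain ⟨α, hα, β, hβ, γ, hγ, rfl⟩ := exists_euler g
      rw [← eulerFun_eq_evalPt]
      have hc : Continuous fun β => eulerFun R ξ α β γ :=
        (continuous_eulerFun R ξ).comp (f := fun β : ℝ => (α, β, γ)) (by fun_prop)
      have hcl : IsClosed {β | eulerFun R ξ α β γ = 0} := isClosed_eq hc continuous_const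
      have hsub : Set.Ioo 0 Real.pi ⊆ {β | eulerFun R ξ α β γ = 0} := fun β hβ =>
        h α (Set.Ico_subset_Icc_self hα) γ (Set.Ico_subset_Icc_self hγ) β hβ
      have := closure_minimal hsub hcl
      rw [closure_Ioo hpi.ne] at this
      exact this hβ
    exact (LinearEquiv.map_eq_zero_iff psiEquiv).1 (Subtype.ext h1)
  refine mul_pos (by positivity) ?_
  refine intervalIntegral.integral_pos (by positivity) hcont2.continuousOn
    (fun α _ => intervalIntegral.integral_nonneg (by positivity) fun γ _ => hpos1 α γ) ⟨α, hα, ?_⟩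
  refine intervalIntegral.integral_pos (by positivity)
    (hcont1.comp (Continuous.prodMk_right α)).continuousOn (fun γ _ => hpos1 α γ) ⟨γ, hγ, ?_⟩
  refine intervalIntegral.integral_pos hpi
    (hcont.comp (f := fun β : ℝ => (α, γ, β)) (by fun_prop)).continuousOn
    (fun β hβ => hpos α γ β (Set.Ioc_subset_Icc_self hβ)) ⟨β, Set.Ioo_subset_Icc_self hβ, ?_⟩
  have := Real.sin_pos_of_mem_Ioo hβ
  have := norm_pos_iff.2 hne
  positivity

/-! ### The bracket -/

theorem differentiable_eulerFun_alpha (R : ℝ) (ξ : FreePoly) (β γ : ℝ) :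
    Differentiable ℝ fun x => eulerFun R ξ x β γ := by
  have hc : Differentiable ℝ fun x : ℝ => (x : ℂ) := Complex.ofRealCLM.differentiable
  induction ξ using gen_induction with
  | h1 => simp only [eulerFun_one]; exact differentiable_const _
  | hgen x ξ ih =>
    simp only [eulerFun_mul]
    refine Differentiable.mul ?_ ih
    cases x
    · simp only [eulerFun_gen_ap]; fun_prop
    · simp only [eulerFun_gen_am]; fun_prop
    · simp only [eulerFun_gen_bp]; fun_prop
    · simp only [eulerFun_gen_bm]; fun_prop
  | hadd ξ ζ h1 h2 => simp only [eulerFun_add]; exact h1.add h2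
  | hsmul c ξ h => simp only [eulerFun_smul]; exact h.const_mul c

theorem differentiable_eulerFun_gamma (R : ℝ) (ξ : FreePoly) (α β : ℝ) :
    Differentiable ℝ fun x => eulerFun R ξ α β x := by
  have hc : Differentiable ℝ fun x : ℝ => (x : ℂ) := Complex.ofRealCLM.differentiable
  have hg : ∀ x, Differentiable ℝ fun t => eulerFun R (gen x) α β t := by
    intro x
    cases x
    · simp only [eulerFun_gen_ap]; fun_prop
    · simp only [eulerFun_gen_am]; fun_prop
    · simp only [eulerFun_gen_bp]; fun_prop
    · simp only [eulerFun_gen_bm]; fun_prop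
  induction ξ using gen_induction with
  | h1 => simp only [eulerFun_one]; exact differentiable_const _
  | hgen x ξ ih =>
    simp only [eulerFun_mul]
    exact (hg x).mul ih
  | hadd ξ ζ h1 h2 => simp only [eulerFun_add]; exact h1.add h2
  | hsmul c ξ h => simp only [eulerFun_smul]; exact h.const_mul c

theorem hasDerivAt_cos_half (β : ℝ) : HasDerivAt (fun x : ℝ => (Real.cos (x / 2) : ℂ))
    (-(1 / 2) * (Real.sin (β / 2) : ℂ)) β := by
  have h0 : HasDerivAt (fun x : ℝ => x / 2) (1 / 2) β := (hasDerivAt_id β).div_const 2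
  refine h0.cos.ofReal_comp.congr_deriv ?_
  push_cast
  ring

theorem hasDerivAt_sin_half (β : ℝ) : HasDerivAt (fun x : ℝ => (Real.sin (x / 2) : ℂ))
    ((1 / 2) * (Real.cos (β / 2) : ℂ)) β := by
  have h0 : HasDerivAt (fun x : ℝ => x / 2) (1 / 2) β := (hasDerivAt_id β).div_const 2
  refine h0.sin.ofReal_comp.congr_deriv ?_
  push_cast
  ring

theorem differentiable_eulerFun_beta (R : ℝ) (ξ : FreePoly) (α γ : ℝ) :
    Differentiable ℝ fun x => eulerFun R ξ α x γ := by
  have hc : Differentiable ℝ fun x : ℝ => (Real.cos (x / 2) : ℂ) := fun x =>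
    (hasDerivAt_cos_half x).differentiableAt
  have hs : Differentiable ℝ fun x : ℝ => (Real.sin (x / 2) : ℂ) := fun x =>
    (hasDerivAt_sin_half x).differentiableAt
  induction ξ using gen_induction with
  | h1 => simp only [eulerFun_one]; exact differentiable_const _
  | hgen x ξ ih =>
    simp only [eulerFun_mul]
    refine Differentiable.mul ?_ ih
    cases x
    · simp only [eulerFun_gen_ap]; exact (hc.const_mul _).mul_const _
    · simp only [eulerFun_gen_am]; exact (hc.const_mul _).mul_const _
    · simp only [eulerFun_gen_bp]; exact (hs.const_mul _).mul_const _
    · simp only [eulerFun_gen_bm]; exact (hs.const_mul _).mul_const _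
  | hadd ξ ζ h1 h2 => simp only [eulerFun_add]; exact h1.add h2
  | hsmul c ξ h => simp only [eulerFun_smul]; exact h.const_mul c

/-- The evaluation of a noncommutative polynomial at a point in Euler angles. -/
def evalEuler (R α β γ : ℝ) : FreePoly →ₐ[ℂ] ℂ :=
  (Pi.evalAlgHom ℂ (fun _ : SU2 => ℂ) (euler α β γ)).comp (evalSU2 R)

theorem evalEuler_apply (R α β γ : ℝ) (ξ : FreePoly) :
    evalEuler R α β γ ξ = eulerFun R ξ α β γ := rfl

/-- Derivations of the free algebra at a point. -/
def IsPointDerivation (ev : FreePoly →ₐ[ℂ] ℂ) (D : FreePoly →ₗ[ℂ] ℂ) : Prop :=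
  ∀ ξ ζ, D (ξ * ζ) = D ξ * ev ζ + ev ξ * D ζ

theorem IsPointDerivation.apply_one {ev : FreePoly →ₐ[ℂ] ℂ} {D : FreePoly →ₗ[ℂ] ℂ}
    (h : IsPointDerivation ev D) : D 1 = 0 := by
  have := h 1 1
  rw [mul_one, map_one ev] at this
  linear_combination -this

/-- `∂/∂α` at a point. -/
def dAlpha (R α β γ : ℝ) : FreePoly →ₗ[ℂ] ℂ where
  toFun ξ := deriv (fun x => eulerFun R ξ x β γ) α
  map_add' ξ ζ := by
    simp only [eulerFun_add]
    exact deriv_fun_add (differentiable_eulerFun_alpha R ξ β γ α)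
      (differentiable_eulerFun_alpha R ζ β γ α)
  map_smul' c ξ := by
    simp only [eulerFun_smul, RingHom.id_apply, smul_eq_mul]
    exact deriv_const_mul _ (differentiable_eulerFun_alpha R ξ β γ α)

/-- `∂/∂β` at a point. -/
def dBeta (R α β γ : ℝ) : FreePoly →ₗ[ℂ] ℂ where
  toFun ξ := deriv (fun x => eulerFun R ξ α x γ) β
  map_add' ξ ζ := by
    simp only [eulerFun_add]
    exact deriv_fun_add (differentiable_eulerFun_beta R ξ α γ β)
      (differentiable_eulerFun_beta R ζ α γ β)
  map_smul' c ξ := by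
    simp only [eulerFun_smul, RingHom.id_apply, smul_eq_mul]
    exact deriv_const_mul _ (differentiable_eulerFun_beta R ξ α γ β)

/-- `∂/∂γ` at a point. -/
def dGamma (R α β γ : ℝ) : FreePoly →ₗ[ℂ] ℂ where
  toFun ξ := deriv (fun x => eulerFun R ξ α β x) γ
  map_add' ξ ζ := by
    simp only [eulerFun_add]
    exact deriv_fun_add (differentiable_eulerFun_gamma R ξ α β γ)
      (differentiable_eulerFun_gamma R ζ α β γ)
  map_smul' c ξ := by
    simp only [eulerFun_smul, RingHom.id_apply, smul_eq_mul]
    exact deriv_const_mul _ (differentiable_eulerFun_gamma R ξ α β γ)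

/-- Half the degree operator, evaluated at a point. -/
def dNumber (R α β γ : ℝ) : FreePoly →ₗ[ℂ] ℂ :=
  (1 / 2 : ℂ) • (evalEuler R α β γ).toLinearMap ∘ₗ degOp

theorem dNumber_apply (R α β γ : ℝ) (ξ : FreePoly) :
    dNumber R α β γ ξ = (1 / 2 : ℂ) * eulerFun R (degOp ξ) α β γ := rfl

theorem isPointDerivation_dAlpha (R α β γ : ℝ) :
    IsPointDerivation (evalEuler R α β γ) (dAlpha R α β γ) := fun ξ ζ => by
  change deriv (fun x => eulerFun R (ξ * ζ) x β γ) α = _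
  simp only [eulerFun_mul]
  exact deriv_fun_mul (differentiable_eulerFun_alpha R ξ β γ α)
      (differentiable_eulerFun_alpha R ζ β γ α)

theorem isPointDerivation_dBeta (R α β γ : ℝ) :
    IsPointDerivation (evalEuler R α β γ) (dBeta R α β γ) := fun ξ ζ => by
  change deriv (fun x => eulerFun R (ξ * ζ) α x γ) β = _
  simp only [eulerFun_mul]
  exact deriv_fun_mul (differentiable_eulerFun_beta R ξ α γ β)
      (differentiable_eulerFun_beta R ζ α γ β)

theorem isPointDerivation_dGamma (R α β γ : ℝ) :
    IsPointDerivation (evalEuler R α β γ) (dGamma R α β γ) := fun ξ ζ => by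
  change deriv (fun x => eulerFun R (ξ * ζ) α β x) γ = _
  simp only [eulerFun_mul]
  exact deriv_fun_mul (differentiable_eulerFun_gamma R ξ α β γ)
      (differentiable_eulerFun_gamma R ζ α β γ)

theorem degOp_mul (ξ ζ : FreePoly) : degOp (ξ * ζ) = degOp ξ * ζ + ξ * degOp ζ := by
  induction ξ using word_induction with
  | h u =>
    induction ζ using word_induction with
    | h v =>
      rw [← word_append, degOp_word, degOp_word, degOp_word, word_append, List.length_append,
        smul_mul_assoc, mul_smul_comm, ← add_smul]
      push_cast
      rfl
    | hadd a b ha hb => rw [mul_add, map_add, ha, hb, map_add]; noncomm_ring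
    | hsmul c a ha => rw [mul_smul_comm, map_smul, ha, map_smul, mul_smul_comm, smul_add,
        mul_smul_comm]
  | hadd a b ha hb => rw [add_mul, map_add, ha, hb, map_add]; noncomm_ring
  | hsmul c a ha => rw [smul_mul_assoc, map_smul, ha, map_smul, smul_mul_assoc, smul_add,
      smul_mul_assoc]

theorem isPointDerivation_dNumber (R α β γ : ℝ) :
    IsPointDerivation (evalEuler R α β γ) (dNumber R α β γ) := fun ξ ζ => by
  rw [dNumber_apply, degOp_mul, eulerFun_add, eulerFun_mul, eulerFun_mul, dNumber_apply,
    dNumber_apply, evalEuler_apply, evalEuler_apply]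
  ring

/-- The bracket at a point, for all noncommutative polynomials. -/
def ptBracket (R α β γ : ℝ) (ξ ζ : FreePoly) : ℂ :=
  1 / ((R : ℂ) * (Real.sin β : ℂ)) * (dAlpha R α β γ ξ * dBeta R α β γ ζ -
      dBeta R α β γ ξ * dAlpha R α β γ ζ) +
    1 / (R : ℂ) * (dNumber R α β γ ξ * dGamma R α β γ ζ -
      dGamma R α β γ ξ * dNumber R α β γ ζ) +
    (Real.cos β : ℂ) / ((R : ℂ) * (Real.sin β : ℂ)) * (dBeta R α β γ ξ * dGamma R α β γ ζ -
      dGamma R α β γ ξ * dBeta R α β γ ζ)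

theorem ptBracket_swap (R α β γ : ℝ) (ξ ζ : FreePoly) :
    ptBracket R α β γ ξ ζ = -ptBracket R α β γ ζ ξ := by
  rw [ptBracket, ptBracket]; ring

theorem ptBracket_add_left (R α β γ : ℝ) (ξ ξ' ζ : FreePoly) :
    ptBracket R α β γ (ξ + ξ') ζ = ptBracket R α β γ ξ ζ + ptBracket R α β γ ξ' ζ := by
  simp only [ptBracket, map_add]; ring

theorem ptBracket_smul_left (R α β γ : ℝ) (c : ℂ) (ξ ζ : FreePoly) :
    ptBracket R α β γ (c • ξ) ζ = c * ptBracket R α β γ ξ ζ := by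
  simp only [ptBracket, map_smul, smul_eq_mul]; ring

theorem ptBracket_mul_left (R α β γ : ℝ) (ξ ξ' ζ : FreePoly) :
    ptBracket R α β γ (ξ * ξ') ζ = ptBracket R α β γ ξ ζ * eulerFun R ξ' α β γ +
      eulerFun R ξ α β γ * ptBracket R α β γ ξ' ζ := by
  simp only [ptBracket, isPointDerivation_dAlpha R α β γ ξ ξ',
    isPointDerivation_dBeta R α β γ ξ ξ', isPointDerivation_dGamma R α β γ ξ ξ',
    isPointDerivation_dNumber R α β γ ξ ξ', evalEuler_apply]
  ring

theorem ptBracket_one_left (R α β γ : ℝ) (ζ : FreePoly) : ptBracket R α β γ 1 ζ = 0 := by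
  simp only [ptBracket, (isPointDerivation_dAlpha R α β γ).apply_one,
    (isPointDerivation_dBeta R α β γ).apply_one, (isPointDerivation_dGamma R α β γ).apply_one,
    (isPointDerivation_dNumber R α β γ).apply_one]
  ring

/-- The commutator of two elements of the free algebra is, in every `𝒲(ε)`, the product of `ε` and
an element independent of `ε` whose value on `SU(2)` is `i` times the bracket. -/
def HasBracket (R : ℝ) (ξ ζ : FreePoly) : Prop :=
  ∃ b : FreePoly, (∀ ε : ℝ, toWeyl ε (ξ * ζ - ζ * ξ) = (ε : ℂ) • toWeyl ε b) ∧
    ∀ α β γ : ℝ, Real.sin β ≠ 0 → -Complex.I * eulerFun R b α β γ = ptBracket R α β γ ξ ζ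

theorem HasBracket.symm {R : ℝ} {ξ ζ : FreePoly} (h : HasBracket R ξ ζ) : HasBracket R ζ ξ := by
  obtain ⟨b, h1, h2⟩ := h
  refine ⟨-b, fun ε => ?_, fun α β γ hβ => ?_⟩
  · rw [← neg_sub, map_neg, h1, map_neg, smul_neg]
  · rw [ptBracket_swap, ← h2 α β γ hβ, ← neg_one_smul ℂ b, eulerFun_smul]
    ring

theorem hasBracket_one_left (R : ℝ) (ζ : FreePoly) : HasBracket R 1 ζ := by
  refine ⟨0, fun ε => by simp, fun α β γ _ => ?_⟩
  rw [ptBracket_one_left, ← zero_smul ℂ (1 : FreePoly), eulerFun_smul]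
  ring

theorem HasBracket.add_left {R : ℝ} {ξ ξ' ζ : FreePoly} (h : HasBracket R ξ ζ)
    (h' : HasBracket R ξ' ζ) : HasBracket R (ξ + ξ') ζ := by
  obtain ⟨b, h1, h2⟩ := h
  obtain ⟨b', h1', h2'⟩ := h'
  refine ⟨b + b', fun ε => ?_, fun α β γ hβ => ?_⟩
  · rw [map_add, smul_add, ← h1, ← h1', ← map_add]
    congr 1
    noncomm_ring
  · rw [ptBracket_add_left, ← h2 α β γ hβ, ← h2' α β γ hβ, eulerFun_add]
    ring

theorem HasBracket.smul_left {R : ℝ} {ξ ζ : FreePoly} (c : ℂ) (h : HasBracket R ξ ζ) :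
    HasBracket R (c • ξ) ζ := by
  obtain ⟨b, h1, h2⟩ := h
  refine ⟨c • b, fun ε => ?_, fun α β γ hβ => ?_⟩
  · rw [smul_mul_assoc, mul_smul_comm, ← smul_sub, map_smul, h1, map_smul, smul_comm]
  · rw [ptBracket_smul_left, ← h2 α β γ hβ, eulerFun_smul]
    ring

theorem HasBracket.mul_left {R : ℝ} {ξ ξ' ζ : FreePoly} (h : HasBracket R ξ ζ)
    (h' : HasBracket R ξ' ζ) : HasBracket R (ξ * ξ') ζ := by
  obtain ⟨b, h1, h2⟩ := h
  obtain ⟨b', h1', h2'⟩ := h'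
  refine ⟨b * ξ' + ξ * b', fun ε => ?_, fun α β γ hβ => ?_⟩
  · have e : ξ * ξ' * ζ - ζ * (ξ * ξ') = (ξ * ζ - ζ * ξ) * ξ' + ξ * (ξ' * ζ - ζ * ξ') := by
      noncomm_ring
    rw [e, map_add, map_mul, map_mul, h1, h1', map_add, map_mul, map_mul, smul_add,
      smul_mul_assoc, mul_smul_comm]
  · rw [ptBracket_mul_left, ← h2 α β γ hβ, ← h2' α β γ hβ, eulerFun_add, eulerFun_mul,
      eulerFun_mul]
    ring

/-- The commutators of the generators, divided by `ε`. -/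
def genBracket : Gen → Gen → ℂ
  | .am, .ap => 1
  | .ap, .am => -1
  | .bm, .bp => 1
  | .bp, .bm => -1
  | _, _ => 0

theorem toWeyl_gen_commutator (ε : ℝ) (x y : Gen) :
    toWeyl ε (gen x * gen y - gen y * gen x) =
      (ε : ℂ) • toWeyl ε (genBracket x y • (1 : FreePoly)) := by
  have ha := wgen_am_mul_ap ε
  have hb := wgen_bm_mul_bp ε
  have hab := wgen_comm_ab ε
  simp only [map_sub, map_mul, map_smul, map_one]
  change wgen ε x * wgen ε y - wgen ε y * wgen ε x = _
  cases x <;> cases y <;> simp only [genBracket, zero_smul, smul_zero, sub_self, one_smul]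
  · rw [ha, sub_add_cancel_left]; module
  · rw [hab .ap .bp (by simp) (by simp), sub_self]
  · rw [hab .ap .bm (by simp) (by simp), sub_self]
  · rw [ha]; simp
  · rw [hab .am .bp (by simp) (by simp), sub_self]
  · rw [hab .am .bm (by simp) (by simp), sub_self]
  · rw [hab .ap .bp (by simp) (by simp), sub_self]
  · rw [hab .am .bp (by simp) (by simp), sub_self]
  · rw [hb, sub_add_cancel_left]; module
  · rw [hab .ap .bm (by simp) (by simp), sub_self]
  · rw [hab .am .bm (by simp) (by simp), sub_self]
  · rw [hb]; simp

theorem hasDerivAt_exp_half (c d : ℂ) (x : ℝ) : HasDerivAt (fun x : ℝ => Complex.exp (c * (x + d)))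
    (c * Complex.exp (c * (x + d))) x := by
  have h0 : HasDerivAt (fun x : ℝ => c * ((x : ℂ) + d)) c x := by
    simpa using ((hasDerivAt_id x).ofReal_comp.add_const d).const_mul c
  simpa [mul_comm] using h0.cexp

/-- The weights of the generators with respect to `∂/∂α`. -/
def alphaWeight : Gen → ℂ
  | .ap => -(Complex.I / 2)
  | .am => Complex.I / 2
  | .bp => Complex.I / 2
  | .bm => -(Complex.I / 2)

/-- The weights of the generators with respect to `∂/∂γ`. -/
def gammaWeight : Gen → ℂ
  | .ap => -(Complex.I / 2)
  | .am => Complex.I / 2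
  | .bp => -(Complex.I / 2)
  | .bm => Complex.I / 2

theorem dAlpha_gen (R α β γ : ℝ) (x : Gen) :
    dAlpha R α β γ (gen x) = alphaWeight x * eulerFun R (gen x) α β γ := by
  change deriv (fun t => eulerFun R (gen x) t β γ) α = _
  cases x
  · simp only [eulerFun_gen_ap, alphaWeight]
    rw [((hasDerivAt_exp_half _ (γ : ℂ) α).const_mul _).deriv]
    ring
  · simp only [eulerFun_gen_am, alphaWeight]
    rw [((hasDerivAt_exp_half _ (γ : ℂ) α).const_mul _).deriv]
    ring
  · simp only [eulerFun_gen_bp, alphaWeight, sub_eq_add_neg]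
    rw [((hasDerivAt_exp_half _ (-γ : ℂ) α).const_mul _).deriv]
    ring
  · simp only [eulerFun_gen_bm, alphaWeight, sub_eq_add_neg]
    rw [((hasDerivAt_exp_half _ (-γ : ℂ) α).const_mul _).deriv]
    ring

theorem dGamma_gen (R α β γ : ℝ) (x : Gen) :
    dGamma R α β γ (gen x) = gammaWeight x * eulerFun R (gen x) α β γ := by
  change deriv (fun t => eulerFun R (gen x) α β t) γ = _
  cases x
  · simp only [eulerFun_gen_ap, gammaWeight, add_comm (α : ℂ)]
    rw [((hasDerivAt_exp_half _ (α : ℂ) γ).const_mul _).deriv]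
    ring
  · simp only [eulerFun_gen_am, gammaWeight, add_comm (α : ℂ)]
    rw [((hasDerivAt_exp_half _ (α : ℂ) γ).const_mul _).deriv]
    ring
  · have h : ∀ t : ℂ, Complex.I / 2 * (α - t) = -(Complex.I / 2) * (t + -α) := fun t => by ring
    simp only [eulerFun_gen_bp, gammaWeight, h]
    rw [((hasDerivAt_exp_half _ (-α : ℂ) γ).const_mul _).deriv]
    ring
  · have h : ∀ t : ℂ, -(Complex.I / 2) * (α - t) = Complex.I / 2 * (t + -α) := fun t => by ring
    simp only [eulerFun_gen_bm, gammaWeight, h]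
    rw [((hasDerivAt_exp_half _ (-α : ℂ) γ).const_mul _).deriv]
    ring

theorem dNumber_gen (R α β γ : ℝ) (x : Gen) :
    dNumber R α β γ (gen x) = 1 / 2 * eulerFun R (gen x) α β γ := by
  rw [dNumber_apply, gen, degOp_word]
  simp

/-- The values of `∂/∂β` on the generators. -/
def betaDeriv (R α β γ : ℝ) : Gen → ℂ
  | .ap => (Real.sqrt (2 * R) : ℂ) * (-(1 / 2) * (Real.sin (β / 2) : ℂ)) *
      Complex.exp (-(Complex.I / 2) * (α + γ))
  | .am => (Real.sqrt (2 * R) : ℂ) * (-(1 / 2) * (Real.sin (β / 2) : ℂ)) *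
      Complex.exp ((Complex.I / 2) * (α + γ))
  | .bp => -Complex.I * (Real.sqrt (2 * R) : ℂ) * (1 / 2 * (Real.cos (β / 2) : ℂ)) *
      Complex.exp ((Complex.I / 2) * (α - γ))
  | .bm => Complex.I * (Real.sqrt (2 * R) : ℂ) * (1 / 2 * (Real.cos (β / 2) : ℂ)) *
      Complex.exp (-(Complex.I / 2) * (α - γ))

theorem dBeta_gen (R α β γ : ℝ) (x : Gen) :
    dBeta R α β γ (gen x) = betaDeriv R α β γ x := by
  change deriv (fun t => eulerFun R (gen x) α t γ) β = _
  cases x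
  · simp only [eulerFun_gen_ap, betaDeriv]
    exact (((hasDerivAt_cos_half β).const_mul _).mul_const _).deriv
  · simp only [eulerFun_gen_am, betaDeriv]
    exact (((hasDerivAt_cos_half β).const_mul _).mul_const _).deriv
  · simp only [eulerFun_gen_bp, betaDeriv]
    exact (((hasDerivAt_sin_half β).const_mul _).mul_const _).deriv
  · simp only [eulerFun_gen_bm, betaDeriv]
    exact (((hasDerivAt_sin_half β).const_mul _).mul_const _).deriv

theorem ptBracket_gen {R : ℝ} (hR : 0 < R) (α β γ : ℝ) (hβ : Real.sin β ≠ 0) (x y : Gen) :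
    -Complex.I * genBracket x y = ptBracket R α β γ (gen x) (gen y) := by
  have hR' : (R : ℂ) ≠ 0 := by exact_mod_cast hR.ne'
  have hβ' : (Real.sin β : ℂ) ≠ 0 := by exact_mod_cast hβ
  have hs : (Real.sin β : ℂ) = 2 * (Real.sin (β / 2) : ℂ) * (Real.cos (β / 2) : ℂ) := by
    have := Real.sin_two_mul (β / 2)
    rw [mul_div_cancel₀ _ two_ne_zero] at this
    exact_mod_cast this
  have hc : (Real.cos β : ℂ) = (Real.cos (β / 2) : ℂ) ^ 2 - (Real.sin (β / 2) : ℂ) ^ 2 := by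
    have := Real.cos_two_mul' (β / 2)
    rw [mul_div_cancel₀ _ two_ne_zero] at this
    exact_mod_cast this
  have hcs : (Real.cos (β / 2) : ℂ) ^ 2 + (Real.sin (β / 2) : ℂ) ^ 2 = 1 := by
    exact_mod_cast Real.cos_sq_add_sin_sq (β / 2)
  have hE : Complex.exp (-(Complex.I / 2) * (α + γ)) * Complex.exp (Complex.I / 2 * (α + γ)) =
      1 := by
    rw [← Complex.exp_add, ← Complex.exp_zero]; congr 1; ring
  have hG : Complex.exp (-(Complex.I / 2) * (α - γ)) * Complex.exp (Complex.I / 2 * (α - γ)) =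
      1 := by
    rw [← Complex.exp_add, ← Complex.exp_zero]; congr 1; ring
  have hS := ofReal_sqrt_two_mul_sq hR
  -- Everything is put over the denominator R sin β, and cos²(β/2) + sin²(β/2) = 1 is inserted so
  -- that the numerator is a homogeneous form in the half-angle functions.
  have key : ptBracket R α β γ (gen x) (gen y) = ((Real.cos (β / 2) : ℂ) ^ 2 +
      (Real.sin (β / 2) : ℂ) ^ 2) * (dAlpha R α β γ (gen x) * dBeta R α β γ (gen y) -
        dBeta R α β γ (gen x) * dAlpha R α β γ (gen y)) / (R * (Real.sin β : ℂ)) +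
      (2 * (Real.sin (β / 2) : ℂ) * (Real.cos (β / 2) : ℂ) *
        (dNumber R α β γ (gen x) * dGamma R α β γ (gen y) -
          dGamma R α β γ (gen x) * dNumber R α β γ (gen y)) +
      ((Real.cos (β / 2) : ℂ) ^ 2 - (Real.sin (β / 2) : ℂ) ^ 2) *
        (dBeta R α β γ (gen x) * dGamma R α β γ (gen y) -
          dGamma R α β γ (gen x) * dBeta R α β γ (gen y))) / (R * (Real.sin β : ℂ)) := by
    rw [ptBracket, hcs, ← hc, ← hs]
    field_simp
    ring
  rw [key, ← add_div, eq_div_iff (mul_ne_zero hR' hβ'), hs]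
  simp only [dAlpha_gen, dBeta_gen, dGamma_gen, dNumber_gen]
  generalize hX : (Real.cos (β / 2) : ℂ) = c at *
  generalize hY : (Real.sin (β / 2) : ℂ) = s at *
  -- Homogenizes 2R in the same way, so that the remaining identities need only the products of
  -- opposite exponentials and i² = -1.
  have h4 : (2 * R : ℂ) = (Real.sqrt (2 * R) : ℂ) ^ 2 * (c ^ 2 + s ^ 2) := by
    rw [hcs, mul_one, hS]
  cases x <;> cases y <;>
    simp only [genBracket, alphaWeight, gammaWeight, betaDeriv, eulerFun_gen_ap,
      eulerFun_gen_am, eulerFun_gen_bp, eulerFun_gen_bm, hX, hY, mul_zero, zero_mul]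
  · ring
  · linear_combination (Complex.I * s * c) * h4 -
      Complex.I * (Real.sqrt (2 * R) : ℂ) ^ 2 * c * s * (c ^ 2 + s ^ 2) * hE
  · ring
  · ring
  · linear_combination (-Complex.I * s * c) * h4 +
      Complex.I * (Real.sqrt (2 * R) : ℂ) ^ 2 * c * s * (c ^ 2 + s ^ 2) * hE
  · ring
  · ring
  · ring
  · ring
  · ring
  · ring
  · linear_combination (Complex.I * s * c) * h4 -
      Complex.I * (Real.sqrt (2 * R) : ℂ) ^ 2 * c * s * (c ^ 2 + s ^ 2) * hG +
      Complex.I * (Real.sqrt (2 * R) : ℂ) ^ 2 * c * s * (c ^ 2 + s ^ 2) *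
        (Complex.exp (-(Complex.I / 2) * (α - γ)) * Complex.exp (Complex.I / 2 * (α - γ))) *
        Complex.I_sq
  · ring
  · ring
  · linear_combination (-Complex.I * s * c) * h4 +
      Complex.I * (Real.sqrt (2 * R) : ℂ) ^ 2 * c * s * (c ^ 2 + s ^ 2) * hG -
      Complex.I * (Real.sqrt (2 * R) : ℂ) ^ 2 * c * s * (c ^ 2 + s ^ 2) *
        (Complex.exp (-(Complex.I / 2) * (α - γ)) * Complex.exp (Complex.I / 2 * (α - γ))) *
        Complex.I_sq
  · ring

theorem hasBracket_gen {R : ℝ} (hR : 0 < R) (x y : Gen) : HasBracket R (gen x) (gen y) := by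
  refine ⟨genBracket x y • 1, fun ε => toWeyl_gen_commutator ε x y, fun α β γ hβ => ?_⟩
  rw [eulerFun_smul, eulerFun_one, mul_one, ptBracket_gen hR α β γ hβ]

/-- Commutator and pointwise bracket are both antisymmetric and derivations in each argument, so the
property passes from generators to all polynomials, one argument at a time. -/
theorem hasBracket {R : ℝ} (hR : 0 < R) (ξ ζ : FreePoly) : HasBracket R ξ ζ := by
  have hgen : ∀ x, HasBracket R (gen x) ζ := by
    intro x
    refine HasBracket.symm ?_
    induction ζ using gen_induction with
    | h1 => exact hasBracket_one_left R _
    | hgen y ζ ih => exact (hasBracket_gen hR y x).mul_left ih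
    | hadd ζ ζ' h1 h2 => exact h1.add_left h2
    | hsmul c ζ h => exact h.smul_left c
  induction ξ using gen_induction with
  | h1 => exact hasBracket_one_left R _
  | hgen y ξ ih => exact (hgen y).mul_left ih
  | hadd ξ ξ' h1 h2 => exact h1.add_left h2
  | hsmul c ξ h => exact h.smul_left c

theorem PsiTendsto.congr_punctured {F G : ℝ → Psi} {η : Psi} (h : PsiTendsto F (𝓝 0) η)
    (hFG : ∀ ε ≠ 0, F ε = G ε) : PsiTendsto G (𝓝[≠] 0) η := by
  have he : F =ᶠ[𝓝[≠] 0] G := by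
    filter_upwards [self_mem_nhdsWithin] with ε hε using hFG ε hε
  obtain ⟨⟨d, hd⟩, h2⟩ := h
  refine ⟨⟨d, ?_⟩, fun u => ?_⟩
  · filter_upwards [he, hd.filter_mono nhdsWithin_le_nhds] with ε h1 h3 u hu
    rw [← h1]
    exact h3 u hu
  · refine ((h2 u).mono_left nhdsWithin_le_nhds).congr' ?_
    filter_upwards [he] with ε h1
    rw [h1]

theorem exists_bracket {R : ℝ} (hR : 0 < R) (ξ ζ : Psi) : ∃ η : Psi,
    PsiTendsto (fun ε => (1 / (Complex.I * (ε : ℂ))) •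
      rho ε R (toWeyl ε ξ * toWeyl ε ζ - toWeyl ε ζ * toWeyl ε ξ)) (𝓝[≠] 0) η ∧
    ∀ α β γ : ℝ, Real.sin β ≠ 0 → eulerFun R η α β γ = ptBracket R α β γ ξ ζ := by
  obtain ⟨b, h1, h2⟩ := hasBracket hR (ξ : FreePoly) (ζ : FreePoly)
  -- The quotient by iε equals -i times the reduction of the ε-independent `b` for ε ≠ 0. That
  -- family is continuous at 0, so its value there is the limit.
  refine ⟨(-Complex.I) • reduce 0 R (freeRep 0 b 1), ?_, fun α β γ hβ => ?_⟩
  · refine PsiTendsto.congr_punctured (F := fun ε => (-Complex.I) • reduce ε R (freeRep ε b 1))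
      (psiTendsto_of_mem_contFamily ((contFamily Psi).smul_mem (-Complex.I)
        (reduce_family_mem R (freeRep_mem_contFamily b 1)))) fun ε hε => ?_
    have hε' : (ε : ℂ) ≠ 0 := by exact_mod_cast hε
    rw [← map_mul, ← map_mul, ← map_sub, h1, rho_eq_reduce, map_smul, map_smul, smul_smul,
      symbol_apply, weylRep_toWeyl]
    congr 1
    field_simp
    simp
  · rw [← h2 α β γ hβ, Submodule.coe_smul, eulerFun_smul, eulerFun_eq_evalPt,
      evalPt_comm_reduce hR, freeRep_zero, mul_one, ← eulerFun_eq_evalPt]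

/-! ### The leading elements -/

theorem map_word_of_commute {A : Type*} [Semiring A] [Algebra ℂ A] (φ : FreePoly →ₐ[ℂ] A)
    (h : Commute (φ (gen .ap)) (φ (gen .bm))) {l : List Gen} (hl : ∀ g ∈ l, g = .ap ∨ g = .bm) :
    φ (word l) = φ (gen .ap) ^ l.count .ap * φ (gen .bm) ^ l.count .bm := by
  induction l with
  | nil => simp [word_nil]
  | cons g l ih =>
    rw [word_cons, map_mul, ih fun x hx => hl x (List.mem_cons_of_mem _ hx)]
    rcases hl g List.mem_cons_self with rfl | rfl
    · rw [List.count_cons_self, List.count_cons_of_ne (by decide), pow_succ', mul_assoc]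
    · rw [List.count_cons_self, List.count_cons_of_ne (by decide), pow_succ', ← mul_assoc,
        ← mul_assoc, (h.pow_left _).eq]

theorem count_ofFn {n : ℕ} (f : Fin n → Gen) (g : Gen) :
    (List.ofFn f).count g = (Finset.univ.filter fun k => f k = g).card := by
  induction n with
  | zero => simp
  | succ n ih =>
    rw [List.ofFn_succ, List.count_cons, ih, Fin.univ_succ, Finset.filter_cons]
    split_ifs with h1 h2 h2 <;> simp_all [Finset.filter_map]

/-- The letter `a₊` at the positions in `s`, and `b₋` elsewhere. -/
def topWord {n : ℕ} (s : Finset (Fin n)) : List Gen :=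
  List.ofFn fun k => if k ∈ s then Gen.ap else Gen.bm

theorem mem_topWord {n : ℕ} (s : Finset (Fin n)) : ∀ g ∈ topWord s, g = .ap ∨ g = .bm := by
  intro g hg
  rw [topWord, List.mem_ofFn] at hg
  obtain ⟨k, rfl⟩ := hg
  split_ifs <;> simp

theorem count_topWord_ap {n : ℕ} (s : Finset (Fin n)) : (topWord s).count .ap = s.card := by
  rw [topWord, count_ofFn]
  congr 1
  ext k
  simp

theorem count_topWord_bm {n : ℕ} (s : Finset (Fin n)) : (topWord s).count .bm = n - s.card := by
  have hc := Finset.card_compl s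
  rw [Fintype.card_fin] at hc
  rw [topWord, count_ofFn, ← hc]
  congr 1
  ext k
  simp

theorem topWord_injective {n : ℕ} : Function.Injective (topWord (n := n)) := by
  intro s t h
  ext k
  have := congrFun (List.ofFn_injective h) k
  by_cases h1 : k ∈ s <;> by_cases h2 : k ∈ t <;> simp_all

theorem exists_topWord_eq {n : ℕ} {l : List Gen} (hl : ∀ g ∈ l, g = .ap ∨ g = .bm)
    (hn : l.length = n) : ∃ s : Finset (Fin n), topWord s = l := by
  subst hn
  refine ⟨Finset.univ.filter fun k => l.get k = .ap, ?_⟩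
  conv_rhs => rw [← List.ofFn_get l]
  rw [topWord]
  congr 1
  funext k
  rcases hl (l.get k) (List.get_mem _ _) with h | h
  · have hk : k ∈ Finset.univ.filter fun k => l.get k = Gen.ap :=
      Finset.mem_filter.2 ⟨Finset.mem_univ _, h⟩
    rw [if_pos hk, h]
  · rw [if_neg (fun hk => by rw [Finset.mem_filter, h] at hk; exact absurd hk.2 (by decide)), h]

theorem topMonomial_eq (x y : ℕ) : topMonomial x y = (((x + y).choose x : ℂ)⁻¹) •
    ∑ s ∈ Finset.powersetCard x (Finset.univ : Finset (Fin (x + y))), word (topWord s) := rfl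

theorem wordCoeff_topMonomial (x y : ℕ) (l : List Gen) : wordCoeff (topMonomial x y) l =
    if (∀ g ∈ l, g = .ap ∨ g = .bm) ∧ l.length = x + y ∧ l.count .ap = x
    then ((x + y).choose x : ℂ)⁻¹ else 0 := by
  rw [topMonomial_eq, wordCoeff_smul, wordCoeff_sum]
  simp only [wordCoeff_word]
  split_ifs with h
  · obtain ⟨s, rfl⟩ := exists_topWord_eq h.1 h.2.1
    rw [count_topWord_ap] at h
    rw [Finset.sum_eq_single s, if_pos rfl, mul_one]
    · intro t _ hts
      rw [if_neg fun e => hts (topWord_injective e)]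
    · intro hs
      exact absurd (Finset.mem_powersetCard.2 ⟨Finset.subset_univ _, h.2.2⟩) hs
  · rw [Finset.sum_eq_zero, mul_zero]
    intro s hs
    rw [if_neg]
    rintro rfl
    refine h ⟨mem_topWord s, by simp [topWord], ?_⟩
    rw [count_topWord_ap, (Finset.mem_powersetCard.1 hs).2]

theorem isSymm_topMonomial (x y : ℕ) : IsSymm (topMonomial x y) := by
  intro u v h
  rw [wordCoeff_topMonomial, wordCoeff_topMonomial, h.length_eq, h.count_eq]
  simp only [h.mem_iff]

theorem map_topMonomial {A : Type*} [Semiring A] [Algebra ℂ A] (φ : FreePoly →ₐ[ℂ] A)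
    (h : Commute (φ (gen .ap)) (φ (gen .bm))) (x y : ℕ) :
    φ (topMonomial x y) = φ (gen .ap) ^ x * φ (gen .bm) ^ y := by
  rw [topMonomial_eq, map_smul, map_sum, Finset.sum_congr rfl (g := fun _ =>
    φ (gen .ap) ^ x * φ (gen .bm) ^ y), Finset.sum_const, Finset.card_powersetCard,
    Finset.card_univ, Fintype.card_fin, ← Nat.cast_smul_eq_nsmul ℂ, smul_smul, inv_mul_cancel₀,
    one_smul]
  · exact_mod_cast (Nat.choose_pos (Nat.le_add_right _ _)).ne'
  · intro s hs
    have hs := (Finset.mem_powersetCard.1 hs).2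
    rw [map_word_of_commute φ h (mem_topWord s), count_topWord_ap, count_topWord_bm, hs,
      Nat.add_sub_cancel_left]

theorem comm_topMonomial (x y : ℕ) : comm (topMonomial x y) = X .ap ^ x * X .bm ^ y := by
  rw [map_topMonomial comm (Commute.all _ _), comm_gen, comm_gen]

/-- The commutative image a₊ˣ b₋ʸ contains neither a₋ nor b₊, so each second derivative in the
Laplacian vanishes. -/
theorem topMonomial_mem_Psi (x y : ℕ) : topMonomial x y ∈ Psi := by
  rw [mem_Psi_iff, comm_topMonomial, lap_apply]
  refine ⟨isSymm_topMonomial x y, ?_⟩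
  simp [pderiv_X]

/-! ### The lowering operator -/

theorem lower_eq_wordLift (ξ : FreePoly) : lower ξ = wordLift lowerWord ξ := rfl

theorem lower_word (l : List Gen) : lower (word l) = lowerWord l := by
  rw [lower_eq_wordLift, wordLift_word]

theorem lower_add (ξ ζ : FreePoly) : lower (ξ + ζ) = lower ξ + lower ζ := by
  simp only [lower_eq_wordLift, map_add]

theorem lower_smul (c : ℂ) (ξ : FreePoly) : lower (c • ξ) = c • lower ξ := by
  simp only [lower_eq_wordLift, map_smul]

/-- A derivation that is a multiple of `lower` on generators is so everywhere. -/
theorem smul_map_lower {A : Type*} [Ring A] [Algebra ℂ A] (φ : FreePoly →ₐ[ℂ] A) (c : ℂ)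
    (D : A →ₗ[ℂ] A) (hD : ∀ a b, D (a * b) = D a * b + a * D b)
    (hgen : ∀ g, D (φ (gen g)) = c • φ (lowerGen g)) (ξ : FreePoly) :
    D (φ ξ) = c • φ (lower ξ) := by
  induction ξ using word_induction with
  | h l =>
    rw [lower_word]
    induction l with
    | nil =>
      have h1 := hD 1 1
      simp only [mul_one, one_mul, left_eq_add] at h1
      rw [word_nil, map_one, h1, lowerWord, map_zero, smul_zero]
    | cons g l ih =>
      rw [word_cons, map_mul, hD, hgen, ih, lowerWord, map_add, map_mul, map_mul, smul_add,
        smul_mul_assoc, mul_smul_comm]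
  | hadd a b ha hb => rw [map_add, map_add, ha, hb, lower_add, map_add, smul_add]
  | hsmul r a ha => rw [map_smul, map_smul, ha, lower_smul, map_smul, smul_comm]

/-- The difference of `strip g ∘ lower` and `lower ∘ strip g`. -/
def stripLower : Gen → FreePoly →ₗ[ℂ] FreePoly
  | .ap => 0
  | .am => -strip .bm
  | .bp => strip .ap
  | .bm => 0

theorem strip_gen_mul (g h : Gen) (ξ : FreePoly) :
    strip g (gen h * ξ) = if h = g then ξ else 0 := by
  apply freePoly_ext
  intro l
  rw [wordCoeff_strip, wordCoeff_gen_mul_cons]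
  split_ifs <;> rfl

/-- The extra term comes from words whose first letter is itself lowered: b₊ can only arise from a₊,
and a₋ only from b₋, with a minus sign. -/
theorem strip_lower (g : Gen) (ξ : FreePoly) :
    strip g (lower ξ) = lower (strip g ξ) + stripLower g ξ := by
  have h : strip g ∘ₗ wordLift lowerWord = wordLift lowerWord ∘ₗ strip g + stripLower g := by
    refine linearMap_ext_word fun l => ?_
    simp only [LinearMap.comp_apply, LinearMap.add_apply, wordLift_word]
    cases l with
    | nil =>
      cases g <;> simp [lowerWord, strip, stripLower]
    | cons x l =>
      rw [lowerWord, word_cons, map_add, strip_gen_mul, strip_gen_mul]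
      cases g <;> cases x <;>
        simp [lowerGen, stripLower, strip_gen_mul]
  exact LinearMap.congr_fun h ξ

theorem IsSymm.strip_comm {ξ : FreePoly} (h : IsSymm ξ) (x y : Gen) :
    FuzzySU2.strip x (FuzzySU2.strip y ξ) = FuzzySU2.strip y (FuzzySU2.strip x ξ) := by
  apply freePoly_ext
  intro l
  simp only [wordCoeff_strip]
  exact h _ _ (List.Perm.swap _ _ _)

theorem IsSymm.lower {ξ : FreePoly} (h : IsSymm ξ) : IsSymm (lower ξ) := by
  have key : ∀ u v : List Gen, u.Perm v → ∀ ξ, IsSymm ξ →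
      wordCoeff (FuzzySU2.lower ξ) u = wordCoeff (FuzzySU2.lower ξ) v := by
    intro u v huv
    induction huv with
    | nil => intros; rfl
    | cons x hp ih =>
      rename_i u v
      intro ξ hξ
      rw [← wordCoeff_strip, ← wordCoeff_strip, strip_lower, wordCoeff_add, wordCoeff_add,
        ih _ (hξ.strip x)]
      congr 1
      cases x
      · rfl
      · simp only [stripLower, LinearMap.neg_apply, wordCoeff_neg]
        rw [hξ.strip _ u v hp]
      · exact hξ.strip _ u v hp
      · rfl
    -- After both letters are removed, the terms containing `lower` agree because ξ is symmetric;
    -- what is left are coefficients of ξ itself, compared letter by letter.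
    | swap x y l =>
      intro ξ hξ
      rw [← wordCoeff_strip, ← wordCoeff_strip, ← wordCoeff_strip, ← wordCoeff_strip]
      simp only [strip_lower, map_add, hξ.strip_comm x y, wordCoeff_add]
      have hs : ∀ a b : Gen, wordCoeff ξ (a :: b :: l) = wordCoeff ξ (b :: a :: l) := fun a b =>
        hξ _ _ (List.Perm.swap _ _ _)
      cases x <;> cases y <;>
        simp only [stripLower, LinearMap.zero_apply, LinearMap.neg_apply, map_zero, map_neg,
          wordCoeff_neg, wordCoeff_zero, wordCoeff_strip, hs .am .ap, hs .bp .ap, hs .bm .ap,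
          hs .bm .am, hs .bm .bp] <;>
        ring
    | trans _ _ h1 h2 => intro ξ hξ; rw [h1 ξ hξ, h2 ξ hξ]
  exact fun u v huv => key u v huv ξ h

/-- The derivation `b₊ ∂/∂a₊ - a₋ ∂/∂b₋`. -/
def lowerD : Derivation ℂ CPoly CPoly := mkDerivation ℂ fun g => comm (lowerGen g)

theorem lowerD_X (g : Gen) : lowerD (X g) = comm (lowerGen g) := mkDerivation_X _ _ _

theorem comm_lower (ξ : FreePoly) : comm (lower ξ) = lowerD (comm ξ) := by
  rw [← one_smul ℂ (comm (lower ξ))]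
  symm
  refine smul_map_lower comm 1 (lowerD : CPoly →ₗ[ℂ] CPoly) (fun a b => ?_) (fun g => ?_) ξ
  · simp only [Derivation.coeFn_coe, Derivation.leibniz, smul_eq_mul]
    ring
  · rw [comm_gen, Derivation.coeFn_coe, lowerD_X, one_smul]

theorem lowerD_apply (f : CPoly) : lowerD f = X .bp * pderiv .ap f - X .am * pderiv .bm f := by
  have h : lowerD = (X .bp : CPoly) • pderiv (R := ℂ) Gen.ap - (X .am : CPoly) • pderiv Gen.bm := by
    apply MvPolynomial.derivation_ext
    intro g
    rw [lowerD_X]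
    cases g <;> simp [lowerGen, comm_gen, pderiv_X]
  rw [h]
  rfl

/-- The commutators with ∂/∂a₋ and ∂/∂b₊ are -∂/∂b₋ and ∂/∂a₊, so the two contributions -∂²/∂a₊∂b₋
and ∂²/∂a₊∂b₋ cancel. -/
theorem lap_lowerD (f : CPoly) : lap (lowerD f) = lowerD (lap f) := by
  simp only [lap_apply, lowerD_apply, map_sub, map_add, pderiv_mul, pderiv_X_gen]
  simp only [pderiv_pderiv_comm .am .ap, pderiv_pderiv_comm .bm .ap, pderiv_pderiv_comm .bp .ap,
    pderiv_pderiv_comm .bm .am, pderiv_pderiv_comm .bm .bp]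
  simp
  ring

theorem lower_mem_Psi {ξ : FreePoly} (h : ξ ∈ Psi) : lower ξ ∈ Psi := by
  rw [mem_Psi_iff] at h ⊢
  exact ⟨h.1.lower, by rw [comm_lower, lap_lowerD, h.2, map_zero]⟩

theorem lower_iterate_mem_Psi {ξ : FreePoly} (h : ξ ∈ Psi) (k : ℕ) : lower^[k] ξ ∈ Psi := by
  induction k with
  | zero => exact h
  | succ k ih => rw [Function.iterate_succ_apply']; exact lower_mem_Psi ih

theorem basisElt_mem_Psi (N i j : ℕ) : basisElt N i j ∈ Psi :=
  Psi.smul_mem _ (lower_iterate_mem_Psi (topMonomial_mem_Psi _ _) _)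

/-- The commutator with J₋ is a derivation, so only the four letters have to be checked. -/
theorem smul_toWeyl_lower (ε : ℝ) (ξ : FreePoly) :
    Jminus ε * toWeyl ε ξ - toWeyl ε ξ * Jminus ε = (ε : ℂ) • toWeyl ε (lower ξ) := by
  have hJ : Jminus ε = wgen ε .am * wgen ε .bp := map_mul _ _ _
  have hab := wgen_comm_ab ε
  have h1 := hab .ap .bp (by simp) (by simp)
  have h2 := hab .am .bp (by simp) (by simp)
  have h3 := hab .am .bm (by simp) (by simp)
  refine smul_map_lower (toWeyl ε) ε (LinearMap.mulLeft ℂ (Jminus ε) -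
    LinearMap.mulRight ℂ (Jminus ε)) (fun a b => ?_) (fun g => ?_) ξ
  · simp only [LinearMap.sub_apply, LinearMap.mulLeft_apply, LinearMap.mulRight_apply]
    simp only [mul_sub, sub_mul, mul_assoc]
    abel
  · simp only [LinearMap.sub_apply, LinearMap.mulLeft_apply, LinearMap.mulRight_apply, hJ]
    change wgen ε .am * wgen ε .bp * wgen ε g - wgen ε g * (wgen ε .am * wgen ε .bp) = _
    cases g
    · change _ = (ε : ℂ) • wgen ε .bp
      rw [mul_assoc, ← h1.eq, ← mul_assoc, wgen_am_mul_ap, ← mul_assoc, add_mul, smul_mul_assoc,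
        one_mul, add_sub_cancel_left]
    · simp only [lowerGen, map_zero, smul_zero]
      rw [mul_assoc, h2.eq, sub_self]
    · simp only [lowerGen, map_zero, smul_zero]
      rw [← mul_assoc, h2.eq, sub_self]
    · simp only [lowerGen, map_neg, smul_neg]
      change _ = -((ε : ℂ) • wgen ε .am)
      rw [← mul_assoc, ← h3.eq, mul_assoc, mul_assoc, wgen_bm_mul_bp, mul_add, mul_smul_comm,
        mul_one, sub_add_cancel_left]

theorem toWeyl_lower_iterate (ε : ℝ) (ξ : FreePoly) (k : ℕ) :
    (fun w : Weyl ε => Jminus ε * w - w * Jminus ε)^[k] (toWeyl ε ξ) =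
      (ε : ℂ) ^ k • toWeyl ε (lower^[k] ξ) := by
  induction k with
  | zero => simp
  | succ k ih =>
    rw [Function.iterate_succ_apply', Function.iterate_succ_apply', ih]
    rw [pow_succ, mul_smul, ← smul_toWeyl_lower, smul_sub, mul_smul_comm, smul_mul_assoc]

theorem toWeyl_basisElt {ε : ℝ} (hε : ε ≠ 0) (N i j : ℕ) : toWeyl ε (basisElt N i j) =
    (((ε : ℂ) ^ (-((N - j : ℕ) : ℤ))) * (basisNorm N j : ℂ)) •
      (fun w : Weyl ε => Jminus ε * w - w * Jminus ε)^[N - j]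
        (toWeyl ε (gen .ap) ^ i * toWeyl ε (gen .bm) ^ (N - i)) := by
  have hε' : (ε : ℂ) ≠ 0 := by exact_mod_cast hε
  rw [← map_topMonomial (toWeyl ε) (wgen_comm_ab ε .ap .bm (by simp) (by simp)),
    toWeyl_lower_iterate, smul_smul, basisElt, map_smul]
  congr 1
  rw [zpow_neg, zpow_natCast]
  field_simp

/-! ### Explicit form of the basis elements -/

theorem derivation_iterate_mul {A : Type*} [CommRing A] [Algebra ℂ A] (D : Derivation ℂ A A)
    (n : ℕ) (a b : A) : D^[n] (a * b) =
      ∑ st ∈ Finset.HasAntidiagonal.antidiagonal n, (n.choose st.1 : A) * (D^[st.1] a * D^[st.2] b) := by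
  induction n with
  | zero => simp
  | succ n ih =>
    rw [Finset.sum_antidiagonal_choose_succ_mul (fun s t => D^[s] a * D^[t] b) n,
      Function.iterate_succ_apply', ih, map_sum, ← Finset.sum_add_distrib]
    refine Finset.sum_congr rfl fun st hst => ?_
    have hc : n.choose st.2 = n.choose st.1 := by
      rw [← Finset.HasAntidiagonal.mem_antidiagonal.1 hst, ← Nat.choose_symm_add]
    rw [hc, Derivation.leibniz, Derivation.leibniz, Derivation.map_natCast,
      Function.iterate_succ_apply', Function.iterate_succ_apply']
    simp only [smul_eq_mul, mul_zero, add_zero]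
    ring

/-- As D²x = 0, applying D repeatedly to xⁿ only replaces factors x by u. For k > n the descending
factorial vanishes, so the truncated exponent does not matter. -/
theorem derivation_iterate_pow {A : Type*} [CommRing A] [Algebra ℂ A] (D : Derivation ℂ A A)
    {x u : A} (hx : D x = u) (hu : D u = 0) (n k : ℕ) :
    D^[k] (x ^ n) = (n.descFactorial k : A) * (x ^ (n - k) * u ^ k) := by
  induction k with
  | zero => simp
  | succ k ih =>
    rw [Function.iterate_succ_apply', ih, Nat.descFactorial_succ]
    simp only [Derivation.leibniz, Derivation.leibniz_pow, hx, hu, Derivation.map_natCast,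
      smul_eq_mul, nsmul_eq_mul]
    rw [Nat.sub_sub]
    push_cast
    ring

theorem comm_lower_iterate (ξ : FreePoly) (k : ℕ) :
    comm (lower^[k] ξ) = lowerD^[k] (comm ξ) := by
  induction k with
  | zero => rfl
  | succ k ih => rw [Function.iterate_succ_apply', Function.iterate_succ_apply', comm_lower, ih]

theorem comm_basisElt (N i j : ℕ) : comm (basisElt N i j) = (basisNorm N j : ℂ) •
    ∑ st ∈ Finset.HasAntidiagonal.antidiagonal (N - j), ((N - j).choose st.1 : CPoly) *
      (((i.descFactorial st.1 : CPoly) * (X .ap ^ (i - st.1) * X .bp ^ st.1)) *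
        (((N - i).descFactorial st.2 : CPoly) * (X .bm ^ (N - i - st.2) * (-X .am) ^ st.2))) := by
  rw [basisElt, map_smul, comm_lower_iterate, comm_topMonomial, derivation_iterate_mul]
  refine congrArg _ (Finset.sum_congr rfl fun st _ => ?_)
  rw [derivation_iterate_pow lowerD (u := X .bp), derivation_iterate_pow lowerD (u := -X .am)] <;>
    simp only [lowerD_X, lowerGen, comm_gen, map_zero, map_neg, neg_zero]

/-! ### Rotation matrices -/

/-- The parameters are the exponents of the monomial a₊ᵃ b₊ˢ b₋ᵘ a₋ᵗ in P(n,r,m), so that N = a + s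
+ u + t, n + r = a + s, n + m = a + u. All truncated subtractions disappear in these variables. -/
theorem basisNorm_mul (a s u t : ℕ) : basisNorm (a + s + u + t) (a + u) *
    ((s + t).choose s * ((a + s).descFactorial s * (u + t).descFactorial t)) =
    Real.sqrt (((a + u).factorial : ℝ) * ((s + t).factorial : ℝ) * ((a + s).factorial : ℝ) *
      ((u + t).factorial : ℝ)) / Real.sqrt ((a + s + u + t).choose (a + s)) /
      ((a.factorial : ℝ) * (s.factorial : ℝ) * (u.factorial : ℝ) * (t.factorial : ℝ)) := by
  have hf : ∀ n : ℕ, (0 : ℝ) < n.factorial := fun n => by exact_mod_cast n.factorial_pos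
  have h1 : ((s + t).choose s : ℝ) = (s + t).factorial / (s.factorial * t.factorial) :=
    Nat.cast_add_choose ℝ
  have h2 : ((a + s).descFactorial s : ℝ) = (a + s).factorial / a.factorial := by
    rw [eq_div_iff (hf a).ne', mul_comm]
    have := Nat.factorial_mul_descFactorial (Nat.le_add_left s a)
    rw [Nat.add_sub_cancel] at this
    exact_mod_cast this
  have h3 : ((u + t).descFactorial t : ℝ) = (u + t).factorial / u.factorial := by
    rw [eq_div_iff (hf u).ne', mul_comm]
    have := Nat.factorial_mul_descFactorial (Nat.le_add_left t u)
    rw [Nat.add_sub_cancel] at this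
    exact_mod_cast this
  have h4 : ((a + s + u + t).choose (a + s) : ℝ) =
      (a + s + u + t).factorial / ((a + s).factorial * (u + t).factorial) := by
    rw [add_assoc (a + s)]
    exact Nat.cast_add_choose ℝ
  have h5 : a + s + u + t - (a + u) = s + t := by omega
  rw [basisNorm, h1, h2, h3, h4, h5]
  have e1 := hf (a + u)
  have e2 := hf (s + t)
  have e3 := hf (a + s)
  have e4 := hf (u + t)
  have e5 := hf (a + s + u + t)
  have e6 := hf a
  have e7 := hf s
  have e8 := hf u
  have e9 := hf t
  generalize ((a + u).factorial : ℝ) = x1 at *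
  generalize ((s + t).factorial : ℝ) = x2 at *
  generalize ((a + s).factorial : ℝ) = x3 at *
  generalize ((u + t).factorial : ℝ) = x4 at *
  generalize ((a + s + u + t).factorial : ℝ) = x5 at *
  have key : Real.sqrt (x1 * x2 * x3 * x4) / Real.sqrt (x5 / (x3 * x4)) =
      Real.sqrt (x1 / (x5 * x2)) * (x2 * x3 * x4) := by
    rw [← Real.sqrt_div (by positivity), ← Real.sqrt_sq (show 0 ≤ x2 * x3 * x4 by positivity),
      ← Real.sqrt_mul (by positivity)]
    congr 1
    field_simp
  rw [key]
  field_simp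

theorem monomial_phase (a s u t : ℕ) (q c σ : ℂ) (α γ : ℝ) :
    (q * c * Complex.exp (-(Complex.I / 2) * (α + γ))) ^ a *
      (-Complex.I * q * σ * Complex.exp ((Complex.I / 2) * (α - γ))) ^ s *
      ((Complex.I * q * σ * Complex.exp (-(Complex.I / 2) * (α - γ))) ^ u *
      (-(q * c * Complex.exp ((Complex.I / 2) * (α + γ)))) ^ t) =
    Complex.I ^ ((u : ℤ) - (s : ℤ)) * (-1) ^ t * q ^ (a + s + u + t) *
      (c ^ (a + t) * σ ^ (u + s)) *
      (Complex.exp (-Complex.I * (((a + u : ℕ) : ℂ) - ((a + s + u + t : ℕ) : ℂ) / 2) * α) *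
        Complex.exp (-Complex.I * (((a + s : ℕ) : ℂ) - ((a + s + u + t : ℕ) : ℂ) / 2) * γ)) := by
  have hI : (-Complex.I) ^ s = (Complex.I ^ s)⁻¹ := by rw [← inv_pow, Complex.inv_I]
  have hz : Complex.I ^ ((u : ℤ) - (s : ℤ)) = Complex.I ^ u * (Complex.I ^ s)⁻¹ := by
    rw [zpow_sub₀ Complex.I_ne_zero, zpow_natCast, zpow_natCast, div_eq_mul_inv]
  have hexp : Complex.exp (-Complex.I * (((a + u : ℕ) : ℂ) - ((a + s + u + t : ℕ) : ℂ) / 2) * α) *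
        Complex.exp (-Complex.I * (((a + s : ℕ) : ℂ) - ((a + s + u + t : ℕ) : ℂ) / 2) * γ) =
      Complex.exp (-(Complex.I / 2) * (α + γ)) ^ a * Complex.exp ((Complex.I / 2) * (α - γ)) ^ s *
      Complex.exp (-(Complex.I / 2) * (α - γ)) ^ u *
      Complex.exp ((Complex.I / 2) * (α + γ)) ^ t := by
    simp only [← Complex.exp_nat_mul, ← Complex.exp_add]
    congr 1
    push_cast
    ring
  rw [hexp, hz, ← hI]
  have hneg : ∀ x : ℂ, (-x) ^ t = (-1) ^ t * x ^ t := fun x => neg_pow x t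
  rw [hneg]
  simp only [mul_pow, pow_add]
  ring

theorem sqrt_pow_eq_rpow {x : ℝ} (hx : 0 ≤ x) (N : ℕ) : Real.sqrt x ^ N = x ^ ((N : ℝ) / 2) := by
  rw [Real.sqrt_eq_rpow, ← Real.rpow_mul_natCast hx]
  congr 1
  ring

theorem eulerFun_basisElt_eq_sum (R : ℝ) (N i j : ℕ) (α β γ : ℝ) :
    eulerFun R (basisElt N i j) α β γ = (basisNorm N j : ℂ) *
      ∑ s ∈ Finset.range (N - j + 1), ((N - j).choose s : ℂ) *
        (((i.descFactorial s : ℂ) *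
          (eulerFun R (gen .ap) α β γ ^ (i - s) * eulerFun R (gen .bp) α β γ ^ s)) *
        (((N - i).descFactorial (N - j - s) : ℂ) *
          (eulerFun R (gen .bm) α β γ ^ (N - i - (N - j - s)) *
            (-eulerFun R (gen .am) α β γ) ^ (N - j - s)))) := by
  have hX : ∀ g, evalPt R (euler α β γ) (X g) = eulerFun R (gen g) α β γ := by
    intro g
    rw [eulerFun_eq_evalPt, comm_gen]
  rw [eulerFun_eq_evalPt, comm_basisElt, map_smul, map_sum, smul_eq_mul,
    Finset.Nat.sum_antidiagonal_eq_sum_range_succ_mk]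
  simp only [map_mul, map_pow, map_neg, map_natCast, hX]

/-- One term of Wigner's sum. The sign (-1)ᵗ from the powers of -a₋ agrees with the product of the
prefactor (-1)ᵘ⁺ᵗ and the (-1)ᵘ in Wigner's formula. -/
theorem basisElt_term {R : ℝ} (hR : 0 < R) (a s u t : ℕ) (α β γ : ℝ) :
    (basisNorm (a + s + u + t) (a + u) : ℂ) * (((s + t).choose s : ℂ) *
        ((((a + s).descFactorial s : ℂ) *
          (eulerFun R (gen .ap) α β γ ^ a * eulerFun R (gen .bp) α β γ ^ s)) *
        (((u + t).descFactorial t : ℂ) *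
          (eulerFun R (gen .bm) α β γ ^ u * (-eulerFun R (gen .am) α β γ) ^ t)))) =
    Complex.I ^ ((u : ℤ) - (s : ℤ)) * (-1) ^ (u + t) *
      (((2 * R) ^ (((a + s + u + t : ℕ) : ℝ) / 2) /
        Real.sqrt ((a + s + u + t).choose (a + s)) : ℝ) : ℂ) *
      (Complex.exp (-Complex.I * (((a + u : ℕ) : ℂ) - ((a + s + u + t : ℕ) : ℂ) / 2) * α) *
        ((Real.sqrt (((a + u).factorial : ℝ) * ((s + t).factorial : ℝ) *
          ((a + s).factorial : ℝ) * ((u + t).factorial : ℝ)) *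
          ((-1 : ℝ) ^ u * Real.cos (β / 2) ^ (a + t) * Real.sin (β / 2) ^ (u + s) /
            ((a.factorial : ℝ) * (s.factorial : ℝ) * (u.factorial : ℝ) *
              (t.factorial : ℝ))) : ℝ) : ℂ) *
        Complex.exp (-Complex.I * (((a + s : ℕ) : ℂ) - ((a + s + u + t : ℕ) : ℂ) / 2) * γ)) := by
  have h1 := congrArg (fun x : ℝ => (x : ℂ)) (basisNorm_mul a s u t)
  have h2 := monomial_phase a s u t (Real.sqrt (2 * R)) (Real.cos (β / 2)) (Real.sin (β / 2)) α γ
  rw [eulerFun_gen_ap, eulerFun_gen_am, eulerFun_gen_bp, eulerFun_gen_bm,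
    ← sqrt_pow_eq_rpow (by positivity)]
  have hs : ((-1 : ℂ) ^ u) * (-1) ^ u = 1 := by rw [← mul_pow]; simp
  simp only [Complex.ofReal_mul, Complex.ofReal_div, Complex.ofReal_natCast, Complex.ofReal_pow,
    Complex.ofReal_neg, Complex.ofReal_one] at h1 ⊢
  generalize (Real.sqrt (((a + u).factorial : ℝ) * ((s + t).factorial : ℝ) *
          ((a + s).factorial : ℝ) * ((u + t).factorial : ℝ)) : ℂ) = W at *
  generalize (Real.sqrt ((a + s + u + t).choose (a + s)) : ℂ) = V at *
  have hassoc : ∀ n c d A B e U T : ℂ, n * (c * ((d * (A * B)) * (e * (U * T)))) =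
      n * (c * (d * e)) * (A * B * (U * T)) := by intros; ring
  rw [hassoc, h1, h2, pow_add (-1 : ℂ) u t]
  generalize Complex.exp (-Complex.I * (((a + u : ℕ) : ℂ) - ((a + s + u + t : ℕ) : ℂ) / 2) * α) = E1
  generalize Complex.exp (-Complex.I * (((a + s : ℕ) : ℂ) - ((a + s + u + t : ℕ) : ℂ) / 2) * γ) = E2
  generalize (Real.cos (β / 2) : ℂ) ^ (a + t) = c
  generalize (Real.sin (β / 2) : ℂ) ^ (u + s) = σ
  generalize (Real.sqrt (2 * R) : ℂ) ^ (a + s + u + t) = q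
  generalize Complex.I ^ ((u : ℤ) - (s : ℤ)) = y
  generalize (-1 : ℂ) ^ u = z at *
  linear_combination (-(W / V / ((a.factorial : ℂ) * s.factorial * u.factorial * t.factorial) *
    (y * (-1) ^ t * q * (c * σ) * (E1 * E2)))) * hs

theorem eulerFun_basisElt {R : ℝ} (hR : 0 < R) {N i j : ℕ} (hi : i ≤ N) (hj : j ≤ N)
    (α β γ : ℝ) : eulerFun R (basisElt N i j) α β γ =
        Complex.I ^ ((j : ℤ) - (i : ℤ)) * (-1) ^ (N - i) *
          (((2 * R) ^ ((N : ℝ) / 2) / Real.sqrt (N.choose i) : ℝ) : ℂ) *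
          wignerD N j i α β γ := by
  rw [eulerFun_basisElt_eq_sum, wignerD, wignerSmallD, Finset.mul_sum, Finset.mul_sum,
    Complex.ofReal_sum, Finset.mul_sum, Finset.sum_mul, Finset.mul_sum]
  symm
  refine (Finset.sum_congr rfl fun s hs => ?_).trans
    (Finset.sum_subset (s₁ := (Finset.range (N + 1)).filter
      (fun s => s ≤ i ∧ i ≤ j + s ∧ s + j ≤ N)) (fun s hs => ?_) fun s hs hs' => ?_)
  -- On the range of Wigner's sum the exponents a = i - s, u = j + s - i and t = N - j - s are true
  -- differences.
  · obtain ⟨-, h1, h2, h3⟩ := Finset.mem_filter.1 hs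
    obtain ⟨a, rfl⟩ := Nat.exists_eq_add_of_le' h1
    obtain ⟨u, hu⟩ := Nat.exists_eq_add_of_le' h2
    obtain ⟨t, rfl⟩ := Nat.exists_eq_add_of_le' h3
    obtain rfl : j = a + u := by omega
    have e := basisElt_term hR a s u t α β γ
    have d1 : t + (s + (a + u)) = a + s + u + t := by omega
    have d2 : a + s + u + t - (a + u) = s + t := by omega
    have d3 : a + s + u + t - (a + s) = u + t := by omega
    have d4 : a + u + s - (a + s) = u := by omega
    have d5 : ((a + u : ℕ) : ℤ) - ((a + s : ℕ) : ℤ) = (u : ℤ) - (s : ℤ) := by push_cast; ring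
    rw [d1, d2, d3, d4, d5, Nat.add_sub_cancel, Nat.add_sub_cancel_left, Nat.add_sub_cancel]
    exact e.symm
  · obtain ⟨-, h1, h2, h3⟩ := Finset.mem_filter.1 hs
    exact Finset.mem_range.2 (by omega)
  · rw [Finset.mem_range] at hs
    -- The terms of the Leibniz sum outside Wigner's range contain a vanishing descending factorial.
    have h : i < s ∨ N - i < N - j - s := by
      by_contra! h
      refine hs' (Finset.mem_filter.2 ⟨Finset.mem_range.2 (by omega), h.1, ?_, ?_⟩) <;> omega
    rcases h with h | h <;> rw [Nat.descFactorial_of_lt h] <;> simp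

/-! ### The basis elements span `Ψ` -/

/-- The exponent of the monomial `a₊ᵃ b₊ˢ b₋ᵘ a₋ᵗ`. -/
def expo (a s u t : ℕ) : Gen →₀ ℕ :=
  Finsupp.single .ap a + Finsupp.single .bp s + Finsupp.single .bm u + Finsupp.single .am t

theorem expo_ap (a s u t : ℕ) : expo a s u t .ap = a := by simp [expo]

theorem expo_am (a s u t : ℕ) : expo a s u t .am = t := by simp [expo]

theorem expo_bp (a s u t : ℕ) : expo a s u t .bp = s := by simp [expo]

theorem expo_bm (a s u t : ℕ) : expo a s u t .bm = u := by simp [expo]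

theorem expo_self (m : Gen →₀ ℕ) : expo (m .ap) (m .bp) (m .bm) (m .am) = m := by
  ext g
  cases g
  · exact expo_ap ..
  · exact expo_am ..
  · exact expo_bp ..
  · exact expo_bm ..

theorem X_pow_eq_monomial_expo (a s u t : ℕ) (c : ℂ) :
    monomial (expo a s u t) c =
      C c * ((X .ap : CPoly) ^ a * X .bp ^ s * (X .bm ^ u * X .am ^ t)) := by
  rw [X_pow_eq_monomial, X_pow_eq_monomial, X_pow_eq_monomial, X_pow_eq_monomial, monomial_mul,
    monomial_mul, monomial_mul, C_mul_monomial, expo, add_assoc]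
  simp only [mul_one]

/-- The coefficients of the basis elements, up to the normalization. -/
def basisCoeff (N i j s t : ℕ) : ℂ :=
  ((N - j).choose s : ℂ) * (i.descFactorial s : ℂ) * ((N - i).descFactorial t : ℂ) * (-1) ^ t

theorem coeff_basisElt (N i j : ℕ) (m : Gen →₀ ℕ) : coeff m (comm (basisElt N i j)) =
    (basisNorm N j : ℂ) * ∑ st ∈ Finset.HasAntidiagonal.antidiagonal (N - j),
      if expo (i - st.1) st.1 (N - i - st.2) st.2 = m then basisCoeff N i j st.1 st.2 else 0 := by
  rw [comm_basisElt, coeff_smul, coeff_sum, smul_eq_mul]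
  refine congrArg _ (Finset.sum_congr rfl fun st _ => ?_)
  rw [← coeff_monomial, X_pow_eq_monomial_expo]
  congr 1
  simp only [basisCoeff, map_mul, map_pow, map_neg, map_one, map_natCast]
  rw [neg_pow (X Gen.am : CPoly)]
  ring

theorem basisNorm_pos (N j : ℕ) : 0 < basisNorm N j := by
  have hf : ∀ n : ℕ, (0 : ℝ) < n.factorial := fun n => by exact_mod_cast n.factorial_pos
  exact Real.sqrt_pos.2 (div_pos (hf _) (mul_pos (hf _) (hf _)))

theorem coeff_basisElt_ne_zero (a s u t : ℕ) :
    coeff (expo a s u t) (comm (basisElt (a + s + u + t) (a + s) (a + u))) ≠ 0 := by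
  have d2 : a + s + u + t - (a + u) = s + t := by omega
  have d3 : a + s + u + t - (a + s) = u + t := by omega
  have hmem : (s, t) ∈ Finset.HasAntidiagonal.antidiagonal (a + s + u + t - (a + u)) := by
    rw [d2, Finset.HasAntidiagonal.mem_antidiagonal]
  rw [coeff_basisElt, Finset.sum_eq_single_of_mem (s, t) hmem]
  · rw [if_pos (by rw [d3, Nat.add_sub_cancel, Nat.add_sub_cancel]), basisCoeff, d2, d3]
    have h1 : ((s + t).choose s : ℂ) ≠ 0 := by
      exact_mod_cast (Nat.choose_pos (Nat.le_add_right s t)).ne'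
    have h2 : ((a + s).descFactorial s : ℂ) ≠ 0 := by
      exact_mod_cast (Nat.descFactorial_pos.2 (Nat.le_add_left s a)).ne'
    have h3 : ((u + t).descFactorial t : ℂ) ≠ 0 := by
      exact_mod_cast (Nat.descFactorial_pos.2 (Nat.le_add_left t u)).ne'
    have h4 : (basisNorm (a + s + u + t) (a + u) : ℂ) ≠ 0 := by
      exact_mod_cast (basisNorm_pos _ _).ne'
    exact mul_ne_zero h4 (mul_ne_zero (mul_ne_zero (mul_ne_zero h1 h2) h3)
      (pow_ne_zero _ (by norm_num)))
  · intro st hst hne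
    rw [if_neg]
    intro h
    apply hne
    have e1 := DFunLike.congr_fun h Gen.bp
    have e2 := DFunLike.congr_fun h Gen.am
    rw [expo_bp, expo_bp] at e1
    rw [expo_am, expo_am] at e2
    exact Prod.ext e1 e2

/-- Monomials without the product `b₊b₋`. -/
def IsReduced (m : Gen →₀ ℕ) : Prop := m .bp = 0 ∨ m .bm = 0

/-- In all monomials of a basis element the exponents of b₊ and b₋ have the same difference s - u,
so just one of them is free of b₊b₋. -/
theorem eq_expo_of_coeff_ne_zero {a s u t : ℕ} (hsu : s = 0 ∨ u = 0) {m : Gen →₀ ℕ}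
    (hm : IsReduced m)
    (h : coeff m (comm (basisElt (a + s + u + t) (a + s) (a + u))) ≠ 0) : m = expo a s u t := by
  have d2 : a + s + u + t - (a + u) = s + t := by omega
  have d3 : a + s + u + t - (a + s) = u + t := by omega
  rw [coeff_basisElt] at h
  obtain ⟨⟨x, y⟩, hxy, hne⟩ := Finset.exists_ne_zero_of_sum_ne_zero (right_ne_zero_of_mul h)
  rw [d2, Finset.HasAntidiagonal.mem_antidiagonal] at hxy
  simp only [ne_eq, ite_eq_right_iff, Classical.not_imp] at hne hxy
  obtain ⟨rfl, hc⟩ := hne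
  rw [basisCoeff, d3] at hc
  have h1 : x ≤ a + s := by
    by_contra! hx
    exact hc (by rw [Nat.descFactorial_of_lt hx]; simp)
  have h2 : y ≤ u + t := by
    by_contra! hy
    exact hc (by rw [Nat.descFactorial_of_lt hy]; simp)
  rw [IsReduced, expo_bp, expo_bm, d3] at hm
  rw [d3]
  obtain ⟨rfl, rfl⟩ : x = s ∧ y = t := by omega
  rw [Nat.add_sub_cancel, Nat.add_sub_cancel]

/-- The equation Δf = 0 expresses the coefficient of a monomial containing b₊b₋ by the one in which
b₊b₋ is replaced by a₊a₋; induction on the exponent of b₊. -/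
theorem Harm.eq_zero_of_reduced {f : CPoly} (hf : f ∈ Harm)
    (h : ∀ m, IsReduced m → coeff m f = 0) : f = 0 := by
  have key : ∀ n (m : Gen →₀ ℕ), m .bp = n → coeff m f = 0 := by
    intro n
    induction n with
    | zero => exact fun m hm => h m (Or.inl hm)
    | succ n ih =>
      intro m hm
      by_cases h0 : m .bm = 0
      · exact h m (Or.inr h0)
      · obtain ⟨k, hk⟩ := Nat.exists_eq_succ_of_ne_zero h0
        have e := coeff_lap f (expo (m .ap) n k (m .am))
        rw [mem_Harm.1 hf, coeff_zero, ih _ (by simp [expo_bp]), mul_zero, zero_add] at e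
        have hm' : expo (m .ap) n k (m .am) + Finsupp.single .bp 1 + Finsupp.single .bm 1 = m := by
          ext g
          cases g <;> simp [expo_ap, expo_am, expo_bp, expo_bm, hm, hk]
        rw [hm'] at e
        refine (mul_eq_zero.1 e.symm).resolve_left ?_
        exact mul_ne_zero (Nat.cast_add_one_ne_zero _) (Nat.cast_add_one_ne_zero _)
  ext m
  rw [coeff_zero]
  exact key _ m rfl

/-- The basis elements as elements of `Ψ`. -/
def basisPsi (N i j : ℕ) : Psi := ⟨basisElt N i j, basisElt_mem_Psi N i j⟩

/-- The basis element with a given reduced leading monomial. -/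
def leadBasis (m : Gen →₀ ℕ) : Psi :=
  basisPsi (m .ap + m .bp + m .bm + m .am) (m .ap + m .bp) (m .ap + m .bm)

/-- Harmonic polynomials are determined by their reduced coefficients, and each basis element
`leadBasis m` has `m` as its only reduced monomial. Matching the reduced coefficients of ξ thus
expands ξ. -/
theorem span_basisPsi : Submodule.span ℂ
    {ξ | ∃ N i j, i ≤ N ∧ j ≤ N ∧ ξ = basisPsi N i j} = ⊤ := by
  classical
  rw [eq_top_iff]
  intro ξ _
  set L : (Gen →₀ ℕ) → CPoly := fun m => comm (leadBasis m) with hL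
  have hne : ∀ m, coeff m (L m) ≠ 0 := by
    intro m
    have := coeff_basisElt_ne_zero (m .ap) (m .bp) (m .bm) (m .am)
    rwa [expo_self] at this
  have hz : ∀ m m', IsReduced m → IsReduced m' → m' ≠ m → coeff m' (L m) = 0 := by
    intro m m' hm hm' hmm
    by_contra hc
    exact hmm ((eq_expo_of_coeff_ne_zero hm hm' hc).trans (expo_self m))
  set S := (comm (ξ : FreePoly)).support.filter IsReduced with hS
  set η : Psi := ∑ m ∈ S, (coeff m (comm (ξ : FreePoly)) / coeff m (L m)) • leadBasis m with hη
  have hcη : comm (η : FreePoly) =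
      ∑ m ∈ S, (coeff m (comm (ξ : FreePoly)) / coeff m (L m)) • L m := by
    rw [hη, Submodule.coe_sum, map_sum]
    refine Finset.sum_congr rfl fun m _ => ?_
    rw [Submodule.coe_smul, map_smul]
  have h0 : comm ((ξ - η : Psi) : FreePoly) = 0 := by
    refine Harm.eq_zero_of_reduced (psiEquiv (ξ - η)).2 fun m hm => ?_
    rw [Submodule.coe_sub, map_sub, coeff_sub, hcη, coeff_sum]
    simp only [coeff_smul, smul_eq_mul]
    by_cases hmS : m ∈ S
    · rw [Finset.sum_eq_single_of_mem m hmS, div_mul_cancel₀ _ (hne m), sub_self]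
      intro m' hm' hmm
      rw [hz m' m (Finset.mem_filter.1 hm').2 hm hmm.symm, mul_zero]
    · rw [Finset.sum_eq_zero, sub_zero]
      · by_contra hc
        exact hmS (Finset.mem_filter.2 ⟨mem_support_iff.2 hc, hm⟩)
      · intro m' hm'
        rw [hz m' m (Finset.mem_filter.1 hm').2 hm, mul_zero]
        rintro rfl
        exact hmS hm'
  have h1 : ξ = η := by
    rw [← sub_eq_zero]
    refine Subtype.ext (comm_injOn_symm (ξ - η).2.1 (0 : Psi).2.1 ?_)
    rw [h0, ZeroMemClass.coe_zero, map_zero]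
  rw [h1]
  refine Submodule.sum_mem _ fun m _ => Submodule.smul_mem _ _ (Submodule.subset_span ?_)
  exact ⟨_, _, _, by omega, by omega, rfl⟩

/-! ### The number operator -/

theorem degOp_mem_Psi {ξ : FreePoly} (h : ξ ∈ Psi) : degOp ξ ∈ Psi := by
  refine ⟨IsSymm.degOp h.1, fun l => ?_⟩
  have e : traceCoeff (degOp ξ) l = (l.length + 2) * traceCoeff ξ l := by
    simp only [traceCoeff, wordCoeff_degOp, List.length_append, List.length_cons, List.length_nil]
    push_cast
    ring
  rw [e, h.2 l, mul_zero]

/-- Lowering replaces one letter by another and so preserves the length of words. -/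
theorem degOp_lower (ξ : FreePoly) : degOp (lower ξ) = lower (degOp ξ) := by
  have hgen : ∀ g, degOp (gen g) = gen g := fun g => by
    rw [gen, degOp_word]; simp
  have hlow : ∀ g, degOp (lowerGen g) = lowerGen g := by
    intro g
    cases g <;> simp [lowerGen, hgen]
  induction ξ using word_induction with
  | h l =>
    rw [degOp_word, lower_smul, lower_word]
    induction l with
    | nil => simp [lowerWord]
    | cons g l ih =>
      rw [lowerWord, map_add, degOp_mul, degOp_mul, hlow, hgen, degOp_word, ih, List.length_cons]
      push_cast
      rw [mul_smul_comm, mul_smul_comm]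
      module
  | hadd a b ha hb => rw [lower_add, map_add, ha, hb, map_add, lower_add]
  | hsmul c a ha => rw [lower_smul, map_smul, ha, map_smul, lower_smul]

theorem degOp_topMonomial (x y : ℕ) :
    degOp (topMonomial x y) = ((x + y : ℕ) : ℂ) • topMonomial x y := by
  apply freePoly_ext
  intro l
  rw [wordCoeff_degOp, wordCoeff_smul, wordCoeff_topMonomial]
  split_ifs with h
  · rw [h.2.1]
  · rw [mul_zero, mul_zero]

theorem degOp_basisElt {N i : ℕ} (j : ℕ) (hi : i ≤ N) :
    degOp (basisElt N i j) = (N : ℂ) • basisElt N i j := by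
  have h : ∀ k, degOp (lower^[k] (topMonomial i (N - i))) =
      (N : ℂ) • lower^[k] (topMonomial i (N - i)) := by
    intro k
    induction k with
    | zero =>
      rw [Function.iterate_zero, id, degOp_topMonomial, Nat.add_sub_cancel' hi]
    | succ k ih => rw [Function.iterate_succ_apply', degOp_lower, ih, lower_smul]
  rw [basisElt, map_smul, h, smul_comm]

/-- The number operator: half of the degree. -/
def numberOp : Psi →ₗ[ℂ] Psi := (1 / 2 : ℂ) • degOp.restrict fun _ h => degOp_mem_Psi h

theorem numberOp_coe (ξ : Psi) : (numberOp ξ : FreePoly) = (1 / 2 : ℂ) • degOp ξ := rfl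

theorem isNumberOperator_numberOp : IsNumberOperator numberOp := by
  intro N i j hi _ ξ hξ
  apply Subtype.ext
  rw [numberOp_coe, hξ, degOp_basisElt j hi, Submodule.coe_smul, hξ, smul_smul]
  congr 1
  ring

theorem IsNumberOperator.eq_numberOp {δ : Psi →ₗ[ℂ] Psi} (h : IsNumberOperator δ) :
    δ = numberOp := by
  refine LinearMap.ext_on span_basisPsi ?_
  rintro ξ ⟨N, i, j, hi, hj, rfl⟩
  rw [h N i j hi hj _ rfl, isNumberOperator_numberOp N i j hi hj _ rfl]

theorem bracketRHS_numberOp (R : ℝ) (ξ ζ : Psi) (α β γ : ℝ) :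
    bracketRHS R numberOp ξ ζ α β γ = ptBracket R α β γ ξ ζ := by
  have h : ∀ ξ : Psi, eulerFun R (numberOp ξ) α β γ = dNumber R α β γ ξ := fun ξ => by
    rw [numberOp_coe, eulerFun_smul, dNumber_apply]
  rw [ptBracket, ← h, ← h]
  rfl

end FuzzySU2

end

theorem mainTheorem6 (R : ℝ) (hR : 0 < R) :
    -- the projection onto `Ψ` along `{w (K₀ - R̂)}` is well defined for every `ε`
    (∀ (ε : ℝ) (w : Weyl ε), ∃! ξ : Psi, InKerRho ε R (w - toWeyl ε ξ)) ∧
    -- the `P(n,r,m)` lie in `Ψ` and, for `ε ≠ 0`, are given in `𝒲(ε)` by iterated commutators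
    (∀ N i j : ℕ, i ≤ N → j ≤ N → basisElt N i j ∈ Psi ∧
      ∀ ε : ℝ, ε ≠ 0 → toWeyl ε (basisElt N i j) =
        (((ε : ℂ) ^ (-((N - j : ℕ) : ℤ))) * (basisNorm N j : ℂ)) •
          (fun w : Weyl ε => Jminus ε * w - w * Jminus ε)^[N - j]
            (toWeyl ε (gen .ap) ^ i * toWeyl ε (gen .bm) ^ (N - i))) ∧
    -- the product and the form depend continuously on `ε` at `ε = 0`
    (∀ ξ ζ : Psi, PsiTendsto (fun ε => prodRho ε R ξ ζ) (𝓝 0) (prodRho 0 R ξ ζ)) ∧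
    (∀ ξ ζ : Psi, Filter.Tendsto (fun ε => form ε R ξ ζ) (𝓝 0) (𝓝 (form 0 R ξ ζ))) ∧
    -- at `ε = 0`, `(Ψ, ρ)` is the algebra of polynomial functions on `SU(2)`
    (∃ e : Psi ≃ₗ[ℂ] polyFun, (∀ ξ : Psi, (e ξ : SU2 → ℂ) = evalSU2 R ξ) ∧
      ∀ ξ ζ : Psi, e (prodRho 0 R ξ ζ) = e ξ * e ζ) ∧
    -- Euler angles and the generators
    (∀ g : SU2, ∃ α ∈ Set.Ico 0 (2 * Real.pi), ∃ β ∈ Set.Icc 0 Real.pi,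
      ∃ γ ∈ Set.Ico 0 (4 * Real.pi), euler α β γ = g) ∧
    (∀ α β γ : ℝ,
      eulerFun R (gen .ap) α β γ = (Real.sqrt (2 * R) : ℂ) * (Real.cos (β / 2) : ℂ) *
        Complex.exp (-(Complex.I / 2) * (α + γ)) ∧
      eulerFun R (gen .am) α β γ = (Real.sqrt (2 * R) : ℂ) * (Real.cos (β / 2) : ℂ) *
        Complex.exp ((Complex.I / 2) * (α + γ)) ∧
      eulerFun R (gen .bp) α β γ = -Complex.I * (Real.sqrt (2 * R) : ℂ) *
        (Real.sin (β / 2) : ℂ) * Complex.exp ((Complex.I / 2) * (α - γ)) ∧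
      eulerFun R (gen .bm) α β γ = Complex.I * (Real.sqrt (2 * R) : ℂ) *
        (Real.sin (β / 2) : ℂ) * Complex.exp (-(Complex.I / 2) * (α - γ))) ∧
    -- the basis elements are multiples of the rotation matrix entries
    (∀ N i j : ℕ, i ≤ N → j ≤ N → ∀ α β γ : ℝ,
      eulerFun R (basisElt N i j) α β γ =
        Complex.I ^ ((j : ℤ) - (i : ℤ)) * (-1) ^ (N - i) *
          (((2 * R) ^ ((N : ℝ) / 2) / Real.sqrt (N.choose i) : ℝ) : ℂ) *
          wignerD N j i α β γ) ∧
    -- the form is an inner product, given by the normalized integral over `SU(2)`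
    (∀ ξ ζ : Psi, form 0 R ξ ζ = starRingEnd ℂ (form 0 R ζ ξ)) ∧
    (∀ ξ : Psi, ξ ≠ 0 → 0 < (form 0 R ξ ξ).re ∧ (form 0 R ξ ξ).im = 0) ∧
    (∀ ξ ζ : Psi, form 0 R ξ ζ = (1 / (16 * (Real.pi : ℂ) ^ 2)) *
      ∫ α in (0 : ℝ)..(2 * Real.pi), ∫ γ in (0 : ℝ)..(4 * Real.pi), ∫ β in (0 : ℝ)..Real.pi,
        (Real.sin β : ℂ) * starRingEnd ℂ (eulerFun R ξ α β γ) * eulerFun R ζ α β γ) ∧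
    (∀ (k : ℕ) (ξ ζ : Psi), HasParity ξ k → HasParity ζ k →
      form 0 R ξ ζ = (1 / (8 * (Real.pi : ℂ) ^ 2)) *
        ∫ α in (0 : ℝ)..(2 * Real.pi), ∫ γ in (0 : ℝ)..(2 * Real.pi), ∫ β in (0 : ℝ)..Real.pi,
          (Real.sin β : ℂ) * starRingEnd ℂ (eulerFun R ξ α β γ) * eulerFun R ζ α β γ) ∧
    -- the number operator and the bracket
    (∃! δ : Psi →ₗ[ℂ] Psi, IsNumberOperator δ) ∧
    (∀ δ : Psi →ₗ[ℂ] Psi, IsNumberOperator δ → ∀ ξ ζ : Psi, ∃ η : Psi,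
      PsiTendsto (fun ε => (1 / (Complex.I * (ε : ℂ))) •
        rho ε R (toWeyl ε ξ * toWeyl ε ζ - toWeyl ε ζ * toWeyl ε ξ)) (𝓝[≠] 0) η ∧
      ∀ α β γ : ℝ, Real.sin β ≠ 0 →
        eulerFun R η α β γ = bracketRHS R δ ξ ζ α β γ) := by
  refine ⟨fun ε w => exists_unique_rho ε R w, fun N i j _ _ => ⟨basisElt_mem_Psi N i j,
    fun ε hε => toWeyl_basisElt hε N i j⟩, prodRho_tendsto R, form_tendsto R,
    exists_polyFun_equiv hR, exists_euler, fun α β γ => ⟨eulerFun_gen_ap R α β γ,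
    eulerFun_gen_am R α β γ, eulerFun_gen_bp R α β γ, eulerFun_gen_bm R α β γ⟩,
    fun N i j hi hj α β γ => eulerFun_basisElt hR hi hj α β γ, form_conj hR, form_self_pos hR,
    form_eq_integral hR, form_eq_integral_of_parity hR,
    ⟨numberOp, isNumberOperator_numberOp, fun δ hδ => IsNumberOperator.eq_numberOp hδ⟩,
    fun δ hδ ξ ζ => ?_⟩
  obtain ⟨η, h1, h2⟩ := exists_bracket hR ξ ζ
  refine ⟨η, h1, fun α β γ hβ => ?_⟩
  rw [h2 α β γ hβ, IsNumberOperator.eq_numberOp hδ, bracketRHS_numberOp]
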